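/- **Setting.** Let $(\mathcal X,\mathcal B)$ be a measurable space with $\mathcal B$ countably generated, let $P$ be a Markov transition kernel on $\mathcal X$ with invariant probability measure $\pi$, and write $\mathbf P_x$ for the law of the chain $(X_k)_{k\ge 0}$ started at $x$. Assume that the chain is Harris recurrent (every $A\in\mathcal B$ with $\pi(A)>0$ is visited infinitely often $\mathbf P_x$-almost surely, for every $x$) and strongly aperiodic: there are $C\in\mathcal B$ with $\pi(C)>0$, $\delta>0$ and a probability measure $\nu$ with $\nu(C)>0$ such that $P(x,B)\ge\delta\nu(B)$ for all $x\in C$, $B\in\mathcal B$. Let $(X_k,Y_k)_{k\ge0}$, $Y_k\in\{0,1\}$, be the split chain: given $X_k=x$ (and the past), $Y_k=1$ with probability $\delta 1_C(x)$; given $Y_k=1$, $X_{k+1}$ has law $\nu$; given $X_k=x$ and $Y_k=0$, $X_{k+1}$ has law $(P(x,\cdot)-\delta\nu)/(1-\delta)$ if $x\in C$ and $P(x,\cdot)$ if $x\notin C$. For a probability measure $\mu$ on $\mathcal X$, let $\mu^*$ be the law of $(X_0,Y_0)$ when $X_0\sim\mu$, let $\bar{\mathbf P}_{\mu^*}$ be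 the law of the split chain with this initial law, and $x^*=\delta_x^*$. Let $\theta=C\times\{1\}$, so $\pi^*(\theta)=\delta\pi(C)$, and let $\sigma(0)<\sigma(1)<\dots$ be the successive times $k\ge0$ at which $Y_k=1$. For measurable $f:\mathcal X\to\mathbb R$ put $s_i(f)=\sum_{j=\sigma(i)+1}^{\sigma(i+1)}f(X_j)$; the law of $s_i(f)$ depends neither on $i$ nor on the initial law. With $\|Y\|_{\psi_\alpha}=\inf\{c>0:\mathbf E\exp(|Y|^\alpha/c^\alpha)\le2\}$ and $\alpha\in(0,1]$, define $$\mathbf a=\Big\|\sum_{k=0}^{\sigma(0)}|f(X_k)|\Big\|_{\psi_\alpha,\bar{\mathbf P}_{x^*}},\quad \mathbf b=\Big\|\sum_{k=0}^{\sigma(0)}|f(X_k)|\Big\|_{\psi_\alpha,\bar{\mathbf P}_{\pi^*}},\quad \mathbf c=\|s_0(f)\|_{\psi_\alpha},\quad \mathbf d=\|\sigma(0)+1\|_{\psi_1,\bar{\mathbf P}_{\nu^*}}.$$ Assume that the chain is geometrically ergodic, in the sense that $\mathbf d<\infty$. **Theorem.** Let $\alpha\in(0,1]$, $x\in\mathcal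 X$, and let $f:\mathcal X\to\mathbb R$ be measurable with $\mathbf a,\mathbf b,\mathbf c<\infty$ and $\int f\,d\pi=0$. Let $p,q>1$ with $p^{-1}+q^{-1}=1$ and $\varepsilon\in(0,1)$. Then for every integer $n\ge0$ and all $t\ge0$, $$\begin{aligned}\mathbf P_x\Big(\Big|\sum_{i=0}^{n-1}f(X_i)\Big|>t\Big)\le{}&2\exp\Big(-\frac{(tp^{-1})^\alpha}{(2\mathbf a)^\alpha}\Big)+2\pi^*(\theta)^{-1}\exp\Big(-\frac{(tp^{-1})^\alpha}{(2\mathbf b)^\alpha}\Big)+e^8\exp\Big(-\frac{(p^{-1}q^{-1}t)^\alpha}{2\mathbf c^\alpha}\Big)\\&+2^{1+\varepsilon/(1+\varepsilon)}\exp\Big(-\frac{q^{-4}t^2}{2\big((1+\varepsilon)\sigma^2n+M(\varepsilon)tq^{-2}\big)}\Big),\end{aligned}$$ where $\sigma^2=\pi^*(\theta)\,\mathbf E s_0(f)^2$ and $$M(\varepsilon)=\max\Big(\frac{4\mathbf c(3\alpha^{-2}\log(n\vee e))^{1/\alpha}(1+\varepsilon)}{3},\ \frac{12\,\pi^*(\theta)\,\mathbf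 d\,(1+\varepsilon)\,(\mathbf E s_0(f)^2)^{1/2}}{\varepsilon}\Big).$$ If a denominator in an exponent is $0$, the exponential is read as $0$ for $t>0$ and as $1$ for $t=0$. -/

import Mathlib

open MeasureTheory ProbabilityTheory
open scoped ENNReal NNReal

namespace MarkovBernstein

/-- The law on path space of the time-homogeneous Markov chain with transition kernel `κ` and
initial distribution `μ`. For `μ = Measure.dirac x` this is the law of the chain started at `x`. -/
noncomputable def chainLaw {S : Type*} [MeasurableSpace S] (κ : Kernel S S) [IsMarkovKernel κ]
    (μ : Measure S) : Measure (ℕ → S) :=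
  Kernel.trajMeasure (X := fun _ => S) μ
    (fun n => κ.comap (fun h : (i : Finset.Iic n) → S => h ⟨n, by simp⟩) (by fun_prop))

/-- Harris recurrence of a chain with invariant probability `π`: every measurable set of positive
`π`-measure is visited infinitely often, almost surely, from every starting point. -/
def IsHarrisRecurrent {S : Type*} [MeasurableSpace S] (P : Kernel S S) [IsMarkovKernel P]
    (π : Measure S) : Prop :=
  ∀ A : Set S, MeasurableSet A → 0 < π A →
    ∀ x : S, ∀ᵐ ω ∂(chainLaw P (Measure.dirac x)), ∃ᶠ k in Filter.atTop, ω k ∈ A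

/-- The exponential Orlicz norm
`‖Y‖_{ψ_α, μ} = inf {c > 0 : 𝔼_μ exp (|Y|^α / c^α) ≤ 2}`, equal to `∞` if there is no such `c`. -/
noncomputable def psiNorm {Ω : Type*} [MeasurableSpace Ω] (α : ℝ) (μ : Measure Ω) (Y : Ω → ℝ) :
    ℝ≥0∞ :=
  ⨅ (c : ℝ) (_ : 0 < c)
    (_ : ∫⁻ ω, ENNReal.ofReal (Real.exp (|Y ω| ^ α / c ^ α)) ∂μ ≤ 2), ENNReal.ofReal c

/-- `exp (-u)` for `u ∈ [0, ∞]`, with `exp (-∞) = 0`. -/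
noncomputable def expNeg (u : ℝ≥0∞) : ℝ≥0∞ :=
  if u = ∞ then 0 else ENNReal.ofReal (Real.exp (-u.toReal))

/-- Strong aperiodicity: the one-step small set condition
`P(x, B) ≥ δ ν(B)` for `x ∈ C` and measurable `B`, with `ν` a probability measure such that
`ν(C) > 0`, and `δ > 0`. (Necessarily `δ ≤ 1` if `C` is non-empty.) -/
structure Minorization {S : Type*} [MeasurableSpace S] (P : Kernel S S) where
  /-- the small set -/
  C : Set S
  measurableSet_C : MeasurableSet C
  /-- the minorizing measure -/
  ν : Measure S
  isProbabilityMeasure_ν : IsProbabilityMeasure ν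
  ν_C_pos : 0 < ν C
  /-- the minorization constant -/
  δ : ℝ≥0
  δ_pos : 0 < δ
  minor : ∀ x ∈ C, ∀ B : Set S, MeasurableSet B → (δ : ℝ≥0∞) * ν B ≤ P x B

namespace Minorization

variable {S : Type*} [MeasurableSpace S] {P : Kernel S S}

instance (D : Minorization P) : IsProbabilityMeasure D.ν := D.isProbabilityMeasure_ν

lemma δ_le_one [IsMarkovKernel P] (D : Minorization P) : (D.δ : ℝ≥0∞) ≤ 1 := by
  obtain ⟨x, hx⟩ : D.C.Nonempty := by
    by_contra h
    have := D.ν_C_pos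
    simp [Set.not_nonempty_iff_eq_empty.1 h] at this
  simpa using D.minor x hx Set.univ MeasurableSet.univ

lemma smul_ν_le (D : Minorization P) {x : S} (hx : x ∈ D.C) : (D.δ : ℝ≥0∞) • D.ν ≤ P x :=
  Measure.le_intro fun B hB _ => by simpa using D.minor x hx B hB

open Classical in
/-- Given `X_k = x`, the probability `δ 1_C(x)` of the event `Y_k = 1`. -/
noncomputable def regenProb (D : Minorization P) (x : S) : ℝ≥0∞ := if x ∈ D.C then D.δ else 0

lemma measurable_regenProb (D : Minorization P) : Measurable D.regenProb :=
  Measurable.ite D.measurableSet_C measurable_const measurable_const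

lemma regenProb_le_one [IsMarkovKernel P] (D : Minorization P) (x : S) : D.regenProb x ≤ 1 := by
  unfold regenProb
  split_ifs
  · exact D.δ_le_one
  · exact zero_le_one

/-- The kernel attaching to `x` the level `Y ∈ {0, 1}` (coded by `Bool`), where `Y = 1` has
probability `δ 1_C(x)`; it sends `x` to the split `δ_x^*` of the Dirac mass at `x`. -/
noncomputable def splitKernel (D : Minorization P) : Kernel S (S × Bool) where
  toFun x := D.regenProb x • Measure.dirac (x, true)
    + (1 - D.regenProb x) • Measure.dirac (x, false)
  measurable' := by
    refine Measure.measurable_of_measurable_coe _ fun B hB => ?_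
    simp only [Measure.add_apply, Measure.smul_apply, smul_eq_mul, Measure.dirac_apply' _ hB]
    have h1 : ∀ b : Bool, Measurable fun x : S => B.indicator (1 : S × Bool → ℝ≥0∞) (x, b) :=
      fun b => (measurable_one.indicator hB).comp (by fun_prop : Measurable fun x : S => (x, b))
    exact (D.measurable_regenProb.mul (h1 true)).add
      ((measurable_const.sub D.measurable_regenProb).mul (h1 false))

instance [IsMarkovKernel P] (D : Minorization P) : IsMarkovKernel D.splitKernel :=
  ⟨fun x => ⟨by
    change (D.regenProb x • Measure.dirac (x, true)
      + (1 - D.regenProb x) • Measure.dirac (x, false)) Set.univ = 1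
    simp [add_tsub_cancel_of_le (D.regenProb_le_one x)]⟩⟩

/-- The split `μ^*` of a measure `μ`:
`μ^*(A × {1}) = δ μ(A ∩ C)` and `μ^*(A × {0}) = (1 - δ) μ(A ∩ C) + μ(A ∩ Cᶜ)`. -/
noncomputable def split (D : Minorization P) (μ : Measure S) : Measure (S × Bool) :=
  μ.bind D.splitKernel

open Classical in
/-- The residual kernel: `(P(x, ·) - δ ν) / (1 - δ)` for `x ∈ C` and `P(x, ·)` for `x ∉ C`. It is
the law of `X_{k+1}` given `X_k = x` and `Y_k = 0`. (If `δ = 1` and `x ∈ C`, then `Y_k = 0` has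
probability zero, and the value is irrelevant.) -/
noncomputable def residual [IsMarkovKernel P] (D : Minorization P) : Kernel S S where
  toFun x := if x ∈ D.C ∧ D.δ < 1 then (1 - (D.δ : ℝ≥0∞))⁻¹ • (P x - (D.δ : ℝ≥0∞) • D.ν) else P x
  measurable' := by
    refine Measure.measurable_of_measurable_coe _ fun B hB => ?_
    have h : (fun x => (if x ∈ D.C ∧ D.δ < 1 then
          (1 - (D.δ : ℝ≥0∞))⁻¹ • (P x - (D.δ : ℝ≥0∞) • D.ν) else P x) B)
        = fun x => if x ∈ D.C ∧ D.δ < 1 then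
          (1 - (D.δ : ℝ≥0∞))⁻¹ * (P x B - (D.δ : ℝ≥0∞) * D.ν B) else P x B := by
      funext x
      split_ifs with hx
      · have : IsFiniteMeasure ((D.δ : ℝ≥0∞) • D.ν) := Measure.smul_finite _ (by simp)
        rw [Measure.smul_apply, Measure.sub_apply hB (D.smul_ν_le hx.1)]
        simp
      · rfl
    rw [h]
    refine Measurable.ite ?_ ?_ (P.measurable_coe hB)
    · by_cases hd : D.δ < 1
      · simpa [hd] using D.measurableSet_C
      · simp [hd]
    · exact measurable_const.mul ((P.measurable_coe hB).sub measurable_const)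

instance [IsMarkovKernel P] (D : Minorization P) : IsMarkovKernel D.residual :=
  ⟨fun x => ⟨by
    classical
    change (if x ∈ D.C ∧ D.δ < 1 then
      (1 - (D.δ : ℝ≥0∞))⁻¹ • (P x - (D.δ : ℝ≥0∞) • D.ν) else P x) Set.univ = 1
    split_ifs with hx
    · have : IsFiniteMeasure ((D.δ : ℝ≥0∞) • D.ν) := Measure.smul_finite _ (by simp)
      rw [Measure.smul_apply, Measure.sub_apply MeasurableSet.univ (D.smul_ν_le hx.1)]
      have h1 : (D.δ : ℝ≥0∞) < 1 := by exact_mod_cast hx.2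
      simp only [Measure.smul_apply, measure_univ, smul_eq_mul, mul_one]
      exact ENNReal.inv_mul_cancel (tsub_pos_of_lt h1).ne'
        (ENNReal.sub_ne_top ENNReal.one_ne_top)
    · simp⟩⟩

/-- The law of `X_{k+1}` given `(X_k, Y_k) = (x, y)` in the split chain: `ν` after `y = 1`, and the
residual kernel at `x` after `y = 0`. (A pair `(x, 1)` with `x ∉ C` is never visited.) -/
noncomputable def moveKernel [IsMarkovKernel P] (D : Minorization P) : Kernel (S × Bool) S where
  toFun z := if z.2 = true then D.ν else D.residual z.1
  measurable' := Measurable.ite (measurable_snd (measurableSet_singleton true)) measurable_const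
    (D.residual.measurable.comp measurable_fst)

instance [IsMarkovKernel P] (D : Minorization P) : IsMarkovKernel D.moveKernel :=
  ⟨fun z => by
    change IsProbabilityMeasure (if z.2 = true then D.ν else D.residual z.1)
    split_ifs <;> infer_instance⟩

/-- The transition kernel of the split chain `(X_k, Y_k)` on `S × {0, 1}`. -/
noncomputable def splitChain [IsMarkovKernel P] (D : Minorization P) :
    Kernel (S × Bool) (S × Bool) :=
  D.splitKernel ∘ₖ D.moveKernel

instance [IsMarkovKernel P] (D : Minorization P) : IsMarkovKernel D.splitChain := by
  unfold splitChain; infer_instance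

/-- The law of the split chain when `X_0` has law `μ`, i.e. when `(X_0, Y_0)` has law `μ^*`. -/
noncomputable def splitLaw [IsMarkovKernel P] (D : Minorization P) (μ : Measure S) :
    Measure (ℕ → S × Bool) :=
  chainLaw D.splitChain (D.split μ)

/-- The atom `θ = C × {1}` of the split chain. -/
def atom (D : Minorization P) : Set (S × Bool) := D.C ×ˢ {true}

end Minorization

section Excursions

variable {S : Type*}

/-- The regeneration times `σ(0) < σ(1) < ...` of a path of the split chain: `σ(i)` is the `i`-th
time `k ≥ 0` (counted from `i = 0`) at which `Y_k = 1`. -/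
noncomputable def regenTime (i : ℕ) (w : ℕ → S × Bool) : ℕ := Nat.nth (fun k => (w k).2 = true) i

/-- The sum `∑_{k=0}^{σ(0)} |f(X_k)|`. -/
noncomputable def firstBlockAbs (f : S → ℝ) (w : ℕ → S × Bool) : ℝ :=
  ∑ k ∈ Finset.range (regenTime 0 w + 1), |f (w k).1|

/-- The excursion sum `s_i(f) = ∑_{j=σ(i)+1}^{σ(i+1)} f(X_j)`. -/
noncomputable def blockSum (f : S → ℝ) (i : ℕ) (w : ℕ → S × Bool) : ℝ :=
  ∑ j ∈ Finset.Ioc (regenTime i w) (regenTime (i + 1) w), f (w j).1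

end Excursions

namespace Minorization

variable {S : Type*} [MeasurableSpace S] {P : Kernel S S} [IsMarkovKernel P]

/-- `𝐚 = ‖∑_{k=0}^{σ} |f(X_k)|‖_{ψ_α}` for the split chain started at `x^*`. -/
noncomputable def paramA (D : Minorization P) (α : ℝ) (f : S → ℝ) (x : S) : ℝ≥0∞ :=
  psiNorm α (D.splitLaw (Measure.dirac x)) (firstBlockAbs f)

/-- `𝐛 = ‖∑_{k=0}^{σ} |f(X_k)|‖_{ψ_α}` for the split chain started from `π^*`. -/
noncomputable def paramB (D : Minorization P) (α : ℝ) (f : S → ℝ) (π : Measure S) : ℝ≥0∞ :=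
  psiNorm α (D.splitLaw π) (firstBlockAbs f)

/-- `𝐜 = ‖s_0(f)‖_{ψ_α}`. For a recurrent chain the law of `s_i(f)` depends neither on `i` nor on
the initial distribution; the chain is started from `ν^*` here. -/
noncomputable def paramC (D : Minorization P) (α : ℝ) (f : S → ℝ) : ℝ≥0∞ :=
  psiNorm α (D.splitLaw D.ν) (blockSum f 0)

/-- `𝐝 = ‖σ(0) + 1‖_{ψ_1}` for the split chain started from `ν^*`. -/
noncomputable def paramD (D : Minorization P) : ℝ≥0∞ :=
  psiNorm 1 (D.splitLaw D.ν) (fun w => (regenTime 0 w : ℝ) + 1)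

/-- Geometric ergodicity: the regeneration time has an exponential moment, `𝐝 < ∞`. -/
def IsGeometricallyErgodic (D : Minorization P) : Prop := D.paramD < ∞

/-- The block variance `𝔼 s_0(f)²` (`s_0(f)` has mean zero when `π f = 0`). -/
noncomputable def blockVar (D : Minorization P) (f : S → ℝ) : ℝ≥0∞ :=
  ∫⁻ w, ENNReal.ofReal (blockSum f 0 w ^ 2) ∂(D.splitLaw D.ν)

/-- `σ² = π^*(θ) 𝔼 s_0(f)²`. -/
noncomputable def asympVar (D : Minorization P) (π : Measure S) (f : S → ℝ) : ℝ≥0∞ :=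
  D.split π D.atom * D.blockVar f

/-- `M(ε) = max (4 𝐜 (3 α⁻² log n)^{1/α} (1 + ε) / 3, 12 π^*(θ) 𝐝 (1 + ε) (𝔼 s_0(f)²)^{1/2} / ε)`,
with the convention `log n := log (max n e)`. -/
noncomputable def paramM (D : Minorization P) (π : Measure S) (α : ℝ) (f : S → ℝ) (n : ℕ) (ε : ℝ) :
    ℝ≥0∞ :=
  max
    (4 * D.paramC α f
      * ENNReal.ofReal ((3 * (α ^ 2)⁻¹ * Real.log (max (n : ℝ) (Real.exp 1))) ^ (1 / α))
      * ENNReal.ofReal (1 + ε) / 3)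
    (12 * D.split π D.atom * D.paramD * ENNReal.ofReal (1 + ε) * D.blockVar f ^ (1 / 2 : ℝ)
      / ENNReal.ofReal ε)

end Minorization

end MarkovBernstein

open MarkovBernstein

/-! The first coordinate of the split chain is the original chain (`map_fst_splitLaw`), and the
times with Y = 1 cut its path into cycles. These are independent (`iIndepFun_cycleData`), and all
but the first have the law of a cycle started from ν^*. Harris recurrence ensures that there are
infinitely many of them (`ae_frequently_regen`).

By `sum_range_eq_cycles`, the sum up to time n equals the first cycle, plus the full sums of all
later cycles that start no later than n, minus the overshoot from time n to the end of the cycle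
then running. Each of the two boundary terms is allotted t/(2p), the middle sum t/q. The first cycle
is governed by a. For the overshoot, a decomposition at the last regeneration before n and the
occupation formula bound the probability of any event about the path after n by π^*(θ)⁻¹ times its
stationary probability (`measure_compl_noRegen_inter_shift_le`), which brings in b. If no
regeneration precedes n, the whole sum is a piece of the first cycle.

The overshoot is included because the condition that cycle i + 1 start by time n involves only the
lengths of cycles 0, ..., i. The middle sum is thus a predictable selection from independent
variables, centred because π(f) = 0 (`integral_cycleSum_eq_zero`). Each variable is truncated at a
level B of order c (log n)^{1/α}. The removed parts have a small stretched exponential tail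
(`measure_lt_sum_tailPart_le`) and are allotted r = t/(pq); the recentred bounded parts are allotted
s = t/q².

For the bounded parts let Σ be their selected sum and N the number of selected cycles. Bernstein's
bound on the moment generating function gives E exp((1+ε)θΣ - εκN) ≤ 1 for a suitable κ. Hölder's
inequality with exponents 1+ε and (1+ε)/ε then leaves E exp(κN) (`measure_lt_completedSum_le`). The
Laplace transform of a cycle length, controlled through d, shows that cycles 0, ..., i are all
completed by time n with probability at most exp(2κ(a - i)), where a = π^*(θ) n (1 + y/18) with y =
θM ≤ 1, and hence E exp(κN) ≤ 2 exp(κ(a+1)). With θ = s/L, L = (1+ε)σ²n + Ms, the definition of M(ε)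
absorbs the excess of a + 1 over π^*(θ) n, and the exponent -s²/(2L) results. -/

namespace MarkovBernstein

/-! ### Shifting and freezing paths. -/

section Paths

variable {S : Type*}

/-- The path seen from time `j` on. -/
def shift (j : ℕ) (w : ℕ → S) : ℕ → S := fun k => w (k + j)

/-- The path frozen at time `n`. -/
def stopAt (n : ℕ) (w : ℕ → S) : ℕ → S := fun k => w (min k n)

lemma stopAt_apply_of_le {n k : ℕ} (h : k ≤ n) (w : ℕ → S) : stopAt n w k = w k := by
  simp [stopAt, h]

lemma shift_shift (i j : ℕ) (w : ℕ → S) : shift i (shift j w) = shift (i + j) w := by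
  funext k; simp [shift, add_assoc]

lemma stopAt_stopAt_of_le {m n : ℕ} (h : m ≤ n) (w : ℕ → S) :
    stopAt m (stopAt n w) = stopAt m w := by
  funext k; simp only [stopAt]; congr 1; omega

lemma stopAt_shift_stopAt (n j : ℕ) (w : ℕ → S) :
    stopAt n (shift j (stopAt (n + j) w)) = stopAt n (shift j w) := by
  funext k; simp only [stopAt, shift]; congr 1; omega

/-- Continue a path frozen at time `n` by a constant. -/
def extendPath (n : ℕ) (p : (ℕ → S) × S) : ℕ → S := fun k => if k ≤ n then p.1 k else p.2

lemma extendPath_stopAt (n : ℕ) (w : ℕ → S) :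
    extendPath n (stopAt n w, w (n + 1)) = stopAt (n + 1) w := by
  funext k
  simp only [extendPath, stopAt]
  split_ifs with h
  · congr 1; omega
  · congr 1; omega

variable [MeasurableSpace S]

@[fun_prop]
lemma measurable_shift (j : ℕ) : Measurable (shift j : (ℕ → S) → ℕ → S) :=
  measurable_pi_lambda _ fun _ => measurable_pi_apply _

@[fun_prop]
lemma measurable_stopAt (n : ℕ) : Measurable (stopAt n : (ℕ → S) → ℕ → S) :=
  measurable_pi_lambda _ fun _ => measurable_pi_apply _

@[fun_prop]
lemma measurable_extendPath (n : ℕ) : Measurable (extendPath n : (ℕ → S) × S → ℕ → S) := by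
  refine measurable_pi_lambda _ fun k => ?_
  by_cases h : k ≤ n
  · simp only [extendPath, h, if_true]; fun_prop
  · simpa [extendPath, h] using measurable_snd

end Paths

/-! ### Markov chains as measures on path space. -/

section Chain

variable {S : Type*} [MeasurableSpace S]

/-- The one-step Markov property of a measure on path space. -/
def IsChain (κ : Kernel S S) (Q : Measure (ℕ → S)) : Prop :=
  ∀ (n : ℕ) (Φ : (ℕ → S) × S → ℝ≥0∞), Measurable Φ →
    ∫⁻ w, Φ (stopAt n w, w (n + 1)) ∂Q = ∫⁻ w, ∫⁻ s, Φ (stopAt n w, s) ∂(κ (w n)) ∂Q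

variable {κ : Kernel S S} [IsMarkovKernel κ] {Q Q' : Measure (ℕ → S)} {μ : Measure S}

instance [IsProbabilityMeasure μ] : IsProbabilityMeasure (chainLaw κ μ) := by
  unfold chainLaw; infer_instance

/-- Histories indexed by `Finset.Iic n` are turned into full paths by freezing the last coordinate,
so that all times share one path space. -/
lemma isChain_chainLaw [IsProbabilityMeasure μ] : IsChain κ (chainLaw κ μ) := by
  intro n Φ hΦ
  set e : ((i : Finset.Iic n) → S) → ℕ → S :=
    fun h k => h ⟨min k n, by simp⟩ with he
  have hem : Measurable e := measurable_pi_lambda _ fun k => measurable_pi_apply _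
  have hes : ∀ w : ℕ → S, e (Preorder.frestrictLe n w) = stopAt n w := fun w => rfl
  set κ' : (n : ℕ) → Kernel ((i : Finset.Iic n) → S) S :=
    fun n => κ.comap (fun h : (i : Finset.Iic n) → S => h ⟨n, by simp⟩) (by fun_prop) with hκ'
  have key := Kernel.map_frestrictLe_trajMeasure_compProd_eq_map_trajMeasure
    (X := fun _ => S) (κ := κ') (μ₀ := μ) (a := n)
  have h1 := congrArg (fun m => ∫⁻ p, Φ (e p.1, p.2) ∂m) key
  have hm : Measurable fun p : ((i : Finset.Iic n) → S) × S => Φ (e p.1, p.2) := by fun_prop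
  rw [Measure.lintegral_compProd hm, lintegral_map hm (by fun_prop),
    lintegral_map (hm.lintegral_kernel_prod_right') (by fun_prop)] at h1
  exact h1.symm

lemma map_eval_zero_chainLaw [IsProbabilityMeasure μ] :
    (chainLaw κ μ).map (fun w => w 0) = μ := by
  have : (fun w : ℕ → S => w 0)
      = (fun h : (i : Finset.Iic 0) → S => h ⟨0, by simp⟩) ∘ Preorder.frestrictLe 0 := rfl
  rw [this, ← Measure.map_map (by fun_prop) (by fun_prop), chainLaw, Kernel.trajMeasure,
    Measure.map_comp _ _ (by fun_prop), Kernel.traj_map_frestrictLe, Kernel.partialTraj_self,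
    Measure.id_comp, Measure.map_map (by fun_prop) (by fun_prop)]
  exact Measure.map_id

/-- The path frozen at n + 1 is a function (`extendPath`) of the path frozen at n and the next
state, so the one-step property propagates equality from time 0. -/
lemma IsChain.map_stopAt_eq [IsFiniteMeasure Q] [IsFiniteMeasure Q'] (hQ : IsChain κ Q) (hQ' : IsChain κ Q')
    (h0 : Q.map (fun w => w 0) = Q'.map (fun w => w 0)) (n : ℕ) :
    Q.map (stopAt n) = Q'.map (stopAt n) := by
  induction n with
  | zero =>
    have : (stopAt 0 : (ℕ → S) → ℕ → S) = (fun s _ => s) ∘ fun w => w 0 := by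
      funext w k; simp [stopAt]
    rw [this, ← Measure.map_map (by fun_prop) (by fun_prop), h0,
      Measure.map_map (by fun_prop) (by fun_prop)]
  | succ n ih =>
    have key : ∀ R : Measure (ℕ → S), IsChain κ R → ∀ A, MeasurableSet A →
        R.map (stopAt (n + 1)) A = ∫⁻ v, ∫⁻ s, A.indicator 1 (extendPath n (v, s)) ∂(κ (v n))
          ∂(R.map (stopAt n)) := by
      intro R hR A hA
      have hm : Measurable fun p : (ℕ → S) × S => A.indicator (1 : (ℕ → S) → ℝ≥0∞) (extendPath n p) :=
        (measurable_one.indicator hA).comp (measurable_extendPath n)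
      have hk := hR n _ hm
      simp only [extendPath_stopAt] at hk
      rw [lintegral_map _ (by fun_prop)]
      · simp only [stopAt_apply_of_le le_rfl]
        rw [← hk, ← lintegral_indicator_one (hA), lintegral_map (measurable_one.indicator hA) (by fun_prop)]
      · exact Measurable.lintegral_kernel_prod_right' (κ := κ.comap (fun v : ℕ → S => v n) (by fun_prop)) hm
    ext A hA
    rw [key Q hQ A hA, key Q' hQ' A hA, ih]

/-- Finite-dimensional marginals factor through frozen paths, and projective limits are unique.
Finite measures are allowed because the lemma is applied to restrictions to an event. -/
lemma IsChain.ext [IsFiniteMeasure Q] [IsFiniteMeasure Q'] (hQ : IsChain κ Q) (hQ' : IsChain κ Q')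
    (h0 : Q.map (fun w => w 0) = Q'.map (fun w => w 0)) : Q = Q' := by
  have hlim : IsProjectiveLimit (α := fun _ : ℕ => S) Q fun I => Q'.map I.restrict := by
    intro I
    have : (I.restrict : (ℕ → S) → _) = I.restrict ∘ stopAt (I.sup id) := by
      funext w i
      have : (i : ℕ) ≤ I.sup id := Finset.le_sup (f := id) i.2
      simp [stopAt_apply_of_le this]
    rw [this, ← Measure.map_map (by fun_prop) (by fun_prop), hQ.map_stopAt_eq hQ' h0,
      Measure.map_map (by fun_prop) (by fun_prop), ← this]
  exact hlim.unique fun _ => rfl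

omit [IsMarkovKernel κ] in
lemma IsChain.smul (hQ : IsChain κ Q) (c : ℝ≥0∞) : IsChain κ (c • Q) := by
  intro n Φ hΦ
  simp only [lintegral_smul_measure, hQ n Φ hΦ]

/-- The Markov property at time `j`. -/
lemma IsChain.map_shift_restrict (hQ : IsChain κ Q) (j : ℕ) {A : Set (ℕ → S)} (hA : MeasurableSet A)
    (hAj : ∀ w, stopAt j w ∈ A ↔ w ∈ A) : IsChain κ ((Q.restrict A).map (shift j)) := by
  intro n Φ hΦ
  rw [lintegral_map (by fun_prop) (by fun_prop), lintegral_map _ (by fun_prop),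
    ← lintegral_indicator hA, ← lintegral_indicator hA]
  · have hm : Measurable fun p : (ℕ → S) × S =>
        A.indicator (fun _ => Φ (stopAt n (shift j p.1), p.2)) p.1 := by
      have : (fun p : (ℕ → S) × S => A.indicator (fun _ => Φ (stopAt n (shift j p.1), p.2)) p.1)
        = (Prod.fst ⁻¹' A).indicator (fun p => Φ (stopAt n (shift j p.1), p.2)) := by
        funext p; by_cases hp : p.1 ∈ A <;> simp [hp]
      rw [this]
      exact Measurable.indicator (by fun_prop) (measurable_fst hA)
    have hk := hQ (n + j) _ hm
    have hmem : ∀ w, stopAt (n + j) w ∈ A ↔ w ∈ A := fun w => by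
      rw [← hAj, stopAt_stopAt_of_le (by omega), hAj]
    simp only [stopAt_shift_stopAt] at hk
    convert hk using 2
    · funext w
      have hw : shift j w (n + 1) = w (n + j + 1) := by simp only [shift]; congr 1; omega
      by_cases hwA : w ∈ A <;> simp [Set.indicator, hmem, hwA, hw]
    · funext w
      by_cases hw : w ∈ A <;> simp [Set.indicator, hmem, hw, shift]
  · exact Measurable.comp (g := fun v : ℕ → S => ∫⁻ s, Φ (stopAt n v, s) ∂(κ (v n)))
      (Measurable.lintegral_kernel_prod_right' (κ := κ.comap (fun v : ℕ → S => v n) (by fun_prop))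
        (f := fun p => Φ (stopAt n p.1, p.2)) (by fun_prop)) measurable_id

/-- The path law is the μ-mixture of the trajectory kernel, whose values are the laws started at
points. -/
lemma ae_chainLaw_of_forall_dirac {p : (ℕ → S) → Prop} (hp : MeasurableSet {w | p w})
    (h : ∀ x, ∀ᵐ w ∂(chainLaw κ (Measure.dirac x)), p w) : ∀ᵐ w ∂(chainLaw κ μ), p w := by
  have hc : ∀ m : Measure S, chainLaw κ m {w | ¬ p w} = ∫⁻ x, Kernel.traj (X := fun _ => S)
      (fun n => κ.comap (fun h : (i : Finset.Iic n) → S => h ⟨n, by simp⟩) (by fun_prop)) 0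
      ((MeasurableEquiv.piUnique fun _ : Finset.Iic 0 => S).symm x) {w | ¬ p w} ∂m := by
    intro m
    have hm : Measurable fun y => Kernel.traj (X := fun _ => S)
      (fun n => κ.comap (fun h : (i : Finset.Iic n) → S => h ⟨n, by simp⟩) (by fun_prop)) 0
      y {w | ¬ p w} := Kernel.measurable_coe _ hp.compl
    have hp' : MeasurableSet {w | ¬ p w} := hp.compl
    rw [chainLaw, Kernel.trajMeasure, Measure.bind_apply hp' (Kernel.aemeasurable _),
      lintegral_map hm (by fun_prop)]
  rw [ae_iff, hc]
  refine (lintegral_congr fun x => ?_).trans lintegral_zero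
  have h1 := ae_iff.1 (h x)
  rw [hc, lintegral_dirac'] at h1
  · exact h1
  · exact (Kernel.measurable_coe _ hp.compl).comp (by fun_prop)

end Chain

/-! ### The split chain: projection to the original chain and restart at regenerations. -/

namespace Minorization

variable {S : Type*} [MeasurableSpace S] {P : Kernel S S} (D : Minorization P)

lemma lintegral_splitKernel (x : S) {g : S × Bool → ℝ≥0∞} (hg : Measurable g) :
    ∫⁻ z, g z ∂(D.splitKernel x)
      = D.regenProb x * g (x, true) + (1 - D.regenProb x) * g (x, false) := by
  change ∫⁻ z, g z ∂(D.regenProb x • Measure.dirac (x, true)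
    + (1 - D.regenProb x) • Measure.dirac (x, false)) = _
  rw [lintegral_add_measure, lintegral_smul_measure, lintegral_smul_measure,
    lintegral_dirac' _ hg, lintegral_dirac' _ hg]
  rfl

lemma regenProb_of_mem {x : S} (hx : x ∈ D.C) : D.regenProb x = D.δ := if_pos hx

lemma regenProb_of_notMem {x : S} (hx : x ∉ D.C) : D.regenProb x = 0 := if_neg hx

variable [IsMarkovKernel P]

lemma regenProb_smul_add (x : S) :
    D.regenProb x • D.ν + (1 - D.regenProb x) • D.residual x = P x := by
  classical
  have hres : D.residual x = if x ∈ D.C ∧ D.δ < 1 then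
    (1 - (D.δ : ℝ≥0∞))⁻¹ • (P x - (D.δ : ℝ≥0∞) • D.ν) else P x := rfl
  by_cases hx : x ∈ D.C
  · rw [D.regenProb_of_mem hx]
    have hfin : IsFiniteMeasure ((D.δ : ℝ≥0∞) • D.ν) := Measure.smul_finite _ (by simp)
    by_cases hd : D.δ < 1
    · rw [hres, if_pos ⟨hx, hd⟩, smul_smul, ENNReal.mul_inv_cancel, one_smul, add_comm,
        Measure.sub_add_cancel_of_le (D.smul_ν_le hx)]
      · exact (tsub_pos_of_lt (by exact_mod_cast hd)).ne'
      · exact ENNReal.sub_ne_top ENNReal.one_ne_top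
    -- When δ = 1, ν ≤ P x and both have mass one, so they coincide, and the residual part has
    -- weight zero.
    · have h1 : (D.δ : ℝ≥0∞) = 1 := le_antisymm D.δ_le_one (by exact_mod_cast not_lt.1 hd)
      have hle := D.smul_ν_le hx
      rw [h1, one_smul] at hle
      simp only [h1, one_smul, tsub_self, zero_smul, add_zero]
      exact Measure.eq_of_le_of_measure_univ_eq hle (by simp)
  · rw [D.regenProb_of_notMem hx, hres, if_neg (fun h => hx h.1)]
    simp

lemma moveKernel_true {z : S × Bool} (hz : z.2 = true) : D.moveKernel z = D.ν := if_pos hz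

lemma moveKernel_false {z : S × Bool} (hz : z.2 = false) : D.moveKernel z = D.residual z.1 :=
  if_neg (by simp [hz])

lemma splitChain_of_true {z : S × Bool} (hz : z.2 = true) : D.splitChain z = D.split D.ν := by
  rw [splitChain, Kernel.comp_apply, D.moveKernel_true hz, split]

lemma lintegral_moveKernel_mix (x : S) (g : S → ℝ≥0∞) :
    D.regenProb x * ∫⁻ y, g y ∂(D.moveKernel (x, true))
      + (1 - D.regenProb x) * ∫⁻ y, g y ∂(D.moveKernel (x, false)) = ∫⁻ y, g y ∂(P x) := by
  rw [D.moveKernel_true rfl, D.moveKernel_false rfl]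
  conv_rhs => rw [← D.regenProb_smul_add x]
  rw [lintegral_add_measure, lintegral_smul_measure, lintegral_smul_measure]
  rfl

lemma lintegral_splitChain (z : S × Bool) {g : S × Bool → ℝ≥0∞} (hg : Measurable g) :
    ∫⁻ y, g y ∂(D.splitChain z) = ∫⁻ x, ∫⁻ y, g y ∂(D.splitKernel x) ∂(D.moveKernel z) := by
  rw [splitChain, Kernel.lintegral_comp _ _ _ hg]

instance {μ : Measure S} [IsProbabilityMeasure μ] : IsProbabilityMeasure (D.split μ) := by
  unfold split; infer_instance

instance {μ : Measure S} [IsProbabilityMeasure μ] : IsProbabilityMeasure (D.splitLaw μ) := by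
  unfold splitLaw; infer_instance

lemma isChain_splitLaw (μ : Measure S) [IsProbabilityMeasure μ] :
    IsChain D.splitChain (D.splitLaw μ) := isChain_chainLaw

/-- The path frozen at time `n`, with the level at time `n` forgotten. -/
def eraseLevel (n : ℕ) (w : ℕ → S × Bool) : ℕ → S × Bool :=
  fun k => if k < n then w k else ((w n).1, false)

omit [MeasurableSpace S] in
lemma eraseLevel_of_lt {n k : ℕ} (h : k < n) (w : ℕ → S × Bool) : eraseLevel n w k = w k :=
  if_pos h

omit [MeasurableSpace S] in
lemma eraseLevel_self_fst (n : ℕ) (w : ℕ → S × Bool) : (eraseLevel n w n).1 = (w n).1 := by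
  simp [eraseLevel]

/-- Given the past and `X_n`, the level `Y_n` equals one with probability `δ 1_C(X_n)`. -/
lemma lintegral_level (μ : Measure S) [IsProbabilityMeasure μ] (n : ℕ)
    {Φ : (ℕ → S × Bool) × Bool → ℝ≥0∞} (hΦ : Measurable Φ) :
    ∫⁻ w, Φ (eraseLevel n w, (w n).2) ∂(D.splitLaw μ)
      = ∫⁻ w, D.regenProb (w n).1 * Φ (eraseLevel n w, true)
          + (1 - D.regenProb (w n).1) * Φ (eraseLevel n w, false) ∂(D.splitLaw μ) := by
  have hr := D.measurable_regenProb
  -- The right-hand integrand ignores the level at time n, so averaging it over that level changes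
  -- nothing; both sides agree once the level is integrated out.
  have hadd : ∀ x a, D.regenProb x * a + (1 - D.regenProb x) * a = a := fun x a => by
    rw [← add_mul, add_tsub_cancel_of_le (D.regenProb_le_one x), one_mul]
  cases n with
  | zero =>
    set E : S × Bool → ℕ → S × Bool := fun z _ => (z.1, false) with hE
    have hEm : Measurable E := measurable_pi_lambda _ fun _ => by fun_prop
    have he : ∀ w : ℕ → S × Bool, eraseLevel 0 w = E (w 0) := fun w => by
      funext k; simp [eraseLevel, hE]
    have h0 := map_eval_zero_chainLaw (κ := D.splitChain) (μ := D.split μ)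
    simp only [he]
    rw [← lintegral_map (μ := D.splitLaw μ) (g := fun w => w 0)
        (f := fun z => Φ (E z, z.2)) (by fun_prop) (by fun_prop),
      ← lintegral_map (μ := D.splitLaw μ) (g := fun w => w 0)
        (f := fun z => D.regenProb z.1 * Φ (E z, true) + (1 - D.regenProb z.1) * Φ (E z, false))
        (by fun_prop) (by fun_prop), splitLaw, h0, split,
      Measure.lintegral_bind (Kernel.aemeasurable _) (by fun_prop),
      Measure.lintegral_bind (Kernel.aemeasurable _) (by fun_prop)]
    refine lintegral_congr fun x => ?_
    rw [D.lintegral_splitKernel x (by fun_prop), D.lintegral_splitKernel x (by fun_prop)]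
    exact (hadd _ _).symm
  | succ n =>
    set E : (ℕ → S × Bool) × (S × Bool) → ℕ → S × Bool :=
      fun p => extendPath n (p.1, (p.2.1, false)) with hE
    have hEm : Measurable E := by fun_prop
    have he : ∀ w : ℕ → S × Bool, eraseLevel (n + 1) w = E (stopAt n w, w (n + 1)) := fun w => by
      funext k
      by_cases h : k ≤ n
      · simp [eraseLevel, hE, extendPath, h, stopAt]
      · simp [eraseLevel, hE, extendPath, h]
    simp only [he]
    have h1 := D.isChain_splitLaw μ n (fun p => Φ (E p, p.2.2)) (by fun_prop)
    have h2 := D.isChain_splitLaw μ n (fun p => D.regenProb p.2.1 * Φ (E p, true)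
      + (1 - D.regenProb p.2.1) * Φ (E p, false)) (by fun_prop)
    simp only at h1 h2
    rw [h1, h2]
    refine lintegral_congr fun w => ?_
    rw [D.lintegral_splitChain _ (by fun_prop), D.lintegral_splitChain _ (by fun_prop)]
    refine lintegral_congr fun x => ?_
    rw [D.lintegral_splitKernel x (by fun_prop), D.lintegral_splitKernel x (by fun_prop)]
    exact (hadd _ _).symm

lemma map_fst_split (μ : Measure S) : (D.split μ).map Prod.fst = μ := by
  ext A hA
  rw [Measure.map_apply measurable_fst hA, split,
    Measure.bind_apply (measurable_fst hA) (Kernel.aemeasurable _)]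
  have : ∀ x, D.splitKernel x (Prod.fst ⁻¹' A) = A.indicator 1 x := fun x => by
    rw [← lintegral_indicator_one (measurable_fst hA), D.lintegral_splitKernel x
      (measurable_one.indicator (measurable_fst hA))]
    by_cases h : x ∈ A
    · simp [h, add_tsub_cancel_of_le (D.regenProb_le_one x)]
    · simp [h]
  simp only [this]
  rw [lintegral_indicator_one hA]

/-- The first coordinate of the split chain is the original chain. -/
lemma map_fst_splitLaw (μ : Measure S) [IsProbabilityMeasure μ] :
    (D.splitLaw μ).map (fun w k => (w k).1) = chainLaw P μ := by
  have hpm : Measurable (fun (w : ℕ → S × Bool) k => (w k).1) :=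
    measurable_pi_lambda _ fun _ => by fun_prop
  have : IsProbabilityMeasure ((D.splitLaw μ).map (fun w k => (w k).1)) :=
    Measure.isProbabilityMeasure_map hpm.aemeasurable
  refine IsChain.ext (κ := P) ?_ isChain_chainLaw ?_
  · intro n Φ hΦ
    have hm2 : Measurable fun v : ℕ → S => ∫⁻ s, Φ (stopAt n v, s) ∂(P (v n)) :=
      Measurable.lintegral_kernel_prod_right' (κ := P.comap (fun v : ℕ → S => v n) (by fun_prop))
        (f := fun p => Φ (stopAt n p.1, p.2)) (by fun_prop)
    rw [lintegral_map (by fun_prop) (by fun_prop), lintegral_map hm2 (by fun_prop)]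
    have h1 := D.isChain_splitLaw μ n (fun p => Φ (stopAt n (fun k => (p.1 k).1), p.2.1))
      (by fun_prop)
    have hss : ∀ w : ℕ → S × Bool, (stopAt n fun k => (stopAt n w k).1)
        = stopAt n fun k => (w k).1 := fun w => by
      funext k; simp [stopAt]
    simp only [hss] at h1
    rw [h1]
    -- Ψ is the expectation after the move out of (X_n, level). Its average over the level, given
    -- the past and X_n, is one step of P.
    set Ψ : (ℕ → S × Bool) × Bool → ℝ≥0∞ := fun p =>
      ∫⁻ x, Φ (stopAt n (fun k => (p.1 k).1), x) ∂(D.moveKernel ((p.1 n).1, p.2)) with hΨ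
    have hΨm : Measurable Ψ :=
      Measurable.lintegral_kernel_prod_right' (κ := D.moveKernel.comap
        (fun p : (ℕ → S × Bool) × Bool => ((p.1 n).1, p.2)) (by fun_prop))
        (f := fun p => Φ (stopAt n (fun k => (p.1.1 k).1), p.2)) (by fun_prop)
    have hse : ∀ w : ℕ → S × Bool, (stopAt n fun k => (eraseLevel n w k).1)
        = stopAt n fun k => (w k).1 := fun w => by
      funext k
      rcases lt_or_ge k n with h | h
      · simp [stopAt, h.le, eraseLevel_of_lt h]
      · simp [stopAt, h, eraseLevel_self_fst]
    have h2 := D.lintegral_level μ n hΨm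
    simp only [hΨ, hse, eraseLevel_self_fst] at h2
    simp only [D.lintegral_moveKernel_mix] at h2
    rw [← h2]
    refine lintegral_congr fun w => ?_
    rw [D.lintegral_splitChain _ (by fun_prop)]
    refine lintegral_congr fun x => ?_
    rw [D.lintegral_splitKernel x (by fun_prop)]
    simp only
    rw [← add_mul, add_tsub_cancel_of_le (D.regenProb_le_one x), one_mul]
  · rw [map_eval_zero_chainLaw, Measure.map_map (by fun_prop) hpm]
    have : ((fun w : ℕ → S => w 0) ∘ fun (w : ℕ → S × Bool) k => (w k).1)
      = Prod.fst ∘ fun w => w 0 := rfl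
    rw [this, ← Measure.map_map (by fun_prop) (by fun_prop), splitLaw, map_eval_zero_chainLaw,
      map_fst_split]

/-- After a regeneration the chain starts afresh from `ν^*`. -/
lemma measure_inter_shift_of_regen (μ : Measure S) [IsProbabilityMeasure μ] (j : ℕ)
    {A H : Set (ℕ → S × Bool)} (hA : MeasurableSet A) (hAj : ∀ w, stopAt j w ∈ A ↔ w ∈ A)
    (hY : ∀ w ∈ A, (w j).2 = true) (hH : MeasurableSet H) :
    D.splitLaw μ (A ∩ shift (j + 1) ⁻¹' H) = D.splitLaw μ A * D.splitLaw D.ν H := by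
  have hAj' : ∀ w, stopAt (j + 1) w ∈ A ↔ w ∈ A := fun w => by
    rw [← hAj, stopAt_stopAt_of_le (Nat.le_succ j), hAj]
  have hch := (D.isChain_splitLaw μ).map_shift_restrict (j + 1) hA hAj'
  have hfin : IsFiniteMeasure (D.splitLaw μ A • D.splitLaw D.ν) :=
    Measure.smul_finite _ (measure_ne_top _ _)
  -- Restricted to A and shifted past the regeneration, the law is still a chain. Its initial law is
  -- a multiple of ν^*, because a move out of level one ignores the state; uniqueness of the chain
  -- does the rest.
  have heq : ((D.splitLaw μ).restrict A).map (shift (j + 1))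
      = D.splitLaw μ A • D.splitLaw D.ν := by
    refine hch.ext ((D.isChain_splitLaw D.ν).smul _) ?_
    rw [Measure.map_smul, splitLaw, splitLaw, map_eval_zero_chainLaw, ← splitLaw,
      Measure.map_map (by fun_prop) (by fun_prop)]
    ext B hB
    have hcomp : ((fun w => w 0) ∘ shift (j + 1) : (ℕ → S × Bool) → S × Bool)
      = fun w => w (j + 1) := by funext w; simp [shift]
    have hBm : MeasurableSet ((fun w : ℕ → S × Bool => w (j + 1)) ⁻¹' B) :=
      (measurable_pi_apply (j + 1)) hB
    rw [hcomp, Measure.map_apply (by fun_prop) hB, Measure.restrict_apply hBm, Set.inter_comm,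
      Measure.smul_apply, smul_eq_mul]
    have h1 := D.isChain_splitLaw μ j (fun p => (A ×ˢ B).indicator 1 p)
      (measurable_one.indicator (hA.prod hB))
    rw [← lintegral_indicator_one (hA.inter hBm)]
    have e1 : ∀ w : ℕ → S × Bool, (A ×ˢ B).indicator (1 : (ℕ → S × Bool) × (S × Bool) → ℝ≥0∞) (stopAt j w, w (j + 1))
        = (A ∩ (fun w : ℕ → S × Bool => w (j + 1)) ⁻¹' B).indicator 1 w := fun w => by
      by_cases hw : w ∈ A <;> by_cases hb : w (j + 1) ∈ B <;> simp [hAj, hw, hb]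
    have e2 : ∀ w : ℕ → S × Bool,
        ∫⁻ s, (A ×ˢ B).indicator (1 : (ℕ → S × Bool) × (S × Bool) → ℝ≥0∞) (stopAt j w, s) ∂(D.splitChain (w j))
        = A.indicator (fun _ => D.split D.ν B) w := fun w => by
      by_cases hw : w ∈ A
      · rw [Set.indicator_of_mem hw, D.splitChain_of_true (hY w hw), ← lintegral_indicator_one hB]
        refine lintegral_congr fun s => ?_
        by_cases hb : s ∈ B <;> simp [hAj, hw, hb]
      · rw [Set.indicator_of_notMem hw]
        refine (lintegral_congr fun s => ?_).trans lintegral_zero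
        simp [hAj, hw]
    simp only [e1, e2] at h1
    rw [h1, lintegral_indicator hA, setLIntegral_const, mul_comm]
  have := congrArg (fun m => m H) heq
  rw [Measure.smul_apply, smul_eq_mul] at this
  rw [← this, Measure.map_apply (by fun_prop) hH,
    Measure.restrict_apply ((measurable_shift _) hH), Set.inter_comm]

/-! ### Harris recurrence yields infinitely many regenerations. -/

open Classical in
/-- The weight `0` for a regeneration, `1 + δ` for a visit to `C` without regeneration, and `1`
otherwise. -/
noncomputable def visitWeight (z : S × Bool) : ℝ≥0∞ :=
  if z.2 = true then 0 else if z.1 ∈ D.C then 1 + D.δ else 1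

omit [IsMarkovKernel P] in
@[fun_prop]
lemma measurable_visitWeight : Measurable D.visitWeight :=
  Measurable.ite (measurable_snd (measurableSet_singleton true)) measurable_const
    (Measurable.ite (measurable_fst D.measurableSet_C) measurable_const measurable_const)

/-- The gain 1 + δ at a missed regeneration is offset by its probability 1 - δ, since (1 - δ)(1 + δ)
≤ 1. -/
lemma regenProb_mul_visitWeight_le (x : S) :
    D.regenProb x * D.visitWeight (x, true) + (1 - D.regenProb x) * D.visitWeight (x, false)
      ≤ 1 := by
  simp only [visitWeight, if_true, mul_zero, zero_add, Bool.false_eq_true, if_false]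
  by_cases hx : x ∈ D.C
  · rw [if_pos hx, D.regenProb_of_mem hx]
    have h := D.δ_le_one
    calc (1 - (D.δ : ℝ≥0∞)) * (1 + D.δ)
        = (1 - (D.δ : ℝ≥0∞)) + (1 - (D.δ : ℝ≥0∞)) * D.δ := by ring
      _ ≤ (1 - (D.δ : ℝ≥0∞)) + 1 * D.δ := by gcongr; exact tsub_le_self
      _ = 1 := by rw [one_mul, tsub_add_cancel_of_le h]
  · simp [hx, D.regenProb_of_notMem hx]

/-- Averaging over the last level shows that the products of weights form a supermartingale started
at one. -/
lemma lintegral_prod_visitWeight_le (μ : Measure S) [IsProbabilityMeasure μ] (j n : ℕ) :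
    ∫⁻ w, ∏ k ∈ Finset.range n, D.visitWeight (w (j + k)) ∂(D.splitLaw μ) ≤ 1 := by
  induction n with
  | zero => simp
  | succ n ih =>
    refine le_trans ?_ ih
    set G : (ℕ → S × Bool) → ℝ≥0∞ := fun w => ∏ k ∈ Finset.range n, D.visitWeight (w (j + k))
      with hG
    have hGm : Measurable G := by fun_prop
    have hGe : ∀ w, G (eraseLevel (j + n) w) = G w := fun w => by
      refine Finset.prod_congr rfl fun k hk => ?_
      rw [eraseLevel_of_lt (by have := Finset.mem_range.1 hk; omega)]
    have h := D.lintegral_level μ (j + n)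
      (Φ := fun p => G p.1 * D.visitWeight ((p.1 (j + n)).1, p.2)) (by fun_prop)
    simp only [hGe, eraseLevel_self_fst] at h
    simp only [Finset.prod_range_succ]
    refine h.trans_le (lintegral_mono fun w => ?_)
    calc _ = G w * (D.regenProb (w (j + n)).1 * D.visitWeight ((w (j + n)).1, true)
          + (1 - D.regenProb (w (j + n)).1) * D.visitWeight ((w (j + n)).1, false)) := by ring
      _ ≤ G w * 1 := by gcongr; exact D.regenProb_mul_visitWeight_le _
      _ = G w := mul_one _

omit [IsMarkovKernel P] in
-- Without regenerations the product is 1 + δ raised to the number of visits to C.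
lemma tendsto_prod_visitWeight {v : ℕ → S × Bool} (hY : ∀ k, (v k).2 = false)
    (hC : ∃ᶠ k in Filter.atTop, (v k).1 ∈ D.C) :
    Filter.Tendsto (fun n => ∏ k ∈ Finset.range n, D.visitWeight (v k)) Filter.atTop
      (nhds ∞) := by
  classical
  have hc : ∀ n, ∏ k ∈ Finset.range n, D.visitWeight (v k)
      = (1 + D.δ : ℝ≥0∞) ^ Nat.count (fun k => (v k).1 ∈ D.C) n := by
    intro n
    induction n with
    | zero => simp
    | succ n ih =>
      rw [Finset.prod_range_succ, ih, Nat.count_succ]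
      by_cases h : (v n).1 ∈ D.C <;> simp [visitWeight, hY, h, pow_succ]
  simp only [hc]
  refine (ENNReal.tendsto_pow_atTop_nhds_top_iff.2 ?_).comp ?_
  · exact ENNReal.lt_add_right (by simp) (by exact_mod_cast D.δ_pos.ne')
  · refine Filter.tendsto_atTop_atTop_of_monotone (Nat.count_monotone _) fun b => ?_
    have hinf := Nat.frequently_atTop_iff_infinite.1 hC
    exact ⟨_, (Nat.count_nth_of_infinite hinf b).ge⟩

/-- By Fatou, the products of weights from any time j on have an almost surely finite lower limit,
whereas they diverge if C is visited infinitely often and no regeneration occurs after j. -/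
lemma ae_frequently_regen_of_frequently_mem (μ : Measure S) [IsProbabilityMeasure μ]
    (hC : ∀ᵐ w ∂(D.splitLaw μ), ∃ᶠ k in Filter.atTop, (w k).1 ∈ D.C) :
    ∀ᵐ w ∂(D.splitLaw μ), ∃ᶠ k in Filter.atTop, (w k).2 = true := by
  have h1 : ∀ j, ∀ᵐ w ∂(D.splitLaw μ), Filter.liminf
      (fun n => ∏ k ∈ Finset.range n, D.visitWeight (w (j + k))) Filter.atTop < ∞ := by
    intro j
    refine ae_lt_top (Measurable.liminf fun n => by fun_prop) ?_
    refine ((lintegral_liminf_le fun n => by fun_prop).trans ?_).trans_lt ENNReal.one_lt_top |>.ne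
    exact Filter.liminf_le_of_le (by isBoundedDefault) fun b hb => by
      obtain ⟨n, hn⟩ := hb.exists
      exact hn.trans (D.lintegral_prod_visitWeight_le μ j n)
  filter_upwards [ae_all_iff.2 h1, hC] with w hw hCw
  by_contra hno
  obtain ⟨j, hj⟩ := Filter.eventually_atTop.1 (Filter.not_frequently.1 hno)
  have hshift : ∃ᶠ k in Filter.atTop, (w (j + k)).1 ∈ D.C := by
    rw [Filter.frequently_atTop] at hCw ⊢
    intro a
    obtain ⟨b, hb, hbC⟩ := hCw (j + a)
    exact ⟨b - j, by omega, by rwa [Nat.add_sub_cancel' (by omega)]⟩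
  have := D.tendsto_prod_visitWeight (v := fun k => w (j + k))
    (fun k => by simpa using hj (j + k) (by omega)) hshift
  exact (hw j).ne this.liminf_eq

/-- Under Harris recurrence the split chain regenerates infinitely often. -/
lemma ae_frequently_regen {π : Measure S} (hH : IsHarrisRecurrent P π) (hC : 0 < π D.C)
    (μ : Measure S) [IsProbabilityMeasure μ] :
    ∀ᵐ w ∂(D.splitLaw μ), ∃ᶠ k in Filter.atTop, (w k).2 = true := by
  refine D.ae_frequently_regen_of_frequently_mem μ ?_
  have hms : MeasurableSet {w : ℕ → S | ∃ᶠ k in Filter.atTop, w k ∈ D.C} := by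
    simp only [Filter.frequently_atTop]
    have hb : ∀ b, MeasurableSet {w : ℕ → S | w b ∈ D.C} := fun b =>
      measurable_pi_apply b D.measurableSet_C
    measurability
  have h := ae_chainLaw_of_forall_dirac (κ := P) (μ := μ) hms (hH _ D.measurableSet_C hC)
  rw [← D.map_fst_splitLaw μ] at h
  exact ae_of_ae_map (measurable_pi_lambda _ fun _ => by fun_prop).aemeasurable h

end Minorization

/-! ### Cycles of a path and the decomposition of partial sums. -/

section Cycles

variable {S : Type*}

/-- The paths along which infinitely many regenerations occur. -/
def Regenerates (w : ℕ → S × Bool) : Prop := ∃ᶠ k in Filter.atTop, (w k).2 = true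

/-- The length of the first cycle, which ends at the first regeneration. -/
noncomputable def cycleLength (w : ℕ → S × Bool) : ℕ := regenTime 0 w + 1

/-- The sum of `f` over the first cycle. -/
noncomputable def cycleSum (f : S → ℝ) (w : ℕ → S × Bool) : ℝ :=
  ∑ k ∈ Finset.range (cycleLength w), f (w k).1

/-- The path after its first cycle. -/
noncomputable def nextCycle (w : ℕ → S × Bool) : ℕ → S × Bool := shift (cycleLength w) w

/-- The time at which the `i`-th cycle starts. -/
noncomputable def cycleStart (i : ℕ) (w : ℕ → S × Bool) : ℕ :=
  ∑ k ∈ Finset.range i, cycleLength (nextCycle^[k] w)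

/-- Length and sum of the `i`-th cycle. -/
noncomputable def cycleData (f : S → ℝ) (i : ℕ) (w : ℕ → S × Bool) : ℕ × ℝ :=
  (cycleLength (nextCycle^[i] w), cycleSum f (nextCycle^[i] w))

lemma cycleLength_pos (w : ℕ → S × Bool) : 0 < cycleLength w := Nat.succ_pos _

lemma Regenerates.shift {w : ℕ → S × Bool} (hw : Regenerates w) (m : ℕ) :
    Regenerates (shift m w) := by
  rw [Regenerates, Filter.frequently_atTop] at hw ⊢
  intro a
  obtain ⟨b, hb, hbY⟩ := hw (a + m)
  exact ⟨b - m, by omega, by rwa [MarkovBernstein.shift, Nat.sub_add_cancel (by omega)]⟩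

lemma Regenerates.exists {w : ℕ → S × Bool} (hw : Regenerates w) : ∃ k, (w k).2 = true :=
  Filter.Frequently.exists hw

lemma regenTime_zero_eq_iff {w : ℕ → S × Bool} (hw : ∃ k, (w k).2 = true) (j : ℕ) :
    regenTime 0 w = j ↔ (w j).2 = true ∧ ∀ k < j, (w k).2 = false := by
  rw [regenTime, Nat.nth_zero_of_exists hw, Nat.find_eq_iff]
  simp

/-- The default value of `Nat.nth` on the exceptional paths, needed because measurability has to
hold on the whole path space. -/
lemma regenTime_zero_of_not_exists {w : ℕ → S × Bool} (hw : ¬ ∃ k, (w k).2 = true) :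
    regenTime 0 w = 0 := by
  have : {k | (w k).2 = true} = ∅ := by
    ext k; simpa using fun h => hw ⟨k, h⟩
  rw [regenTime, Nat.nth_zero]
  rw [Nat.sInf_eq_zero]
  exact Or.inr this

lemma lt_cycleLength_iff {w : ℕ → S × Bool} (hw : ∃ k, (w k).2 = true) (l : ℕ) :
    l < cycleLength w ↔ ∀ k < l, (w k).2 = false := by
  have h := (regenTime_zero_eq_iff hw (regenTime 0 w)).1 rfl
  rw [cycleLength, Nat.lt_succ_iff]
  constructor
  · exact fun hl k hk => h.2 k (by omega)
  · intro hl
    by_contra hlt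
    have := hl _ (not_le.1 hlt)
    simp [h.1] at this

lemma regenTime_zero_shift {w : ℕ → S × Bool} (hw : ∃ k, (w k).2 = true) {m : ℕ}
    (hm : m ≤ regenTime 0 w) : regenTime 0 (shift m w) + m = regenTime 0 w := by
  have h := (regenTime_zero_eq_iff hw (regenTime 0 w)).1 rfl
  have hY : (shift m w (regenTime 0 w - m)).2 = true := by
    rw [shift, Nat.sub_add_cancel hm]; exact h.1
  have : regenTime 0 (shift m w) = regenTime 0 w - m := by
    rw [regenTime_zero_eq_iff ⟨_, hY⟩]
    exact ⟨hY, fun k hk => h.2 _ (by omega)⟩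
  omega

lemma iterate_nextCycle (i : ℕ) (w : ℕ → S × Bool) :
    nextCycle^[i] w = shift (cycleStart i w) w := by
  induction i with
  | zero => simp only [cycleStart, Finset.range_zero, Finset.sum_empty]; rfl
  | succ i ih =>
    rw [Function.iterate_succ_apply', nextCycle, cycleStart, Finset.sum_range_succ, ← cycleStart,
      ih, shift_shift, add_comm]

lemma cycleStart_succ (i : ℕ) (w : ℕ → S × Bool) :
    cycleStart (i + 1) w = cycleStart i w + cycleLength (nextCycle^[i] w) :=
  Finset.sum_range_succ _ _

lemma cycleStart_strictMono (w : ℕ → S × Bool) : StrictMono fun i => cycleStart i w :=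
  strictMono_nat_of_lt_succ fun i => by
    rw [cycleStart_succ]; exact Nat.lt_add_of_pos_right (cycleLength_pos _)

lemma Regenerates.nextCycle {w : ℕ → S × Bool} (hw : Regenerates w) :
    Regenerates (nextCycle w) := hw.shift _

/-- The block between the first two regenerations is the second cycle. This links c and the block
variance to cycles. -/
lemma blockSum_zero_eq {w : ℕ → S × Bool} (hw : Regenerates w) (f : S → ℝ) :
    blockSum f 0 w = cycleSum f (nextCycle w) := by
  classical
  set s := regenTime 0 w with hs
  set s' := regenTime 0 (nextCycle w) with hs'
  have h := (regenTime_zero_eq_iff hw.exists s).1 rfl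
  have h' := (regenTime_zero_eq_iff hw.nextCycle.exists s').1 rfl
  have hY : (w (s' + (s + 1))).2 = true := h'.1
  have hnth : regenTime 1 w = s' + (s + 1) := by
    -- Exactly one regeneration precedes the candidate time, which identifies it through
    -- `Nat.nth_count`.
    have hcount : Nat.count (fun k => (w k).2 = true) (s' + (s + 1)) = 1 := by
      rw [add_comm, Nat.count_add, Nat.count_succ, if_pos h.1]
      have h1 : Nat.count (fun k => (w k).2 = true) s = 0 := by
        rw [Nat.count_iff_forall_not]; intro k hk; simp [h.2 k hk]
      have h2 : Nat.count (fun k => (w (s + 1 + k)).2 = true) s' = 0 := by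
        rw [Nat.count_iff_forall_not]
        intro k hk
        have := h'.2 k hk
        rw [MarkovBernstein.nextCycle, MarkovBernstein.shift, add_comm] at this
        simpa [cycleLength, hs] using this
      omega
    have h := Nat.nth_count (p := fun k => (w k).2 = true) hY
    rwa [hcount] at h
  rw [blockSum, hnth, cycleSum, ← hs, cycleLength, ← hs']
  have : Finset.Ioc s (s' + (s + 1)) = Finset.Ico (0 + (s + 1)) (s' + 1 + (s + 1)) := by
    ext k; simp; omega
  rw [this, ← Finset.sum_Ico_add' (fun k => f (w k).1), Finset.range_eq_Ico]
  rfl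

lemma sum_range_cycleStart (f : S → ℝ) (i : ℕ) (w : ℕ → S × Bool) :
    ∑ k ∈ Finset.range (cycleStart i w), f (w k).1
      = ∑ l ∈ Finset.range i, cycleSum f (nextCycle^[l] w) := by
  induction i with
  | zero => simp [cycleStart]
  | succ i ih =>
    rw [cycleStart_succ, Finset.sum_range_add, ih, Finset.sum_range_succ, cycleSum]
    congr 1
    refine Finset.sum_congr rfl fun k _ => ?_
    rw [iterate_nextCycle, shift, add_comm]

/-- Decomposition of a partial sum into cycles; the last cycle overshoots time `n`. -/
lemma sum_range_eq_cycles {w : ℕ → S × Bool} (hw : Regenerates w) (f : S → ℝ) (n : ℕ) :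
    ∑ k ∈ Finset.range n, f (w k).1 = cycleSum f w
      + ∑ i ∈ Finset.range n, (if cycleStart (i + 1) w ≤ n then cycleSum f (nextCycle^[i + 1] w)
          else 0)
      - cycleSum f (shift n w) := by
  have hmono := cycleStart_strictMono w
  -- K is the index of the cycle running at time n, the first cycle having index 0.
  obtain ⟨K, hK1, hK2⟩ : ∃ K, cycleStart K w ≤ n ∧ n < cycleStart (K + 1) w := by
    have hex : ∃ m, n < cycleStart m w := ⟨n + 1, hmono.id_le (n + 1)⟩
    have h0 : Nat.find hex ≠ 0 := by
      intro h0
      have := Nat.find_spec hex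
      rw [h0] at this
      simp [cycleStart] at this
    obtain ⟨K, hK⟩ := Nat.exists_eq_succ_of_ne_zero h0
    exact ⟨K, not_lt.1 (Nat.find_min hex (by omega)), by rw [← Nat.succ_eq_add_one, ← hK]; exact Nat.find_spec hex⟩
  -- Cycles have length at least one, so n indicator terms are enough.
  have hKn : K ≤ n := (hmono.id_le K).trans hK1
  have hsum : ∑ i ∈ Finset.range n, (if cycleStart (i + 1) w ≤ n then
      cycleSum f (nextCycle^[i + 1] w) else 0)
      = ∑ i ∈ Finset.range K, cycleSum f (nextCycle^[i + 1] w) := by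
    rw [← Finset.sum_filter]
    congr 1
    ext i
    simp only [Finset.mem_filter, Finset.mem_range]
    constructor
    · rintro ⟨-, h⟩
      have := hmono.lt_iff_lt.1 (h.trans_lt hK2)
      omega
    · exact fun h => ⟨by omega, (hmono.monotone (by omega : i + 1 ≤ K)).trans hK1⟩
  -- The first cycle of the path seen from time n ends where the cycle running at n ends.
  have hlen : n + cycleLength (shift n w) = cycleStart (K + 1) w := by
    have h1 := cycleStart_succ K w
    rw [iterate_nextCycle] at h1
    have h2 := regenTime_zero_shift (w := shift (cycleStart K w) w) (hw.shift _).exists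
      (m := n - cycleStart K w) (by rw [cycleLength] at h1; omega)
    rw [shift_shift, Nat.sub_add_cancel hK1] at h2
    rw [cycleLength] at h1 ⊢
    omega
  have h1 := sum_range_cycleStart f (K + 1) w
  rw [← hlen, Finset.sum_range_add, Finset.sum_range_succ'] at h1
  have h2 : cycleSum f (shift n w)
      = ∑ k ∈ Finset.range (cycleLength (shift n w)), f (w (n + k)).1 := by
    rw [cycleSum]
    refine Finset.sum_congr rfl fun k _ => ?_
    rw [shift, add_comm]
  rw [hsum, h2]
  simp only [Function.iterate_zero, id] at h1
  linarith

lemma abs_cycleSum_le (f : S → ℝ) (w : ℕ → S × Bool) : |cycleSum f w| ≤ firstBlockAbs f w :=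
  Finset.abs_sum_le_sum_abs _ _

lemma abs_sum_range_le_firstBlockAbs (f : S → ℝ) {n : ℕ} {w : ℕ → S × Bool}
    (h : n < cycleLength w) : |∑ k ∈ Finset.range n, f (w k).1| ≤ firstBlockAbs f w :=
  (Finset.abs_sum_le_sum_abs _ _).trans (Finset.sum_le_sum_of_subset_of_nonneg
    (Finset.range_subset_range.2 h.le) fun _ _ _ => abs_nonneg _)

variable [MeasurableSpace S]

lemma measurableSet_level (k : ℕ) (b : Bool) :
    MeasurableSet {w : ℕ → S × Bool | (w k).2 = b} :=
  (measurable_snd.comp (measurable_pi_apply k)) (measurableSet_singleton b)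

lemma measurableSet_forall_lt_level (l : ℕ) (b : Bool) :
    MeasurableSet {w : ℕ → S × Bool | ∀ k < l, (w k).2 = b} := by
  have := measurableSet_level (S := S)
  measurability

@[fun_prop]
lemma measurable_regenTime_zero : Measurable (regenTime 0 : (ℕ → S × Bool) → ℕ) := by
  refine measurable_to_countable' fun j => ?_
  have hex : MeasurableSet {w : ℕ → S × Bool | ∃ k, (w k).2 = true} := by
    have := fun k => measurableSet_level (S := S) k true
    measurability
  have : regenTime 0 ⁻¹' {j} = {w : ℕ → S × Bool | ∃ k, (w k).2 = true}.ite
      ({w | (w j).2 = true} ∩ {w | ∀ k < j, (w k).2 = false}) {_w | j = 0} := by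
    ext w
    by_cases hw : ∃ k, (w k).2 = true
    · simp only [Set.mem_preimage, Set.mem_singleton_iff, regenTime_zero_eq_iff hw]
      simp [Set.ite, hw]
    · simp only [Set.mem_preimage, Set.mem_singleton_iff, regenTime_zero_of_not_exists hw]
      have : w ∉ {w : ℕ → S × Bool | ∃ k, (w k).2 = true} := hw
      simp only [Set.ite, Set.mem_union, Set.mem_inter_iff, Set.mem_sdiff, this, and_false,
        not_false_eq_true, and_true, false_or, Set.mem_ofPred_eq]
      exact eq_comm
  rw [this]
  exact hex.ite ((measurableSet_level j true).inter (measurableSet_forall_lt_level j false))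
    (MeasurableSet.const _)

@[fun_prop]
lemma measurable_cycleLength : Measurable (cycleLength : (ℕ → S × Bool) → ℕ) :=
  measurable_regenTime_zero.add_const 1

lemma measurable_cycleSum {f : S → ℝ} (hf : Measurable f) :
    Measurable (cycleSum f : (ℕ → S × Bool) → ℝ) := by
  have h : Measurable fun p : ℕ × (ℕ → S × Bool) => ∑ k ∈ Finset.range p.1, f (p.2 k).1 :=
    measurable_from_prod_countable_right fun n => by dsimp only; fun_prop
  exact h.comp (measurable_cycleLength.prodMk measurable_id)

lemma measurable_firstBlockAbs {f : S → ℝ} (hf : Measurable f) :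
    Measurable (firstBlockAbs f : (ℕ → S × Bool) → ℝ) :=
  measurable_cycleSum (f := fun x => |f x|) (by fun_prop)

@[fun_prop]
lemma measurable_nextCycle : Measurable (nextCycle : (ℕ → S × Bool) → ℕ → S × Bool) := by
  have h : Measurable fun p : ℕ × (ℕ → S × Bool) => shift p.1 p.2 :=
    measurable_from_prod_countable_right fun n => by dsimp only; fun_prop
  exact h.comp (measurable_cycleLength.prodMk measurable_id)

lemma measurable_cycleData {f : S → ℝ} (hf : Measurable f) (i : ℕ) :
    Measurable (cycleData f i : (ℕ → S × Bool) → ℕ × ℝ) :=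
  (measurable_cycleLength.comp (measurable_nextCycle.iterate i)).prodMk
    ((measurable_cycleSum hf).comp (measurable_nextCycle.iterate i))

end Cycles

/-! ### Independence and common law of the cycles. -/

namespace Minorization

variable {S : Type*} [MeasurableSpace S] {P : Kernel S S} [IsMarkovKernel P] (D : Minorization P)

/-- The first cycle is independent of the rest of the path, which has law `P_{ν^*}`. -/
lemma measure_cycleData_inter_nextCycle {f : S → ℝ} (hf : Measurable f) (μ : Measure S)
    [IsProbabilityMeasure μ] (hreg : ∀ᵐ w ∂(D.splitLaw μ), Regenerates w) {A : Set (ℕ × ℝ)}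
    (hA : MeasurableSet A) {H : Set (ℕ → S × Bool)} (hH : MeasurableSet H) :
    D.splitLaw μ (cycleData f 0 ⁻¹' A ∩ nextCycle ⁻¹' H)
      = D.splitLaw μ (cycleData f 0 ⁻¹' A) * D.splitLaw D.ν H := by
  -- The first regeneration is at time j and the cycle it closes has data in A; written so as to
  -- involve the path up to time j only.
  set E : ℕ → Set (ℕ → S × Bool) := fun j => ({w | (w j).2 = true} ∩ {w | ∀ k < j, (w k).2 = false})
    ∩ {w | (j + 1, ∑ k ∈ Finset.range (j + 1), f (w k).1) ∈ A} with hE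
  have hEm : ∀ j, MeasurableSet (E j) := fun j =>
    ((measurableSet_level j true).inter (measurableSet_forall_lt_level j false)).inter
      ((by fun_prop : Measurable fun w : ℕ → S × Bool =>
        ((j + 1, ∑ k ∈ Finset.range (j + 1), f (w k).1) : ℕ × ℝ)) hA)
  have hEj : ∀ j w, stopAt j w ∈ E j ↔ w ∈ E j := fun j w => by
    have h1 : ∀ k < j, stopAt j w k = w k := fun k hk => stopAt_apply_of_le hk.le w
    have h2 : ∑ k ∈ Finset.range (j + 1), f (stopAt j w k).1
        = ∑ k ∈ Finset.range (j + 1), f (w k).1 := Finset.sum_congr rfl fun k hk => by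
      rw [stopAt_apply_of_le (Nat.lt_succ_iff.1 (Finset.mem_range.1 hk))]
    simp +contextual only [hE, Set.mem_inter_iff, Set.mem_ofPred_eq, stopAt_apply_of_le le_rfl, h2, h1]
  have hdisj : Pairwise (Function.onFun Disjoint E) := by
    intro i j hij
    refine Set.disjoint_left.2 fun w hi hj => ?_
    rcases lt_or_gt_of_ne hij with h | h
    · have := hj.1.2 i h
      exact absurd (hi.1.1.symm.trans this) (by decide)
    · have := hi.1.2 j h
      exact absurd (hj.1.1.symm.trans this) (by decide)
  have hEq : ∀ w, Regenerates w → ∀ j, w ∈ E j ↔ regenTime 0 w = j ∧ cycleData f 0 w ∈ A := by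
    intro w hw j
    rw [regenTime_zero_eq_iff hw.exists]
    simp only [hE, Set.mem_inter_iff, Set.mem_ofPred_eq]
    refine and_congr_right fun h => ?_
    rw [← regenTime_zero_eq_iff hw.exists] at h
    simp [cycleData, cycleSum, cycleLength, h]
  have hall : ∀ G : Set (ℕ → S × Bool), MeasurableSet G →
      D.splitLaw μ (cycleData f 0 ⁻¹' A ∩ nextCycle ⁻¹' G)
        = (∑' j, D.splitLaw μ (E j)) * D.splitLaw D.ν G := by
    intro G hG
    have h1 : (cycleData f 0 ⁻¹' A ∩ nextCycle ⁻¹' G : Set (ℕ → S × Bool)) =ᵐ[D.splitLaw μ]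
        ⋃ j, (E j ∩ shift (j + 1) ⁻¹' G : Set (ℕ → S × Bool)) := by
      rw [Filter.eventuallyEq_set]
      filter_upwards [hreg] with w hw
      simp only [Set.mem_inter_iff, Set.mem_preimage, Set.mem_iUnion, hEq w hw]
      constructor
      · exact fun h => ⟨_, ⟨rfl, h.1⟩, h.2⟩
      · rintro ⟨j, ⟨rfl, h⟩, h'⟩
        exact ⟨h, h'⟩
    rw [measure_congr h1, measure_iUnion, ← ENNReal.tsum_mul_right]
    · exact tsum_congr fun j => D.measure_inter_shift_of_regen μ j (hEm j) (hEj j)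
        (fun w hw => hw.1.1) hG
    · exact fun i j hij => (hdisj hij).mono Set.inter_subset_left Set.inter_subset_left
    · exact fun j => (hEm j).inter ((measurable_shift _) hG)
  -- Taking the whole space for G identifies the series with the probability of the first-cycle
  -- event.
  have huniv := hall Set.univ MeasurableSet.univ
  rw [Set.preimage_univ, Set.inter_univ, measure_univ, mul_one] at huniv
  rw [hall H hH, huniv]

lemma map_nextCycle (μ : Measure S) [IsProbabilityMeasure μ]
    (hreg : ∀ᵐ w ∂(D.splitLaw μ), Regenerates w) :
    (D.splitLaw μ).map nextCycle = D.splitLaw D.ν := by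
  ext H hH
  rw [Measure.map_apply (by fun_prop) hH]
  simpa using D.measure_cycleData_inter_nextCycle (f := 0) measurable_zero μ hreg
    MeasurableSet.univ hH

lemma map_iterate_nextCycle (hreg : ∀ (μ : Measure S) [IsProbabilityMeasure μ],
      ∀ᵐ w ∂(D.splitLaw μ), Regenerates w) (μ : Measure S) [IsProbabilityMeasure μ] (i : ℕ) :
    (D.splitLaw μ).map nextCycle^[i + 1] = D.splitLaw D.ν := by
  induction i with
  | zero => simpa using D.map_nextCycle μ (hreg μ)
  | succ i ih =>
    rw [Function.iterate_succ', ← Measure.map_map (by fun_prop) (measurable_nextCycle.iterate _),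
      ih, D.map_nextCycle _ (hreg _)]

/-- Removing the first cycle leaves a path started from ν^*, so the induction has to run over all
initial laws. -/
lemma measure_iInter_cycleData {f : S → ℝ} (hf : Measurable f)
    (hreg : ∀ (μ : Measure S) [IsProbabilityMeasure μ], ∀ᵐ w ∂(D.splitLaw μ), Regenerates w)
    (n : ℕ) (μ : Measure S) [IsProbabilityMeasure μ] {A : ℕ → Set (ℕ × ℝ)}
    (hA : ∀ i, MeasurableSet (A i)) :
    D.splitLaw μ (⋂ i ∈ Finset.range n, cycleData f i ⁻¹' A i)
      = ∏ i ∈ Finset.range n, D.splitLaw μ (cycleData f i ⁻¹' A i) := by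
  induction n generalizing μ A with
  | zero => simp
  | succ n ih =>
    have hset : (⋂ i ∈ Finset.range (n + 1), cycleData f i ⁻¹' A i : Set (ℕ → S × Bool))
        = cycleData f 0 ⁻¹' A 0
          ∩ nextCycle ⁻¹' (⋂ i ∈ Finset.range n, cycleData f i ⁻¹' A (i + 1)) := by
      ext w
      simp only [Set.mem_iInter, Finset.mem_range, Set.mem_inter_iff, Set.mem_preimage]
      constructor
      · exact fun h => ⟨h 0 (by omega), fun i hi => h (i + 1) (by omega)⟩
      · rintro ⟨h0, h⟩ i hi
        cases i with
        | zero => exact h0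
        | succ i => exact h i (by omega)
    have hms : MeasurableSet
        (⋂ i ∈ Finset.range n, cycleData f i ⁻¹' A (i + 1) : Set (ℕ → S × Bool)) :=
      Finset.measurableSet_biInter _ fun i _ => measurable_cycleData hf i (hA _)
    rw [hset, D.measure_cycleData_inter_nextCycle hf μ (hreg μ) (hA 0) hms,
      ih D.ν (fun i => hA (i + 1)), Finset.prod_range_succ', mul_comm]
    congr 1
    refine Finset.prod_congr rfl fun i _ => ?_
    rw [← D.map_nextCycle μ (hreg μ),
      Measure.map_apply (by fun_prop) (measurable_cycleData hf i (hA _))]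
    rfl

/-- The cycles of the split chain are independent. -/
lemma iIndepFun_cycleData {f : S → ℝ} (hf : Measurable f)
    (hreg : ∀ (μ : Measure S) [IsProbabilityMeasure μ], ∀ᵐ w ∂(D.splitLaw μ), Regenerates w)
    (μ : Measure S) [IsProbabilityMeasure μ] :
    iIndepFun (fun i => cycleData f i) (D.splitLaw μ) := by
  classical
  rw [iIndepFun_iff_measure_inter_preimage_eq_mul]
  intro s A hA
  obtain ⟨n, hn⟩ : ∃ n, s ⊆ Finset.range n := s.exists_nat_subset_range
  have h := D.measure_iInter_cycleData hf hreg n μ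
    (A := fun i => if i ∈ s then A i else Set.univ) (fun i => by
      by_cases hi : i ∈ s
      · simpa [hi] using hA i hi
      · simp [hi])
  have h1 : (⋂ i ∈ Finset.range n, cycleData f i ⁻¹' (if i ∈ s then A i else Set.univ) :
      Set (ℕ → S × Bool)) = ⋂ i ∈ s, cycleData f i ⁻¹' A i := by
    ext w
    simp only [Set.mem_iInter, Set.mem_preimage]
    constructor
    · intro h i hi
      simpa [hi] using h i (hn hi)
    · intro h i _
      by_cases hi : i ∈ s
      · simpa [hi] using h i hi
      · simp [hi]
  rw [h1] at h
  rw [h, ← Finset.prod_subset hn]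
  · exact Finset.prod_congr rfl fun i hi => by simp [hi]
  · intro i _ hi
    simp [hi]

lemma map_cycleData_succ {f : S → ℝ} (hf : Measurable f)
    (hreg : ∀ (μ : Measure S) [IsProbabilityMeasure μ], ∀ᵐ w ∂(D.splitLaw μ), Regenerates w)
    (μ : Measure S) [IsProbabilityMeasure μ] (i : ℕ) :
    (D.splitLaw μ).map (cycleData f (i + 1)) = (D.splitLaw D.ν).map (cycleData f 0) := by
  rw [← D.map_iterate_nextCycle hreg μ i, Measure.map_map (measurable_cycleData hf 0)
    (measurable_nextCycle.iterate _)]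
  rfl

end Minorization

/-! ### Stationarity and the occupation formula. -/

lemma map_eval_chainLaw_of_invariant {S : Type*} [MeasurableSpace S] {κ : Kernel S S}
    [IsMarkovKernel κ] {μ : Measure S} [IsProbabilityMeasure μ] (h : κ.Invariant μ) (n : ℕ) :
    (chainLaw κ μ).map (fun w => w n) = μ := by
  induction n with
  | zero => exact map_eval_zero_chainLaw
  | succ n ih =>
    ext A hA
    have h1 := isChain_chainLaw (κ := κ) (μ := μ) n (fun p => A.indicator 1 p.2)
      ((measurable_one.indicator hA).comp measurable_snd)
    simp only [lintegral_indicator_one hA] at h1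
    rw [← lintegral_indicator_one hA, lintegral_map (measurable_one.indicator hA) (by fun_prop), h1,
      ← lintegral_map (μ := chainLaw κ μ) (g := fun w => w n) (f := fun s => κ s A)
        (κ.measurable_coe hA) (by fun_prop), ih, ← Measure.bind_apply hA (Kernel.aemeasurable _), h.def]

namespace Minorization

variable {S : Type*} [MeasurableSpace S] {P : Kernel S S} [IsMarkovKernel P] (D : Minorization P)

omit [IsMarkovKernel P] in
lemma lintegral_split (μ : Measure S) {g : S × Bool → ℝ≥0∞} (hg : Measurable g) :
    ∫⁻ z, g z ∂(D.split μ)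
      = ∫⁻ x, D.regenProb x * g (x, true) + (1 - D.regenProb x) * g (x, false) ∂μ := by
  rw [split, Measure.lintegral_bind (Kernel.aemeasurable _) hg.aemeasurable]
  exact lintegral_congr fun x => D.lintegral_splitKernel x hg

lemma map_eval_splitLaw (μ : Measure S) [IsProbabilityMeasure μ] (n : ℕ) :
    (D.splitLaw μ).map (fun w => w n) = D.split ((chainLaw P μ).map fun w => w n) := by
  have hr := D.measurable_regenProb
  ext A hA
  have hg : Measurable (A.indicator (1 : S × Bool → ℝ≥0∞)) := measurable_one.indicator hA
  have h1 := D.lintegral_level μ n (Φ := fun p => A.indicator 1 ((p.1 n).1, p.2)) (by fun_prop)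
  simp only [eraseLevel_self_fst] at h1
  have hpm : Measurable (fun (w : ℕ → S × Bool) k => (w k).1) :=
    measurable_pi_lambda _ fun _ => by fun_prop
  rw [← lintegral_indicator_one hA, ← lintegral_indicator_one hA, lintegral_map hg (by fun_prop), h1,
    D.lintegral_split _ hg, lintegral_map (by fun_prop) (by fun_prop), ← D.map_fst_splitLaw,
    lintegral_map (by fun_prop) hpm]

lemma map_eval_splitLaw_of_invariant {π : Measure S} [IsProbabilityMeasure π]
    (hinv : P.Invariant π) (n : ℕ) : (D.splitLaw π).map (fun w => w n) = D.split π := by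
  rw [map_eval_splitLaw, map_eval_chainLaw_of_invariant hinv]

lemma map_shift_splitLaw_of_invariant {π : Measure S} [IsProbabilityMeasure π]
    (hinv : P.Invariant π) (n : ℕ) : (D.splitLaw π).map (shift n) = D.splitLaw π := by
  have h := (D.isChain_splitLaw π).map_shift_restrict n MeasurableSet.univ (by simp)
  rw [Measure.restrict_univ] at h
  refine h.ext (D.isChain_splitLaw π) ?_
  rw [Measure.map_map (by fun_prop) (by fun_prop)]
  have hcomp : ((fun w => w 0) ∘ shift n : (ℕ → S × Bool) → S × Bool) = fun w => w n := by
    funext w; simp [shift]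
  rw [hcomp, map_eval_splitLaw_of_invariant D hinv, ← map_eval_splitLaw_of_invariant D hinv 0]

/-- Level one has conditional probability zero off C, so the level set and θ have equal mass under a
split measure. -/
lemma measure_level_of_invariant {π : Measure S} [IsProbabilityMeasure π]
    (hinv : P.Invariant π) (n : ℕ) :
    D.splitLaw π {w | (w n).2 = true} = D.split π D.atom := by
  have hY : MeasurableSet {z : S × Bool | z.2 = true} := measurable_snd (measurableSet_singleton true)
  have hat : MeasurableSet D.atom := D.measurableSet_C.prod (measurableSet_singleton true)
  have h1 : D.splitLaw π {w | (w n).2 = true} = D.split π {z | z.2 = true} := by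
    rw [← map_eval_splitLaw_of_invariant D hinv n, Measure.map_apply (by fun_prop) hY]
    rfl
  rw [h1, ← lintegral_indicator_one hY, ← lintegral_indicator_one hat,
    D.lintegral_split _ (measurable_one.indicator hY), D.lintegral_split _ (measurable_one.indicator hat)]
  refine lintegral_congr fun x => ?_
  by_cases hx : x ∈ D.C
  · simp [atom, hx]
  · simp [atom, hx, D.regenProb_of_notMem hx]

/-- No regeneration occurs before time `l`. -/
def noRegen (S : Type*) (l : ℕ) : Set (ℕ → S × Bool) := {w | ∀ k < l, (w k).2 = false}

lemma measurableSet_noRegen (l : ℕ) : MeasurableSet (noRegen S l) :=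
  measurableSet_forall_lt_level l false

/-- Decomposition over the last regeneration before time `n`. -/
lemma measure_compl_noRegen_inter_shift (μ : Measure S) [IsProbabilityMeasure μ] (n : ℕ)
    {F : Set (ℕ → S × Bool)} (hF : MeasurableSet F) :
    D.splitLaw μ ((noRegen S n)ᶜ ∩ shift n ⁻¹' F)
      = ∑ l ∈ Finset.range n, D.splitLaw μ {w | (w (n - 1 - l)).2 = true}
          * D.splitLaw D.ν (noRegen S l ∩ shift l ⁻¹' F) := by
  set G : ℕ → Set (ℕ → S × Bool) := fun l => noRegen S l ∩ shift l ⁻¹' F with hG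
  have hGm : ∀ l, MeasurableSet (G l) := fun l =>
    (measurableSet_noRegen l).inter ((measurable_shift l) hF)
  -- l counts the times strictly between the last regeneration, at n - 1 - l, and n.
  have hset : (noRegen S n)ᶜ ∩ shift n ⁻¹' F = ⋃ l ∈ Finset.range n,
      ({w : ℕ → S × Bool | (w (n - 1 - l)).2 = true} ∩ shift (n - 1 - l + 1) ⁻¹' G l) := by
    ext w
    simp only [Set.mem_inter_iff, Set.mem_compl_iff, Set.mem_preimage, Set.mem_iUnion,
      Finset.mem_range, exists_prop, hG, shift_shift, noRegen, Set.mem_ofPred_eq]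
    constructor
    · rintro ⟨hno, hw⟩
      push Not at hno
      obtain ⟨k, hk, hkY⟩ := hno
      have hkY : (w k).2 = true := by simpa using hkY
      set j := Nat.findGreatest (fun k => (w k).2 = true) (n - 1) with hj
      have hjY : (w j).2 = true :=
        Nat.findGreatest_spec (P := fun k => (w k).2 = true) (by omega : k ≤ n - 1) hkY
      have hjn : j ≤ n - 1 := Nat.findGreatest_le _
      refine ⟨n - 1 - j, by omega, by rwa [Nat.sub_sub_self hjn], fun i hi => ?_, ?_⟩
      · have := Nat.findGreatest_is_greatest (P := fun k => (w k).2 = true) (n := n - 1)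
          (k := i + (n - 1 - (n - 1 - j) + 1)) (by omega) (by omega)
        simpa [shift] using this
      · convert hw using 2
        omega
    · rintro ⟨l, hl, hY, -, hw⟩
      refine ⟨fun h => ?_, ?_⟩
      · exact absurd (hY.symm.trans (h _ (by omega))) (by decide)
      · convert hw using 2
        omega
  rw [hset, measure_biUnion_finset]
  · refine Finset.sum_congr rfl fun l hl => ?_
    refine D.measure_inter_shift_of_regen μ _ (measurableSet_level _ true) (fun w => ?_)
      (fun w hw => hw) (hGm l)
    simp only [Set.mem_ofPred_eq, stopAt_apply_of_le le_rfl]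
  · have hlt : ∀ a b, a < b → b < n → ∀ w : ℕ → S × Bool, (w (n - 1 - a)).2 = true →
        shift (n - 1 - b + 1) w ∈ G b → False := by
      intro a b hab hb w hY hw
      have := hw.1 (b - a - 1) (by omega)
      rw [shift, show b - a - 1 + (n - 1 - b + 1) = n - 1 - a by omega] at this
      exact absurd (hY.symm.trans this) (by decide)
    intro a ha b hb hab
    have ha := Finset.mem_range.1 ha
    have hb := Finset.mem_range.1 hb
    refine Set.disjoint_left.2 fun w hwa hwb => ?_
    rcases lt_or_gt_of_ne hab with h | h
    · exact hlt a b h hb w hwa.1 hwb.2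
    · exact hlt b a h ha w hwb.1 hwa.2
  · exact fun l _ => (measurableSet_level _ true).inter ((measurable_shift _) (hGm l))

/-- By stationarity F may be observed from time n on; splitting at the last regeneration before n
then gives every term the same factor π^*(θ). -/
lemma measure_eq_noRegen_add {π : Measure S} [IsProbabilityMeasure π] (hinv : P.Invariant π)
    (n : ℕ) {F : Set (ℕ → S × Bool)} (hF : MeasurableSet F) :
    D.splitLaw π F = D.splitLaw π (noRegen S n ∩ shift n ⁻¹' F)
      + D.split π D.atom * ∑ l ∈ Finset.range n, D.splitLaw D.ν (noRegen S l ∩ shift l ⁻¹' F) := by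
  conv_lhs => rw [← map_shift_splitLaw_of_invariant D hinv n, Measure.map_apply (by fun_prop) hF,
    ← measure_inter_add_sdiff _ (measurableSet_noRegen n)]
  rw [Set.inter_comm, Set.sdiff_eq, Set.inter_comm _ (noRegen S n)ᶜ,
    D.measure_compl_noRegen_inter_shift π n hF, Finset.mul_sum]
  simp only [D.measure_level_of_invariant hinv]

/-- The term without regeneration is dropped, so this half of the formula does not need recurrence.
-/
lemma tsum_noRegen_le {π : Measure S} [IsProbabilityMeasure π] (hinv : P.Invariant π)
    {F : Set (ℕ → S × Bool)} (hF : MeasurableSet F) :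
    D.split π D.atom * ∑' l, D.splitLaw D.ν (noRegen S l ∩ shift l ⁻¹' F) ≤ D.splitLaw π F := by
  rw [ENNReal.tsum_eq_iSup_nat, ENNReal.mul_iSup]
  refine iSup_le fun n => ?_
  rw [D.measure_eq_noRegen_add hinv n hF]
  exact le_add_self

/-- The occupation formula for one cycle. -/
lemma tsum_noRegen_eq {π : Measure S} [IsProbabilityMeasure π] (hinv : P.Invariant π)
    (hreg : ∀ᵐ w ∂(D.splitLaw π), Regenerates w) {F : Set (ℕ → S × Bool)} (hF : MeasurableSet F) :
    D.split π D.atom * ∑' l, D.splitLaw D.ν (noRegen S l ∩ shift l ⁻¹' F) = D.splitLaw π F := by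
  have h0 : Filter.Tendsto (fun n => D.splitLaw π (noRegen S n)) Filter.atTop (nhds 0) := by
    have h := tendsto_measure_iInter_atTop (μ := D.splitLaw π) (s := noRegen S)
      (fun n => (measurableSet_noRegen n).nullMeasurableSet)
      (fun m n hmn w hw k hk => hw k (hk.trans_le hmn)) ⟨0, measure_ne_top _ _⟩
    have hz : D.splitLaw π (⋂ n, noRegen S n) = 0 := by
      refine measure_mono_null ?_ (ae_iff.1 hreg)
      intro w hw hreg
      obtain ⟨k, hk⟩ := hreg.exists
      exact absurd (hk.symm.trans (Set.mem_iInter.1 hw (k + 1) k (by omega))) (by decide)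
    rwa [hz] at h
  have h1 : Filter.Tendsto (fun n => D.splitLaw π (noRegen S n ∩ shift n ⁻¹' F)) Filter.atTop
      (nhds 0) :=
    tendsto_of_tendsto_of_tendsto_of_le_of_le tendsto_const_nhds h0 (fun _ => zero_le)
      fun n => measure_mono Set.inter_subset_left
  have h2 := h1.add (ENNReal.Tendsto.const_mul (a := D.split π D.atom)
    (ENNReal.summable (f := fun l => D.splitLaw D.ν (noRegen S l ∩ shift l ⁻¹' F))).hasSum.tendsto_sum_nat
    (Or.inr (measure_ne_top _ _)))
  rw [zero_add] at h2
  refine tendsto_nhds_unique h2 ?_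
  simp only [← D.measure_eq_noRegen_add hinv _ hF]
  exact tendsto_const_nhds

/-- Tail bound for functionals of the path after time `n`, on the event that a regeneration
occurred before. -/
lemma measure_compl_noRegen_inter_shift_le {π : Measure S} [IsProbabilityMeasure π]
    (hinv : P.Invariant π) (hpos : D.split π D.atom ≠ 0) (μ : Measure S) [IsProbabilityMeasure μ]
    (n : ℕ) {F : Set (ℕ → S × Bool)} (hF : MeasurableSet F) :
    D.splitLaw μ ((noRegen S n)ᶜ ∩ shift n ⁻¹' F) ≤ (D.split π D.atom)⁻¹ * D.splitLaw π F := by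
  rw [D.measure_compl_noRegen_inter_shift μ n hF]
  -- Each regeneration probability under μ is bounded by one. This removes all dependence on the
  -- start, and what remains is an occupation sum for ν^*.
  calc _ ≤ ∑ l ∈ Finset.range n, D.splitLaw D.ν (noRegen S l ∩ shift l ⁻¹' F) := by
        refine Finset.sum_le_sum fun l _ => ?_
        exact mul_le_of_le_one_left zero_le prob_le_one
    _ ≤ ∑' l, D.splitLaw D.ν (noRegen S l ∩ shift l ⁻¹' F) := ENNReal.sum_le_tsum _
    _ = (D.split π D.atom)⁻¹ * (D.split π D.atom
          * ∑' l, D.splitLaw D.ν (noRegen S l ∩ shift l ⁻¹' F)) := by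
        rw [← mul_assoc, ENNReal.inv_mul_cancel hpos (measure_ne_top _ _), one_mul]
    _ ≤ _ := by gcongr; exact D.tsum_noRegen_le hinv hF

/-- The mean of a sum over one cycle. -/
lemma lintegral_cycle {π : Measure S} [IsProbabilityMeasure π] (hinv : P.Invariant π)
    (hreg : ∀ (μ : Measure S) [IsProbabilityMeasure μ], ∀ᵐ w ∂(D.splitLaw μ), Regenerates w)
    {g : S → ℝ≥0∞} (hg : Measurable g) :
    D.split π D.atom * ∫⁻ w, ∑ k ∈ Finset.range (cycleLength w), g (w k).1 ∂(D.splitLaw D.ν)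
      = ∫⁻ x, g x ∂π := by
  have hXm : ∀ l, Measurable fun w : ℕ → S × Bool => (w l).1 := fun l => by fun_prop
  -- π is π^*(θ) times the occupation measure of one cycle started from ν^*.
  have hocc : D.split π D.atom • Measure.sum (fun l =>
      ((D.splitLaw D.ν).restrict (noRegen S l)).map fun w => (w l).1) = π := by
    ext A hA
    have hF : MeasurableSet {w : ℕ → S × Bool | (w 0).1 ∈ A} := hXm 0 hA
    have h1 := D.tsum_noRegen_eq hinv (hreg π) hF
    have h2 : D.splitLaw π {w : ℕ → S × Bool | (w 0).1 ∈ A} = π A := by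
      have h3 : {w : ℕ → S × Bool | (w 0).1 ∈ A} = (fun w => w 0) ⁻¹' (Prod.fst ⁻¹' A) := rfl
      rw [h3, ← Measure.map_apply (by fun_prop) (measurable_fst hA),
        map_eval_splitLaw_of_invariant D hinv, ← Measure.map_apply measurable_fst hA, map_fst_split]
    rw [Measure.smul_apply, Measure.sum_apply _ hA, smul_eq_mul, ← h2, ← h1]
    congr 1
    refine tsum_congr fun l => ?_
    rw [Measure.map_apply (hXm l) hA, Measure.restrict_apply ((hXm l) hA), Set.inter_comm]
    congr 2
    ext w
    simp [shift]
  conv_rhs => rw [← hocc]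
  rw [lintegral_smul_measure, lintegral_sum_measure, smul_eq_mul]
  congr 1
  simp only [lintegral_map hg (hXm _)]
  have h4 : ∀ l, ∫⁻ w in noRegen S l, g (w l).1 ∂(D.splitLaw D.ν)
      = ∫⁻ w, (noRegen S l).indicator (fun w => g (w l).1) w ∂(D.splitLaw D.ν) := fun l =>
    (lintegral_indicator (measurableSet_noRegen l) _).symm
  simp only [h4]
  have h5 := lintegral_tsum (μ := D.splitLaw D.ν)
    (f := fun l => (noRegen S l).indicator fun w => g (w l).1)
    fun l => ((hg.comp (hXm l)).indicator (measurableSet_noRegen l)).aemeasurable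
  rw [← h5]
  refine lintegral_congr_ae ?_
  filter_upwards [hreg D.ν] with w hw
  have hmem : ∀ l, w ∈ noRegen S l ↔ l ∈ Finset.range (cycleLength w) := fun l => by
    rw [Finset.mem_range, lt_cycleLength_iff hw.exists]; rfl
  rw [tsum_eq_sum (s := Finset.range (cycleLength w))]
  · exact Finset.sum_congr rfl fun l hl => by rw [Set.indicator_of_mem ((hmem l).2 hl)]
  · exact fun l hl => Set.indicator_of_notMem (fun h => hl ((hmem l).1 h)) _

end Minorization

/-! ### Orlicz norms and tails. -/

section Orlicz

variable {Ω : Type*} [MeasurableSpace Ω] {μ : Measure Ω}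

lemma expNeg_ofReal {u : ℝ} (hu : 0 ≤ u) : expNeg (ENNReal.ofReal u) = ENNReal.ofReal (Real.exp (-u)) := by
  rw [expNeg, if_neg ENNReal.ofReal_ne_top, ENNReal.toReal_ofReal hu]

lemma expNeg_zero : expNeg 0 = 1 := by simp [expNeg]

lemma expNeg_top : expNeg ∞ = 0 := by simp [expNeg]

lemma expNeg_anti {u v : ℝ≥0∞} (h : u ≤ v) : expNeg v ≤ expNeg u := by
  by_cases hv : v = ∞
  · simp [hv, expNeg_top]
  · have hu : u ≠ ∞ := ne_top_of_le_ne_top hv h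
    rw [expNeg, expNeg, if_neg hv, if_neg hu]
    gcongr

/-- Markov's inequality shows that every admissible constant is at least s / L^{1/α}, with L = log
(2/m) and m the probability in question; hence so is the norm. Arguing from below requires neither
that the infimum be attained nor that it be positive. -/
lemma measure_lt_abs_le_psiNorm {α : ℝ} (hα : 0 < α) [IsProbabilityMeasure μ] {Y : Ω → ℝ}
    (hY : Measurable Y) {s : ℝ} (hs : 0 ≤ s) :
    μ {ω | s < |Y ω|} ≤ 2 * expNeg ((ENNReal.ofReal s / psiNorm α μ Y) ^ α) := by
  have h12 : (1 : ℝ≥0∞) ≤ 2 := by norm_num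
  -- This covers s = 0 and an infinite norm, where the bound is the trivial one.
  by_cases hz : ENNReal.ofReal s / psiNorm α μ Y = 0
  · rw [hz, ENNReal.zero_rpow_of_pos hα, expNeg_zero, mul_one]
    exact prob_le_one.trans h12
  have hs0 : 0 < s := by
    rcases hs.eq_or_lt with h | h
    · simp [← h] at hz
    · exact h
  set m := μ {ω | s < |Y ω|} with hm
  rcases eq_or_ne m 0 with hm0 | hm0
  · rw [hm0]; exact zero_le
  have hmt : m ≠ ∞ := measure_ne_top _ _
  have hmpos : 0 < m.toReal := ENNReal.toReal_pos hm0 hmt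
  have hm1 : m.toReal ≤ 1 := by
    rw [← ENNReal.toReal_one]; exact ENNReal.toReal_mono ENNReal.one_ne_top prob_le_one
  set L := Real.log (2 / m.toReal) with hL
  have hLpos : 0 < L := Real.log_pos (by rw [lt_div_iff₀ hmpos]; linarith)
  have hlow : ENNReal.ofReal (s / L ^ (1 / α)) ≤ psiNorm α μ Y := by
    refine le_iInf fun c => le_iInf fun hc => le_iInf fun hint => ENNReal.ofReal_le_ofReal ?_
    have hmark : ENNReal.ofReal (Real.exp (s ^ α / c ^ α)) * m ≤ 2 := by
      refine le_trans ?_ hint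
      refine le_trans ?_ (mul_meas_ge_le_lintegral (by fun_prop)
        (ENNReal.ofReal (Real.exp (s ^ α / c ^ α))))
      refine mul_le_mul_right (measure_mono fun ω hω => ?_) _
      have : s < |Y ω| := hω
      show ENNReal.ofReal _ ≤ ENNReal.ofReal _
      gcongr
    have h2 : Real.exp (s ^ α / c ^ α) * m.toReal ≤ 2 := by
      have := ENNReal.toReal_mono (by norm_num) hmark
      rwa [ENNReal.toReal_mul, ENNReal.toReal_ofReal (Real.exp_pos _).le] at this
    have h3 : s ^ α / c ^ α ≤ L := by
      rw [hL, Real.le_log_iff_exp_le (by positivity), le_div_iff₀ hmpos]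
      exact h2
    rw [← Real.div_rpow hs hc.le] at h3
    have h4 : s / c ≤ L ^ (1 / α) := by
      have := Real.rpow_le_rpow (by positivity) h3 (by positivity : (0 : ℝ) ≤ 1 / α)
      rwa [← Real.rpow_mul (by positivity), mul_one_div_cancel hα.ne', Real.rpow_one] at this
    have hLp : 0 < L ^ (1 / α) := by positivity
    rw [div_le_iff₀ hLp]
    rw [div_le_iff₀ hc] at h4
    linarith
  have hLp : 0 < L ^ (1 / α) := by positivity
  have h5 : (ENNReal.ofReal s / psiNorm α μ Y) ^ α ≤ ENNReal.ofReal L := by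
    calc _ ≤ (ENNReal.ofReal s / ENNReal.ofReal (s / L ^ (1 / α))) ^ α := by gcongr
      _ = ENNReal.ofReal L := by
        rw [← ENNReal.ofReal_div_of_pos (by positivity), ENNReal.ofReal_rpow_of_pos (by positivity)]
        congr 1
        rw [div_div_cancel₀ hs0.ne', ← Real.rpow_mul hLpos.le, one_div_mul_cancel hα.ne', Real.rpow_one]
  calc m = 2 * ENNReal.ofReal (Real.exp (-L)) := by
        rw [hL, Real.exp_neg, Real.exp_log (by positivity)]
        rw [inv_div, ENNReal.ofReal_div_of_pos (by norm_num), ENNReal.ofReal_toReal hmt]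
        rw [ENNReal.ofReal_ofNat, ENNReal.mul_div_cancel (by norm_num) (by norm_num)]
    _ ≤ _ := by
        rw [← expNeg_ofReal hLpos.le]
        gcongr
        exact expNeg_anti h5

lemma ae_eq_zero_of_psiNorm_eq_zero {α : ℝ} (hα : 0 < α) [IsProbabilityMeasure μ] {Y : Ω → ℝ}
    (hY : Measurable Y) (h0 : psiNorm α μ Y = 0) : ∀ᵐ ω ∂μ, Y ω = 0 := by
  have h : ∀ k : ℕ, ∀ᵐ ω ∂μ, |Y ω| ≤ 1 / ((k : ℝ) + 1) := by
    intro k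
    have hk : 0 < 1 / ((k : ℝ) + 1) := by positivity
    have := measure_lt_abs_le_psiNorm (μ := μ) hα hY hk.le
    rw [h0, ENNReal.div_zero (by simpa using hk), ENNReal.top_rpow_of_pos hα, expNeg_top,
      mul_zero] at this
    rw [ae_iff]
    simpa using this
  filter_upwards [ae_all_iff.2 h] with ω hω
  exact abs_eq_zero.1 (le_antisymm (ge_of_tendsto' tendsto_one_div_add_atTop_nhds_zero_nat hω)
    (abs_nonneg _))

lemma lintegral_exp_le_two_of_psiNorm_lt {α : ℝ} (hα : 0 < α) {Y : Ω → ℝ} {c : ℝ} (hc : 0 < c)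
    (h : psiNorm α μ Y < ENNReal.ofReal c) :
    ∫⁻ ω, ENNReal.ofReal (Real.exp (|Y ω| ^ α / c ^ α)) ∂μ ≤ 2 := by
  simp only [psiNorm, iInf_lt_iff] at h
  obtain ⟨c', hc', hint, hlt⟩ := h
  have hlt' : c' < c := (ENNReal.ofReal_lt_ofReal_iff hc).1 hlt
  refine le_trans (lintegral_mono fun ω => ?_) hint
  gcongr

/-- The infimum in the definition of the Orlicz norm is attained. -/
lemma lintegral_exp_psiNorm_le_two {α : ℝ} (hα : 0 < α) {Y : Ω → ℝ} (hY : Measurable Y) {c : ℝ}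
    (hc : 0 < c) (h : psiNorm α μ Y = ENNReal.ofReal c) :
    ∫⁻ ω, ENNReal.ofReal (Real.exp (|Y ω| ^ α / c ^ α)) ∂μ ≤ 2 := by
  -- Admissible constants decreasing to c; Fatou's lemma passes to the limit.
  set C : ℕ → ℝ := fun k => c + 1 / ((k : ℝ) + 1) with hC
  have hCc : ∀ k, c < C k := fun k => by
    have : 0 < 1 / ((k : ℝ) + 1) := by positivity
    simp only [hC]; linarith
  have hlim : Filter.Tendsto C Filter.atTop (nhds c) := by
    simpa [hC] using (tendsto_one_div_add_atTop_nhds_zero_nat (𝕜 := ℝ)).const_add c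
  have hpt : ∀ ω, Filter.Tendsto
      (fun k => ENNReal.ofReal (Real.exp (|Y ω| ^ α / C k ^ α))) Filter.atTop
      (nhds (ENNReal.ofReal (Real.exp (|Y ω| ^ α / c ^ α)))) := fun ω => by
    refine (ENNReal.continuous_ofReal.tendsto _).comp ((Real.continuous_exp.tendsto _).comp ?_)
    exact tendsto_const_nhds.div (hlim.rpow_const (Or.inl hc.ne')) (by positivity)
  calc _ = ∫⁻ ω, Filter.liminf (fun k => ENNReal.ofReal (Real.exp (|Y ω| ^ α / C k ^ α)))
        Filter.atTop ∂μ := lintegral_congr fun ω => (hpt ω).liminf_eq.symm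
    _ ≤ Filter.liminf (fun k => ∫⁻ ω, ENNReal.ofReal (Real.exp (|Y ω| ^ α / C k ^ α)) ∂μ)
        Filter.atTop := lintegral_liminf_le fun k => by fun_prop
    _ ≤ 2 := by
        refine Filter.liminf_le_of_le (by isBoundedDefault) fun b hb => ?_
        obtain ⟨k, hk⟩ := hb.exists
        refine hk.trans (lintegral_exp_le_two_of_psiNorm_lt hα (hc.trans (hCc k)) ?_)
        rw [h]
        exact (ENNReal.ofReal_lt_ofReal_iff (hc.trans (hCc k))).2 (hCc k)

end Orlicz

/-! ### Elementary inequalities for exponentials and powers. -/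

section Numeric

/-- Since (k + 2)! ≥ 2 · 3^k, the exponential series beyond its linear term is dominated by a
geometric series of ratio b/3. -/
lemma exp_le_of_abs_le {x b : ℝ} (hx : |x| ≤ b) (hb : b < 3) :
    Real.exp x ≤ 1 + x + x ^ 2 / (2 * (1 - b / 3)) := by
  have hb0 : 0 ≤ b := (abs_nonneg x).trans hx
  have h1 : HasSum (fun k : ℕ => x ^ k / (k.factorial : ℝ)) (Real.exp x) := by
    rw [Real.exp_eq_exp_ℝ]
    exact NormedSpace.expSeries_div_hasSum_exp x
  have h2 := (hasSum_nat_add_iff' 2).2 h1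
  have h3 : HasSum (fun k : ℕ => x ^ 2 / 2 * (b / 3) ^ k) (x ^ 2 / 2 * (1 - b / 3)⁻¹) :=
    (hasSum_geometric_of_lt_one (by positivity) (by linarith)).mul_left _
  have hfac : ∀ k : ℕ, (2 * 3 ^ k : ℝ) ≤ ((k + 2).factorial : ℝ) := by
    intro k
    induction k with
    | zero => simp
    | succ k ih =>
      rw [show k + 1 + 2 = (k + 2) + 1 by ring, Nat.factorial_succ]
      push_cast
      have : (0 : ℝ) ≤ k := Nat.cast_nonneg k
      calc (2 * 3 ^ (k + 1) : ℝ) = 3 * (2 * 3 ^ k) := by ring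
        _ ≤ ((k : ℝ) + 2 + 1) * ((k + 2).factorial : ℝ) := by gcongr; linarith
  have hle := hasSum_le (fun k => ?_) h2 h3
  · simp only [Finset.sum_range_succ, Finset.sum_range_zero, pow_zero, Nat.factorial, pow_one,
      Nat.cast_one] at hle
    have h4 : x ^ 2 / 2 * (1 - b / 3)⁻¹ = x ^ 2 / (2 * (1 - b / 3)) := by
      rw [div_mul_eq_div_div, div_eq_mul_inv (x ^ 2 / 2)]
    rw [h4] at hle
    norm_num at hle
    linarith
  · calc x ^ (k + 2) / ((k + 2).factorial : ℝ) ≤ |x| ^ (k + 2) / ((k + 2).factorial : ℝ) := by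
          refine div_le_div_of_nonneg_right ?_ (by positivity)
          exact (le_abs_self _).trans (abs_pow x _).le
      _ ≤ (x ^ 2 * b ^ k) / (2 * 3 ^ k) := by
          rw [pow_add, sq_abs, mul_comm]
          gcongr
          exact hfac k
      _ = x ^ 2 / 2 * (b / 3) ^ k := by rw [div_pow]; ring

/-- (1 + x + x²/2)(1 - x + x²/2) = 1 + x⁴/4 ≥ 1, and the first factor is at most e^x. -/
lemma exp_neg_le_quadratic {x : ℝ} (hx : 0 ≤ x) : Real.exp (-x) ≤ 1 - x + x ^ 2 / 2 := by
  have h1 := Real.quadratic_le_exp_of_nonneg hx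
  have h3 : 0 < 1 - x + x ^ 2 / 2 := by nlinarith [sq_nonneg (x - 1)]
  rw [Real.exp_neg, inv_le_comm₀ (Real.exp_pos x) h3]
  refine le_trans ?_ h1
  rw [inv_le_iff_one_le_mul₀ h3]
  nlinarith [sq_nonneg (x ^ 2)]

lemma rpow_sum_le_sum_rpow {ι : Type*} (s : Finset ι) {a : ι → ℝ} (ha : ∀ i, 0 ≤ a i) {α : ℝ}
    (hα0 : 0 < α) (hα1 : α ≤ 1) : (∑ i ∈ s, a i) ^ α ≤ ∑ i ∈ s, a i ^ α := by
  classical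
  induction s using Finset.induction_on with
  | empty => simp [Real.zero_rpow hα0.ne']
  | insert i s hi ih =>
    rw [Finset.sum_insert hi, Finset.sum_insert hi]
    refine (Real.rpow_add_le_add_rpow (ha i) (Finset.sum_nonneg fun j _ => ha j) hα0.le hα1).trans ?_
    gcongr

/-- With u = z^α the claim is (log u + l)/α ≤ u. The logarithm costs at most u/3 + α⁻², and the
remaining 2u/3 ≥ 2l/α² covers both α⁻² and l/α. -/
lemma le_exp_rpow_sub {α l z : ℝ} (hα0 : 0 < α) (hα1 : α ≤ 1) (hl : 1 ≤ l) (hz : 0 < z)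
    (h : 3 * (α ^ 2)⁻¹ * l ≤ z ^ α) : z ≤ Real.exp (z ^ α - l / α) := by
  set u := z ^ α with hu
  have hu0 : 0 < u := by positivity
  have hlogz : Real.log z = Real.log u / α := by
    rw [hu, Real.log_rpow hz]; field_simp
  have h1 : Real.log u ≤ α * u / 3 + 1 / α := by
    have h2 := Real.log_le_sub_one_of_pos (show 0 < α * u / 3 by positivity)
    have h3 := Real.log_le_sub_one_of_pos (show 0 < 1 / α by positivity)
    have h4 := Real.log_le_sub_one_of_pos (show (0 : ℝ) < 3 / 2 by norm_num)
    have h5 := Real.log_le_sub_one_of_pos (show (0 : ℝ) < 2 by norm_num)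
    -- u = (αu/3) · (1/α) · (3/2) · 2, and log x ≤ x - 1 is used for each factor.
    have h6 : Real.log u = Real.log (α * u / 3) + Real.log (1 / α) + (Real.log (3 / 2) + Real.log 2) := by
      rw [← Real.log_mul (by positivity) (by positivity), ← Real.log_mul (by positivity) (by positivity),
        ← Real.log_mul (by positivity) (by positivity)]
      congr 1; field_simp
    linarith
  rw [← Real.log_le_iff_le_exp hz, hlogz]
  have h7 : l / α ≤ (α ^ 2)⁻¹ * l := by
    rw [div_eq_inv_mul]
    gcongr
    nlinarith
  have h8 : (α ^ 2)⁻¹ ≤ (α ^ 2)⁻¹ * l := le_mul_of_one_le_right (by positivity) hl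
  have h9 : Real.log u / α ≤ u / 3 + (α ^ 2)⁻¹ := by
    rw [div_le_iff₀ hα0]
    refine h1.trans (le_of_eq ?_)
    field_simp
  linarith

end Numeric

/-! ### The parts above the truncation level. -/

section Tail

/-- The modulus of `x`, if it exceeds `B`. -/
noncomputable def tailPart (B x : ℝ) : ℝ := if B < |x| then |x| else 0

lemma tailPart_nonneg (B x : ℝ) : 0 ≤ tailPart B x := by
  unfold tailPart; split_ifs <;> positivity

@[fun_prop]
lemma measurable_tailPart (B : ℝ) : Measurable (tailPart B) :=
  Measurable.ite (measurableSet_lt measurable_const (by fun_prop)) (by fun_prop) measurable_const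

variable {α c l B : ℝ}

lemma rpow_div_ge_of_lt_abs (hα0 : 0 < α) (hc : 0 < c) (hl : 1 ≤ l)
    (hB : B = c * (3 * (α ^ 2)⁻¹ * l) ^ (1 / α)) {x : ℝ} (hx : B < |x|) :
    0 < |x| / c ∧ 3 * (α ^ 2)⁻¹ * l ≤ (|x| / c) ^ α := by
  have h0 : 0 < 3 * (α ^ 2)⁻¹ * l := by positivity
  have h1 : (3 * (α ^ 2)⁻¹ * l) ^ (1 / α) ≤ |x| / c := by
    rw [le_div_iff₀ hc, mul_comm, ← hB]; exact hx.le
  have h2 : 0 < (3 * (α ^ 2)⁻¹ * l) ^ (1 / α) := by positivity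
  refine ⟨h2.trans_le h1, ?_⟩
  have := Real.rpow_le_rpow h2.le h1 hα0.le
  rwa [← Real.rpow_mul h0.le, one_div_mul_cancel hα0.ne', Real.rpow_one] at this

lemma tailPart_le_exp (hα0 : 0 < α) (hα1 : α ≤ 1) (hc : 0 < c) (hl : 1 ≤ l)
    (hB : B = c * (3 * (α ^ 2)⁻¹ * l) ^ (1 / α)) (x : ℝ) :
    tailPart B x ≤ c * Real.exp (-(l / α)) * Real.exp (|x| ^ α / c ^ α) := by
  unfold tailPart
  split_ifs with hx
  · obtain ⟨h1, h2⟩ := rpow_div_ge_of_lt_abs hα0 hc hl hB hx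
    have h3 := le_exp_rpow_sub hα0 hα1 hl h1 h2
    rw [div_le_iff₀ hc, Real.div_rpow (abs_nonneg _) hc.le] at h3
    refine h3.trans (le_of_eq ?_)
    rw [mul_assoc, ← Real.exp_add, mul_comm]
    congr 2; ring
  · positivity

/-- Above B the exponent |x|^α/c^α is at least 3l, so half of it can be traded for the factor
e^{-l}. -/
lemma exp_tailPart_le (hα0 : 0 < α) (hα1 : α ≤ 1) (hc : 0 < c) (hl : 1 ≤ l)
    (hB : B = c * (3 * (α ^ 2)⁻¹ * l) ^ (1 / α)) (x : ℝ) :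
    Real.exp (tailPart B x ^ α / (2 * c ^ α))
      ≤ 1 + Real.exp (-l) * Real.exp (|x| ^ α / c ^ α) := by
  unfold tailPart
  split_ifs with hx
  · obtain ⟨h1, h2⟩ := rpow_div_ge_of_lt_abs hα0 hc hl hB hx
    rw [Real.div_rpow (abs_nonneg _) hc.le] at h2
    have h4 : (1 : ℝ) ≤ (α ^ 2)⁻¹ := by
      rw [one_le_inv₀ (by positivity)]; nlinarith
    have h5 : 3 * l ≤ |x| ^ α / c ^ α := by nlinarith
    have h6 : Real.exp (|x| ^ α / (2 * c ^ α)) ≤ Real.exp (-l) * Real.exp (|x| ^ α / c ^ α) := by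
      rw [← Real.exp_add]
      gcongr
      rw [mul_comm 2, ← div_div]
      linarith
    linarith
  · rw [Real.zero_rpow hα0.ne', zero_div, Real.exp_zero]
    have : 0 < Real.exp (-l) * Real.exp (|x| ^ α / c ^ α) := by positivity
    linarith

variable {Ω : Type*} [MeasurableSpace Ω] {μ : Measure Ω} [IsProbabilityMeasure μ]

lemma lintegral_exp_tailPart_le (hα0 : 0 < α) (hα1 : α ≤ 1) (hc : 0 < c) (hl : 1 ≤ l)
    (hB : B = c * (3 * (α ^ 2)⁻¹ * l) ^ (1 / α)) {X : Ω → ℝ} (hX : Measurable X)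
    (hint : ∫⁻ ω, ENNReal.ofReal (Real.exp (|X ω| ^ α / c ^ α)) ∂μ ≤ 2) :
    ∫⁻ ω, ENNReal.ofReal (Real.exp (tailPart B (X ω) ^ α / (2 * c ^ α))) ∂μ
      ≤ ENNReal.ofReal (Real.exp (2 * Real.exp (-l))) := by
  calc _ ≤ ∫⁻ ω, (1 + ENNReal.ofReal (Real.exp (-l))
        * ENNReal.ofReal (Real.exp (|X ω| ^ α / c ^ α))) ∂μ := by
        refine lintegral_mono fun ω => ?_
        rw [← ENNReal.ofReal_mul (by positivity), ← ENNReal.ofReal_one,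
          ← ENNReal.ofReal_add (by positivity) (by positivity)]
        exact ENNReal.ofReal_le_ofReal (exp_tailPart_le hα0 hα1 hc hl hB _)
    _ ≤ 1 + ENNReal.ofReal (Real.exp (-l)) * 2 := by
        rw [lintegral_add_left measurable_const, lintegral_const_mul _ (by fun_prop)]
        simp only [lintegral_const, measure_univ, mul_one]
        gcongr
    _ ≤ _ := by
        rw [← ENNReal.ofReal_ofNat, ← ENNReal.ofReal_mul (by positivity), ← ENNReal.ofReal_one,
          ← ENNReal.ofReal_add (by positivity) (by positivity)]
        refine ENNReal.ofReal_le_ofReal ?_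
        have := Real.add_one_le_exp (2 * Real.exp (-l))
        linarith

omit [IsProbabilityMeasure μ] in
lemma lintegral_tailPart_le (hα0 : 0 < α) (hα1 : α ≤ 1) (hc : 0 < c) (hl : 1 ≤ l)
    (hB : B = c * (3 * (α ^ 2)⁻¹ * l) ^ (1 / α)) {X : Ω → ℝ} (hX : Measurable X)
    (hint : ∫⁻ ω, ENNReal.ofReal (Real.exp (|X ω| ^ α / c ^ α)) ∂μ ≤ 2) :
    ∫⁻ ω, ENNReal.ofReal (tailPart B (X ω)) ∂μ
      ≤ ENNReal.ofReal (2 * c * Real.exp (-(l / α))) := by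
  calc _ ≤ ∫⁻ ω, ENNReal.ofReal (c * Real.exp (-(l / α)))
        * ENNReal.ofReal (Real.exp (|X ω| ^ α / c ^ α)) ∂μ := by
        refine lintegral_mono fun ω => ?_
        rw [← ENNReal.ofReal_mul (by positivity)]
        exact ENNReal.ofReal_le_ofReal (tailPart_le_exp hα0 hα1 hc hl hB _)
    _ ≤ ENNReal.ofReal (c * Real.exp (-(l / α))) * 2 := by
        rw [lintegral_const_mul _ (by fun_prop)]
        gcongr
    _ = _ := by
        rw [← ENNReal.ofReal_ofNat, ← ENNReal.ofReal_mul (by positivity)]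
        congr 1; ring

/-- The sum of the parts exceeding a logarithmic truncation level has a small exponential tail. -/
lemma measure_lt_sum_tailPart_le (hα0 : 0 < α) (hα1 : α ≤ 1) (hc : 0 < c) (hl : 1 ≤ l)
    (hB : B = c * (3 * (α ^ 2)⁻¹ * l) ^ (1 / α)) {X : ℕ → Ω → ℝ} (hX : ∀ i, Measurable (X i))
    (hind : iIndepFun X μ)
    (hint : ∀ i, ∫⁻ ω, ENNReal.ofReal (Real.exp (|X i ω| ^ α / c ^ α)) ∂μ ≤ 2) {n : ℕ}
    (hn : (n : ℝ) ≤ Real.exp l) {e : ℝ} (he0 : 0 ≤ e) (he : e ≤ 2 * c * Real.exp (-(l / α)))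
    {ρ : ℝ} (hρ : 0 ≤ ρ) :
    μ {ω | ρ < ∑ i ∈ Finset.range n, (tailPart B (X i ω) + e)}
      ≤ ENNReal.ofReal (Real.exp (3 - ρ ^ α / (2 * c ^ α))) := by
  set W : ℕ → Ω → ℝ≥0∞ :=
    fun i ω => ENNReal.ofReal (Real.exp (tailPart B (X i ω) ^ α / (2 * c ^ α))) with hW
  have hWm : ∀ i, Measurable (W i) := fun i => by have := hX i; fun_prop
  have hnl : (n : ℝ) * Real.exp (-l) ≤ 1 := by
    rw [Real.exp_neg, ← div_eq_mul_inv, div_le_one (Real.exp_pos _)]; exact hn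
  have hcα : 0 < c ^ α := by positivity
  -- As n ≤ e^l, the n centring corrections e add at most 1 to the exponent.
  have hee : (n : ℝ) * e ^ α / (2 * c ^ α) ≤ 1 := by
    have h1 : e ^ α ≤ 2 * c ^ α * Real.exp (-l) := by
      calc e ^ α ≤ (2 * c * Real.exp (-(l / α))) ^ α := by gcongr
        _ = 2 ^ α * c ^ α * Real.exp (-l) := by
          rw [Real.mul_rpow (by positivity) (by positivity), Real.mul_rpow (by positivity) hc.le,
            ← Real.exp_mul]
          congr 2; field_simp
        _ ≤ 2 * c ^ α * Real.exp (-l) := by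
          gcongr
          calc (2 : ℝ) ^ α ≤ 2 ^ (1 : ℝ) := Real.rpow_le_rpow_of_exponent_le (by norm_num) hα1
            _ = 2 := Real.rpow_one 2
    rw [div_le_one (by positivity)]
    calc (n : ℝ) * e ^ α ≤ n * (2 * c ^ α * Real.exp (-l)) := by gcongr
      _ = (n * Real.exp (-l)) * (2 * c ^ α) := by ring
      _ ≤ 1 * (2 * c ^ α) := by gcongr
      _ = _ := one_mul _
  -- At most e^l factors exp(2e^{-l}) multiply to e²; together with the corrections this gives the
  -- constant e³.
  have hprod : ∫⁻ ω, ∏ i ∈ Finset.range n, W i ω ∂μ ≤ ENNReal.ofReal (Real.exp 2) := by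
    have hWind : iIndepFun W μ := hind.comp
      (fun _ x => ENNReal.ofReal (Real.exp (tailPart B x ^ α / (2 * c ^ α)))) (fun _ => by fun_prop)
    rw [lintegral_prod_eq_prod_lintegral_of_indepFun _ W hWind hWm]
    calc _ ≤ ∏ _i ∈ Finset.range n, ENNReal.ofReal (Real.exp (2 * Real.exp (-l))) :=
          Finset.prod_le_prod' fun i _ => lintegral_exp_tailPart_le hα0 hα1 hc hl hB (hX i) (hint i)
      _ = ENNReal.ofReal (Real.exp (2 * (n * Real.exp (-l)))) := by
          rw [Finset.prod_const, Finset.card_range, ← ENNReal.ofReal_pow (by positivity),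
            ← Real.exp_nat_mul]
          congr 2; ring
      _ ≤ _ := by gcongr; linarith
  set K := Real.exp (ρ ^ α / (2 * c ^ α) - 1) with hK
  have hsub : {ω | ρ < ∑ i ∈ Finset.range n, (tailPart B (X i ω) + e)}
      ⊆ {ω | ENNReal.ofReal K ≤ ∏ i ∈ Finset.range n, W i ω} := by
    intro ω hω
    have hω : ρ < ∑ i ∈ Finset.range n, (tailPart B (X i ω) + e) := hω
    have h1 : ρ ^ α ≤ ∑ i ∈ Finset.range n, tailPart B (X i ω) ^ α + n * e ^ α := by
      calc ρ ^ α ≤ (∑ i ∈ Finset.range n, (tailPart B (X i ω) + e)) ^ α := by gcongr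
        _ ≤ ∑ i ∈ Finset.range n, (tailPart B (X i ω) + e) ^ α :=
          rpow_sum_le_sum_rpow _ (fun i => add_nonneg (tailPart_nonneg _ _) he0) hα0 hα1
        _ ≤ ∑ i ∈ Finset.range n, (tailPart B (X i ω) ^ α + e ^ α) :=
          Finset.sum_le_sum fun i _ =>
            Real.rpow_add_le_add_rpow (tailPart_nonneg _ _) he0 hα0.le hα1
        _ = _ := by rw [Finset.sum_add_distrib]; simp
    show ENNReal.ofReal K ≤ _
    simp only [hW]
    rw [← ENNReal.ofReal_prod_of_nonneg fun i _ => (Real.exp_pos _).le, ← Real.exp_sum,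
      ← Finset.sum_div]
    refine ENNReal.ofReal_le_ofReal (Real.exp_le_exp.2 ?_)
    have h2 : ρ ^ α / (2 * c ^ α) ≤ (∑ i ∈ Finset.range n, tailPart B (X i ω) ^ α + n * e ^ α)
        / (2 * c ^ α) := by gcongr
    rw [add_div] at h2
    linarith
  refine (measure_mono hsub).trans ?_
  refine (meas_ge_le_lintegral_div (Finset.measurable_prod _ fun i _ => hWm i).aemeasurable
    (by simpa using Real.exp_pos _) ENNReal.ofReal_ne_top).trans ?_
  calc _ ≤ ENNReal.ofReal (Real.exp 2) / ENNReal.ofReal K := by gcongr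
    _ = _ := by
      rw [← ENNReal.ofReal_div_of_pos (Real.exp_pos _), ← Real.exp_sub]
      congr 2; ring

end Tail

/-! ### Predictable products of independent factors. -/

section Predictable

variable {Ω : Type*} [MeasurableSpace Ω] {μ : Measure Ω} {X : Type*} [MeasurableSpace X]
  {Z : ℕ → Ω → X}

lemma indepFun_stopAt_succ (hZ : ∀ i, Measurable (Z i)) (hind : iIndepFun Z μ) (N : ℕ) :
    IndepFun (fun ω => stopAt N fun k => Z k ω) (Z (N + 1)) μ := by
  have h := hind.indepFun_finset (Finset.range (N + 1)) {N + 1} (by simp) hZ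
  have h1 : Measurable fun (x : Finset.range (N + 1) → X) (k : ℕ) =>
      x ⟨min k N, by simp⟩ := measurable_pi_lambda _ fun _ => measurable_pi_apply _
  have h2 : Measurable fun x : ({N + 1} : Finset ℕ) → X => x ⟨N + 1, by simp⟩ :=
    measurable_pi_apply _
  exact h.comp h1 h2

open Classical in
/-- A product of factors of mean at most one, each switched on by a predictable event, has mean at
most one. -/
lemma lintegral_prod_predictable_le_one [IsProbabilityMeasure μ] (hZ : ∀ i, Measurable (Z i))
    (hind : iIndepFun Z μ) {h : X → ℝ≥0∞} (hh : Measurable h)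
    (hint : ∀ i, ∫⁻ ω, h (Z (i + 1) ω) ∂μ ≤ 1) {A : ℕ → Set (ℕ → X)}
    (hA : ∀ i, MeasurableSet (A i)) (hAs : ∀ i z, stopAt i z ∈ A i ↔ z ∈ A i) (N : ℕ) :
    ∫⁻ ω, ∏ i ∈ Finset.range N, (if (fun k => Z k ω) ∈ A i then h (Z (i + 1) ω) else 1) ∂μ ≤ 1 := by
  induction N with
  | zero => simp
  | succ N ih =>
    refine le_trans ?_ ih
    set G : (ℕ → X) → ℝ≥0∞ := fun z =>
      ∏ i ∈ Finset.range N, (if z ∈ A i then h (z (i + 1)) else 1) with hG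
    have hGm : Measurable G := Finset.measurable_prod _ fun i _ =>
      Measurable.ite (hA i) (by fun_prop) measurable_const
    have hGs : ∀ z, G (stopAt N z) = G z := fun z => by
      refine Finset.prod_congr rfl fun i hi => ?_
      have hi := Finset.mem_range.1 hi
      rw [stopAt_apply_of_le (by omega : i + 1 ≤ N), ← hAs i (stopAt N z),
        stopAt_stopAt_of_le hi.le, hAs]
    set W : Ω → ℕ → X := fun ω k => Z k ω with hW
    have hWm : Measurable W := measurable_pi_lambda _ hZ
    -- Only the part of G on A N acquires the new factor; it depends on coordinates up to N and is
    -- therefore independent of that factor.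
    set G1 := (A N).indicator G with hG1
    set G2 := (A N)ᶜ.indicator G with hG2
    have hG1m : Measurable G1 := hGm.indicator (hA N)
    have hG2m : Measurable G2 := hGm.indicator (hA N).compl
    have hG1s : ∀ z, G1 (stopAt N z) = G1 z := fun z => by
      by_cases hz : z ∈ A N
      · rw [hG1, Set.indicator_of_mem hz, Set.indicator_of_mem ((hAs N z).2 hz), hGs]
      · rw [hG1, Set.indicator_of_notMem hz, Set.indicator_of_notMem (fun h => hz ((hAs N z).1 h))]
    have hindep : IndepFun (fun ω => G1 (W ω)) (fun ω => h (Z (N + 1) ω)) μ := by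
      have := (indepFun_stopAt_succ hZ hind N).comp hG1m hh
      simpa only [Function.comp_def, hG1s] using this
    calc _ = ∫⁻ ω, (G1 (W ω) * h (Z (N + 1) ω) + G2 (W ω)) ∂μ := by
          refine lintegral_congr fun ω => ?_
          rw [Finset.prod_range_succ]
          change G (W ω) * (if W ω ∈ A N then _ else _) = _
          by_cases hw : W ω ∈ A N <;> simp [hG1, hG2, hw]
      _ = (∫⁻ ω, G1 (W ω) ∂μ) * ∫⁻ ω, h (Z (N + 1) ω) ∂μ + ∫⁻ ω, G2 (W ω) ∂μ := by
          rw [lintegral_add_right _ (by fun_prop)]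
          congr 1
          exact lintegral_mul_eq_lintegral_mul_lintegral_of_indepFun (by fun_prop)
            (hh.comp (hZ _)) hindep
      _ ≤ (∫⁻ ω, G1 (W ω) ∂μ) * 1 + ∫⁻ ω, G2 (W ω) ∂μ := by gcongr; exact hint N
      _ = ∫⁻ ω, G (W ω) ∂μ := by
          rw [mul_one, ← lintegral_add_right _ (by fun_prop)]
          refine lintegral_congr fun ω => ?_
          by_cases hw : W ω ∈ A N <;> simp [hG1, hG2, hw]

end Predictable

/-! ### A summation estimate for the number of cycles. -/

section Numeric

/-- Up to k = ⌊a⌋ + 1 the bound p ≤ 1 makes the sum telescope to e^{κk}. Beyond k the decay e^{2κ(a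
- i)} outweighs e^{κi}, and the terms telescope again, to at most e^{κ(1 + 2a - k)}. Both are at
most e^{κ(a+1)} because a ≤ k ≤ a + 1. -/
lemma one_add_sum_exp_le {κ a : ℝ} (hκ : 0 ≤ κ) (ha : 0 ≤ a) {p : ℕ → ℝ} (hp1 : ∀ i, p i ≤ 1)
    (hp2 : ∀ i, p i ≤ Real.exp (2 * κ * (a - i))) (N : ℕ) :
    1 + ∑ i ∈ Finset.range N, (Real.exp κ - 1) * Real.exp (κ * i) * p i
      ≤ 2 * Real.exp (κ * (a + 1)) := by
  set S : ℕ → ℝ := fun N => 1 + ∑ i ∈ Finset.range N, (Real.exp κ - 1) * Real.exp (κ * i) * p i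
    with hS
  have hκ1 : 0 ≤ Real.exp κ - 1 := by have := Real.add_one_le_exp κ; linarith
  have hstep : ∀ N, S (N + 1) = S N + (Real.exp κ - 1) * Real.exp (κ * N) * p N := fun N => by
    simp only [hS, Finset.sum_range_succ]; ring
  have h1 : ∀ N, S N ≤ Real.exp (κ * N) := by
    intro N
    induction N with
    | zero => simp [hS]
    | succ N ih =>
      have : Real.exp (κ * (N + 1 : ℕ)) = Real.exp (κ * N) + (Real.exp κ - 1) * Real.exp (κ * N) * 1 := by
        push_cast; rw [mul_add, Real.exp_add, mul_one]; ring
      rw [hstep, this]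
      gcongr
      exact hp1 N
  set k := ⌊a⌋₊ + 1 with hk
  have hka : a ≤ k := by rw [hk]; push_cast; exact (Nat.lt_floor_add_one a).le
  have hka1 : (k : ℝ) ≤ a + 1 := by
    rw [hk]; push_cast; have := Nat.floor_le ha; linarith
  have h2 : ∀ m, S (k + m) ≤ Real.exp (κ * k)
      + Real.exp (κ * (1 + 2 * a)) * (Real.exp (-(κ * k)) - Real.exp (-(κ * (k + m : ℕ)))) := by
    intro m
    induction m with
    | zero => simpa using h1 k
    | succ m ih =>
      rw [← add_assoc, hstep]
      have h3 : (Real.exp κ - 1) * Real.exp (κ * (k + m : ℕ)) * p (k + m)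
          ≤ (Real.exp κ - 1) * Real.exp (κ * (k + m : ℕ)) * Real.exp (2 * κ * (a - (k + m : ℕ))) := by
        gcongr
        exact hp2 _
      have h4 : (Real.exp κ - 1) * Real.exp (κ * (k + m : ℕ)) * Real.exp (2 * κ * (a - (k + m : ℕ)))
          = Real.exp (κ * (1 + 2 * a))
            * (Real.exp (-(κ * (k + m : ℕ))) - Real.exp (-(κ * (k + m + 1 : ℕ)))) := by
        rw [mul_assoc, ← Real.exp_add, sub_mul, mul_sub (Real.exp _), one_mul]
        simp only [← Real.exp_add]
        push_cast
        congr 2 <;> ring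
      linarith
  rcases le_total N k with h | h
  · have := h1 N
    have h5 : Real.exp (κ * N) ≤ Real.exp (κ * (a + 1)) := by
      gcongr
      exact (Nat.cast_le.2 h).trans hka1
    have := Real.exp_pos (κ * (a + 1))
    change S N ≤ _
    linarith
  · obtain ⟨m, rfl⟩ := Nat.exists_eq_add_of_le h
    refine (h2 m).trans ?_
    have h5 : Real.exp (κ * k) ≤ Real.exp (κ * (a + 1)) := by gcongr
    have h6 : Real.exp (κ * (1 + 2 * a)) * (Real.exp (-(κ * k)) - Real.exp (-(κ * (k + m : ℕ))))
        ≤ Real.exp (κ * (a + 1)) := by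
      calc _ ≤ Real.exp (κ * (1 + 2 * a)) * Real.exp (-(κ * k)) := by
            gcongr
            have := Real.exp_pos (-(κ * (k + m : ℕ)))
            linarith
        _ = Real.exp (κ * (1 + 2 * a - k)) := by rw [← Real.exp_add]; congr 1; ring
        _ ≤ _ := by
            gcongr
            linarith
    linarith

end Numeric

/-! ### Bounds on moment generating functions. -/

section Moments

variable {Ω : Type*} [MeasurableSpace Ω] {μ : Measure Ω} [IsProbabilityMeasure μ]

/-- Centring removes the linear term, and `exp_le_of_abs_le` leaves only the variance. -/
lemma integral_exp_le_of_abs_le {Y : Ω → ℝ} (hY : Measurable Y) {U v θ : ℝ} (hU : ∀ ω, |Y ω| ≤ U)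
    (hmean : ∫ ω, Y ω ∂μ = 0) (hvar : ∫ ω, Y ω ^ 2 ∂μ ≤ v) (hθ : 0 ≤ θ) (hθU : θ * U < 3) :
    ∫ ω, Real.exp (θ * Y ω) ∂μ ≤ Real.exp (θ ^ 2 * v / (2 * (1 - θ * U / 3))) := by
  have hI1 : Integrable Y μ := Integrable.of_bound hY.aestronglyMeasurable U
    (Filter.Eventually.of_forall hU)
  have hI2 : Integrable (fun ω => Y ω ^ 2) μ := by
    refine Integrable.of_bound (by fun_prop) (U ^ 2) (Filter.Eventually.of_forall fun ω => ?_)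
    rw [Real.norm_eq_abs, abs_pow]
    gcongr
    exact hU ω
  have hpos : 0 < 2 * (1 - θ * U / 3) := by linarith
  have hpt : ∀ ω, Real.exp (θ * Y ω)
      ≤ 1 + θ * Y ω + θ ^ 2 / (2 * (1 - θ * U / 3)) * Y ω ^ 2 := fun ω => by
    refine (exp_le_of_abs_le (b := θ * U) ?_ hθU).trans (le_of_eq ?_)
    · rw [abs_mul, abs_of_nonneg hθ]; gcongr; exact hU ω
    · ring
  have hIe : Integrable (fun ω => Real.exp (θ * Y ω)) μ := by
    refine Integrable.of_bound (by fun_prop) (Real.exp (θ * U)) (Filter.Eventually.of_forall fun ω => ?_)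
    rw [Real.norm_eq_abs, Real.abs_exp]
    gcongr
    exact (le_abs_self _).trans (hU ω)
  calc _ ≤ ∫ ω, (1 + θ * Y ω + θ ^ 2 / (2 * (1 - θ * U / 3)) * Y ω ^ 2) ∂μ :=
        integral_mono hIe (((integrable_const 1).add (hI1.const_mul θ)).add (hI2.const_mul _)) hpt
    _ = 1 + θ ^ 2 / (2 * (1 - θ * U / 3)) * ∫ ω, Y ω ^ 2 ∂μ := by
        have hI3 : Integrable (fun ω => 1 + θ * Y ω) μ := (integrable_const 1).add (hI1.const_mul θ)
        rw [integral_add hI3 (hI2.const_mul _), integral_add (integrable_const 1) (hI1.const_mul θ),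
          integral_const_mul, integral_const_mul, hmean]
        simp
    _ ≤ 1 + θ ^ 2 / (2 * (1 - θ * U / 3)) * v := by gcongr
    _ ≤ _ := by
        have := Real.add_one_le_exp (θ ^ 2 * v / (2 * (1 - θ * U / 3)))
        rw [div_mul_eq_mul_div]
        linarith

/-- For T ≥ 0 the function e^{-lT} lies below its second-order expansion, so two moments suffice. -/
lemma integral_exp_neg_le {T : Ω → ℝ} (hT : Measurable T) (hT0 : ∀ ω, 0 ≤ T ω)
    (h1 : Integrable T μ) (h2 : Integrable (fun ω => T ω ^ 2) μ) {l : ℝ} (hl : 0 ≤ l) :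
    ∫ ω, Real.exp (-(l * T ω)) ∂μ
      ≤ Real.exp (-(l * ∫ ω, T ω ∂μ) + l ^ 2 / 2 * ∫ ω, T ω ^ 2 ∂μ) := by
  have hIe : Integrable (fun ω => Real.exp (-(l * T ω))) μ := by
    refine Integrable.of_bound (by fun_prop) 1 (Filter.Eventually.of_forall fun ω => ?_)
    rw [Real.norm_eq_abs, Real.abs_exp, Real.exp_le_one_iff]
    have := mul_nonneg hl (hT0 ω)
    linarith
  calc _ ≤ ∫ ω, (1 - l * T ω + l ^ 2 / 2 * T ω ^ 2) ∂μ := by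
        refine integral_mono hIe (((integrable_const 1).sub (h1.const_mul l)).add (h2.const_mul _))
          fun ω => ?_
        refine (exp_neg_le_quadratic (mul_nonneg hl (hT0 ω))).trans (le_of_eq ?_)
        ring
    _ = 1 - l * ∫ ω, T ω ∂μ + l ^ 2 / 2 * ∫ ω, T ω ^ 2 ∂μ := by
        have h3 : Integrable (fun ω => 1 - l * T ω) μ := (integrable_const 1).sub (h1.const_mul l)
        rw [integral_add h3 (h2.const_mul _), integral_sub (integrable_const 1) (h1.const_mul l), integral_const_mul,
          integral_const_mul]
        simp
    _ ≤ _ := by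
        have := Real.add_one_le_exp (-(l * ∫ ω, T ω ∂μ) + l ^ 2 / 2 * ∫ ω, T ω ^ 2 ∂μ)
        linarith

end Moments

/-! ### Sums over the cycles completed by time n. -/

section RandomSum

variable {Ω : Type*} [MeasurableSpace Ω] {μ : Measure Ω} {Z : ℕ → Ω → ℕ × ℝ}

/-- The sequences of cycles for which at least `i + 1` cycles are completed by time `n`. -/
def completed (n i : ℕ) : Set (ℕ → ℕ × ℝ) := {z | ∑ k ∈ Finset.range (i + 1), (z k).1 ≤ n}

lemma measurableSet_completed (n i : ℕ) : MeasurableSet (completed n i) :=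
  measurableSet_le (by fun_prop) measurable_const

lemma stopAt_mem_completed (n i : ℕ) (z : ℕ → ℕ × ℝ) :
    stopAt i z ∈ completed n i ↔ z ∈ completed n i := by
  have : ∑ k ∈ Finset.range (i + 1), (stopAt i z k).1 = ∑ k ∈ Finset.range (i + 1), (z k).1 :=
    Finset.sum_congr rfl fun k hk => by
      rw [stopAt_apply_of_le (Nat.lt_succ_iff.1 (Finset.mem_range.1 hk))]
  simp only [completed, Set.mem_ofPred_eq, this]

open Classical in
/-- The number of cycles, among the first `N`, completed by time `n`. -/
noncomputable def completedCount (n N : ℕ) (z : ℕ → ℕ × ℝ) : ℝ :=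
  ∑ i ∈ Finset.range N, if z ∈ completed n i then 1 else 0

open Classical in
/-- The sum of the values of the cycles following the ones completed by time `n`. -/
noncomputable def completedSum (n N : ℕ) (z : ℕ → ℕ × ℝ) : ℝ :=
  ∑ i ∈ Finset.range N, if z ∈ completed n i then (z (i + 1)).2 else 0

@[fun_prop]
lemma measurable_completedCount (n N : ℕ) : Measurable (completedCount n N) :=
  Finset.measurable_sum _ fun i _ =>
    Measurable.ite (measurableSet_completed n i) measurable_const measurable_const

@[fun_prop]
lemma measurable_completedSum (n N : ℕ) : Measurable (completedSum n N) :=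
  Finset.measurable_sum _ fun i _ =>
    Measurable.ite (measurableSet_completed n i) (by fun_prop) measurable_const

lemma completedCount_le (n N : ℕ) (z : ℕ → ℕ × ℝ) : completedCount n N z ≤ N := by
  refine (Finset.sum_le_sum (g := fun _ => (1 : ℝ)) fun i _ => ?_).trans (by simp)
  split_ifs <;> simp

variable [IsProbabilityMeasure μ]

/-- Whether value i + 1 is counted depends on entries 0, ..., i only, so the exponential is a
product of predictable factors. -/
lemma lintegral_exp_completedSum_sub_le_one (hZ : ∀ i, Measurable (Z i)) (hind : iIndepFun Z μ)
    {θ φ : ℝ} (hint : ∀ i, ∫⁻ ω, ENNReal.ofReal (Real.exp (θ * (Z (i + 1) ω).2 - φ)) ∂μ ≤ 1)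
    (n N : ℕ) :
    ∫⁻ ω, ENNReal.ofReal (Real.exp (θ * completedSum n N (fun k => Z k ω)
      - φ * completedCount n N (fun k => Z k ω))) ∂μ ≤ 1 := by
  classical
  refine le_trans (le_of_eq (lintegral_congr fun ω => ?_)) (lintegral_prod_predictable_le_one hZ hind
    (h := fun x => ENNReal.ofReal (Real.exp (θ * x.2 - φ))) (by fun_prop) hint
    (measurableSet_completed n) (stopAt_mem_completed n) N)
  rw [completedSum, completedCount, Finset.mul_sum, Finset.mul_sum, ← Finset.sum_sub_distrib,
    Real.exp_sum, ENNReal.ofReal_prod_of_nonneg fun i _ => (Real.exp_pos _).le]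
  refine Finset.prod_congr rfl fun i _ => ?_
  split_ifs <;> simp

/-- Chernoff's bound for the lengths of cycles 1, ..., i. The length of cycle 0, whose law depends
on the start, is simply discarded. -/
lemma measure_completed_le (hZ : ∀ i, Measurable (Z i)) (hind : iIndepFun Z μ) {l κ : ℝ}
    (hl : 0 ≤ l)
    (hint : ∀ i, ∫⁻ ω, ENNReal.ofReal (Real.exp (2 * κ - l * (Z (i + 1) ω).1)) ∂μ ≤ 1) (n i : ℕ) :
    μ {ω | (fun k => Z k ω) ∈ completed n i}
      ≤ ENNReal.ofReal (Real.exp (l * n - 2 * κ * i)) := by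
  classical
  have h := lintegral_prod_predictable_le_one hZ hind
    (h := fun x => ENNReal.ofReal (Real.exp (2 * κ - l * x.1))) (by fun_prop) hint
    (A := fun _ => Set.univ) (fun _ => MeasurableSet.univ) (by simp) i
  simp only [Set.mem_univ, if_true] at h
  have hsub : {ω | (fun k => Z k ω) ∈ completed n i} ⊆
      {ω | ENNReal.ofReal (Real.exp (2 * κ * i - l * n))
        ≤ ∏ k ∈ Finset.range i, ENNReal.ofReal (Real.exp (2 * κ - l * (Z (k + 1) ω).1))} := by
    intro ω hω
    have hω : ∑ k ∈ Finset.range (i + 1), (Z k ω).1 ≤ n := hω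
    rw [Finset.sum_range_succ'] at hω
    have h1 : ∑ k ∈ Finset.range i, ((Z (k + 1) ω).1 : ℝ) ≤ n := by
      exact_mod_cast (Nat.le_add_right _ _).trans hω
    show ENNReal.ofReal _ ≤ _
    rw [← ENNReal.ofReal_prod_of_nonneg fun i _ => (Real.exp_pos _).le, ← Real.exp_sum,
      Finset.sum_sub_distrib, Finset.sum_const, Finset.card_range, nsmul_eq_mul, ← Finset.mul_sum]
    refine ENNReal.ofReal_le_ofReal (Real.exp_le_exp.2 ?_)
    have := mul_le_mul_of_nonneg_left h1 hl
    linarith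
  refine (measure_mono hsub).trans ?_
  refine (meas_ge_le_lintegral_div (Finset.measurable_prod _ fun k _ => by
    have := hZ (k + 1); fun_prop).aemeasurable
    (by simpa using Real.exp_pos _) ENNReal.ofReal_ne_top).trans ?_
  calc _ ≤ 1 / ENNReal.ofReal (Real.exp (2 * κ * i - l * n)) := by gcongr
    _ = _ := by
      rw [one_div, ← ENNReal.ofReal_inv_of_pos (Real.exp_pos _), ← Real.exp_neg, neg_sub]

/-- Each further completed cycle raises the exponential by at most (e^κ - 1)e^{κi}; taking
expectations reduces the claim to `one_add_sum_exp_le`. -/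
lemma integral_exp_completedCount_le (hZ : ∀ i, Measurable (Z i)) (hind : iIndepFun Z μ)
    {l κ a : ℝ} (hl : 0 ≤ l) (hκ : 0 ≤ κ) (ha : 0 ≤ a)
    (hint : ∀ i, ∫⁻ ω, ENNReal.ofReal (Real.exp (2 * κ - l * (Z (i + 1) ω).1)) ∂μ ≤ 1) {n : ℕ}
    (hln : l * n = 2 * κ * a) (N : ℕ) :
    ∫⁻ ω, ENNReal.ofReal (Real.exp (κ * completedCount n N (fun k => Z k ω))) ∂μ
      ≤ ENNReal.ofReal (2 * Real.exp (κ * (a + 1))) := by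
  classical
  set W : Ω → ℕ → ℕ × ℝ := fun ω k => Z k ω with hW
  have hWm : Measurable W := measurable_pi_lambda _ hZ
  set E : ℕ → Set Ω := fun i => {ω | W ω ∈ completed n i} with hE
  have hEm : ∀ i, MeasurableSet (E i) := fun i => hWm (measurableSet_completed n i)
  have hκ1 : 0 ≤ Real.exp κ - 1 := by have := Real.add_one_le_exp κ; linarith
  have hpt : ∀ N ω, Real.exp (κ * completedCount n N (W ω)) ≤ 1 + ∑ i ∈ Finset.range N,
      (Real.exp κ - 1) * Real.exp (κ * i) * (E i).indicator 1 ω := by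
    intro N ω
    induction N with
    | zero => simp [completedCount]
    | succ N ih =>
      rw [Finset.sum_range_succ, ← add_assoc]
      have hsucc : completedCount n (N + 1) (W ω) = completedCount n N (W ω)
          + if W ω ∈ completed n N then 1 else 0 := Finset.sum_range_succ _ _
      rw [hsucc]
      by_cases hw : W ω ∈ completed n N
      · have hwE : ω ∈ E N := hw
        rw [if_pos hw, Set.indicator_of_mem hwE, mul_add, Real.exp_add, mul_one, Pi.one_apply, mul_one]
        have h1 : Real.exp (κ * completedCount n N (W ω)) ≤ Real.exp (κ * N) := by
          gcongr
          exact completedCount_le n N _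
        nlinarith
      · have hwE : ω ∉ E N := hw
        rw [if_neg hw, Set.indicator_of_notMem hwE]
        simpa using ih
  have hIi : ∀ i : ℕ, Integrable (fun ω => (Real.exp κ - 1) * Real.exp (κ * i) *
      (E i).indicator (1 : Ω → ℝ) ω) μ := fun i =>
    ((integrable_const (1 : ℝ)).indicator (hEm i)).const_mul _
  have hI : Integrable (fun ω => 1 + ∑ i ∈ Finset.range N,
      (Real.exp κ - 1) * Real.exp (κ * i) * (E i).indicator (1 : Ω → ℝ) ω) μ :=
    (integrable_const 1).add (integrable_finsetSum _ fun i _ => hIi i)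
  calc _ ≤ ∫⁻ ω, ENNReal.ofReal (1 + ∑ i ∈ Finset.range N,
        (Real.exp κ - 1) * Real.exp (κ * i) * (E i).indicator 1 ω) ∂μ :=
        lintegral_mono fun ω => ENNReal.ofReal_le_ofReal (hpt N ω)
    _ = ENNReal.ofReal (∫ ω, 1 + ∑ i ∈ Finset.range N,
        (Real.exp κ - 1) * Real.exp (κ * i) * (E i).indicator (1 : Ω → ℝ) ω ∂μ) := by
        rw [ofReal_integral_eq_lintegral_ofReal hI]
        exact Filter.Eventually.of_forall fun ω => (Real.exp_pos _).le.trans (hpt N ω)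
    _ = ENNReal.ofReal (1 + ∑ i ∈ Finset.range N,
        (Real.exp κ - 1) * Real.exp (κ * i) * μ.real (E i)) := by
        rw [integral_add (integrable_const 1) (integrable_finsetSum _ fun i _ => hIi i),
          integral_finsetSum _ fun i _ => hIi i]
        simp only [integral_const_mul, integral_indicator_one (hEm _)]
        simp
    _ ≤ _ := by
        refine ENNReal.ofReal_le_ofReal (one_add_sum_exp_le hκ ha (fun i => measureReal_le_one)
          (fun i => ?_) N)
        have h := measure_completed_le hZ hind hl hint n i
        have h2 := ENNReal.toReal_mono ENNReal.ofReal_ne_top h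
        rw [ENNReal.toReal_ofReal (Real.exp_pos _).le, hln] at h2
        refine h2.trans (le_of_eq ?_)
        congr 1; ring

/-- Hölder's inequality decouples the exponential martingale from the number of cycles. -/
lemma measure_lt_completedSum_le (hZ : ∀ i, Measurable (Z i)) (hind : iIndepFun Z μ)
    {l κ a θ ε s : ℝ} (hl : 0 ≤ l) (hκ : 0 ≤ κ) (ha : 0 ≤ a) (hε : 0 < ε) (hθ : 0 ≤ θ)
    (hint : ∀ i, ∫⁻ ω, ENNReal.ofReal (Real.exp (2 * κ - l * (Z (i + 1) ω).1)) ∂μ ≤ 1)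
    (hint2 : ∀ i, ∫⁻ ω, ENNReal.ofReal (Real.exp ((1 + ε) * θ * (Z (i + 1) ω).2 - ε * κ)) ∂μ ≤ 1)
    {n : ℕ} (hln : l * n = 2 * κ * a) (N : ℕ) :
    μ {ω | s < completedSum n N (fun k => Z k ω)}
      ≤ ENNReal.ofReal (2 ^ (ε / (1 + ε))
        * Real.exp (-(θ * s) + ε * κ * (a + 1) / (1 + ε))) := by
  set W : Ω → ℕ → ℕ × ℝ := fun ω k => Z k ω with hW
  have hWm : Measurable W := measurable_pi_lambda _ hZ
  have hr : 0 < 1 + ε := by linarith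
  have hpq : (1 + ε).HolderConjugate ((1 + ε) / ε) := by
    rw [Real.holderConjugate_iff]
    exact ⟨by linarith, by field_simp⟩
  -- The term εκN/(1+ε) is subtracted in F and restored in G; the Hölder powers of F and G are then
  -- exactly the two exponentials already controlled.
  set F : Ω → ℝ≥0∞ := fun ω => ENNReal.ofReal (Real.exp
    (((1 + ε) * θ * completedSum n N (W ω) - ε * κ * completedCount n N (W ω)) / (1 + ε))) with hF
  set G : Ω → ℝ≥0∞ := fun ω => ENNReal.ofReal (Real.exp
    (ε * κ * completedCount n N (W ω) / (1 + ε))) with hG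
  have hholder := ENNReal.lintegral_mul_le_Lp_mul_Lq μ hpq (f := F) (g := G)
    (by fun_prop) (by fun_prop)
  have hFG : ∀ ω, (F * G) ω = ENNReal.ofReal (Real.exp (θ * completedSum n N (W ω))) := fun ω => by
    rw [Pi.mul_apply, hF, hG, ← ENNReal.ofReal_mul (Real.exp_pos _).le, ← Real.exp_add]
    congr 2; field_simp; ring
  have hFp : ∀ ω, F ω ^ (1 + ε) = ENNReal.ofReal (Real.exp
      ((1 + ε) * θ * completedSum n N (W ω) - ε * κ * completedCount n N (W ω))) := fun ω => by
    rw [hF, ENNReal.ofReal_rpow_of_pos (Real.exp_pos _), ← Real.exp_mul]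
    congr 2; field_simp
  have hGq : ∀ ω, G ω ^ ((1 + ε) / ε) = ENNReal.ofReal (Real.exp
      (κ * completedCount n N (W ω))) := fun ω => by
    rw [hG, ENNReal.ofReal_rpow_of_pos (Real.exp_pos _), ← Real.exp_mul]
    congr 2; field_simp
  simp only [hFG, hFp, hGq] at hholder
  have h1 := lintegral_exp_completedSum_sub_le_one hZ hind hint2 n N
  have h2 := integral_exp_completedCount_le hZ hind hl hκ ha hint hln N
  have h3 : ∫⁻ ω, ENNReal.ofReal (Real.exp (θ * completedSum n N (W ω))) ∂μ
      ≤ ENNReal.ofReal (2 ^ (ε / (1 + ε)) * Real.exp (ε * κ * (a + 1) / (1 + ε))) := by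
    calc _ ≤ _ := hholder
      _ ≤ 1 ^ (1 / (1 + ε)) * (ENNReal.ofReal (2 * Real.exp (κ * (a + 1)))) ^ (1 / ((1 + ε) / ε)) := by
        gcongr
      _ = _ := by
        rw [ENNReal.one_rpow, one_mul, ENNReal.ofReal_rpow_of_pos (by positivity),
          Real.mul_rpow (by norm_num) (Real.exp_pos _).le, ← Real.exp_mul, one_div_div]
        congr 3; field_simp
  have hsub : {ω | s < completedSum n N (W ω)} ⊆ {ω | ENNReal.ofReal (Real.exp (θ * s))
      ≤ ENNReal.ofReal (Real.exp (θ * completedSum n N (W ω)))} := fun ω hω => by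
    have hω : s < completedSum n N (W ω) := hω
    show ENNReal.ofReal _ ≤ ENNReal.ofReal _
    gcongr
  refine (measure_mono hsub).trans ?_
  refine (meas_ge_le_lintegral_div (by fun_prop)
    (by simpa using Real.exp_pos _) ENNReal.ofReal_ne_top).trans ?_
  calc _ ≤ ENNReal.ofReal (2 ^ (ε / (1 + ε)) * Real.exp (ε * κ * (a + 1) / (1 + ε)))
        / ENNReal.ofReal (Real.exp (θ * s)) := by gcongr
    _ = _ := by
      rw [← ENNReal.ofReal_div_of_pos (Real.exp_pos _), mul_div_assoc, ← Real.exp_sub]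
      congr 3; ring

end RandomSum

/-! ### Choice of parameters and the bounded Bernstein inequality. -/

section Bernstein

/-- For cycle lengths of mean 1/ρ and second moment at most 2d², this says that the rate 2κρ(1 +
y/18) pushes the Laplace transform below e^{-2κ}. The surplus y/18 pays for the quadratic term,
because the second entry of M(ε) gives 144(ρd)²κ ≤ y². -/
lemma bernstein_param_laplace {ρ d ε M v θ y κ : ℝ} (hε0 : 0 < ε) (hε1 : ε < 1)
    (hρ : 0 < ρ) (hv : 0 ≤ v) (hMd : 12 * ρ * d * (1 + ε) * √v / ε ≤ M)
    (hd : 1 ≤ ρ * d) (hy : y = θ * M) (hy0 : 0 ≤ y) (hy1 : y ≤ 1)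
    (hκ : κ = (1 + ε) ^ 2 * θ ^ 2 * v / (2 * ε * (1 - y / 2))) :
    -(2 * κ * ρ * (1 + y / 18) * ρ⁻¹)
      + (2 * κ * ρ * (1 + y / 18)) ^ 2 / 2 * (2 * d ^ 2) ≤ -(2 * κ) := by
  have hy2 : 0 < 1 - y / 2 := by linarith
  have hκ0 : 0 ≤ κ := by rw [hκ]; positivity
  have hκ1 : κ * (2 * ε * (1 - y / 2)) = (1 + ε) ^ 2 * θ ^ 2 * v := by
    rw [hκ]
    exact div_mul_cancel₀ _ (by positivity)
  have h144 : 144 * (ρ * d) ^ 2 * (1 + ε) ^ 2 * v ≤ ε ^ 2 * M ^ 2 := by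
    rw [div_le_iff₀ hε0] at hMd
    have h1 : 0 ≤ 12 * ρ * d * (1 + ε) * √v := by
      have : 0 ≤ ρ * d := by linarith
      have : 0 ≤ 12 * (ρ * d) * (1 + ε) * √v := by positivity
      linarith
    have h2 := mul_self_le_mul_self h1 hMd
    have h3 := Real.mul_self_sqrt hv
    calc 144 * (ρ * d) ^ 2 * (1 + ε) ^ 2 * v = 144 * (ρ * d) ^ 2 * (1 + ε) ^ 2 * (√v * √v) := by
          rw [h3]
      _ = _ := by ring
      _ ≤ _ := h2
      _ = _ := by ring
  have h1 : κ * ε ≤ (1 + ε) ^ 2 * θ ^ 2 * v := by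
    rw [← hκ1]; nlinarith [mul_nonneg hκ0 hε0.le]
  have h2 : 144 * (ρ * d) ^ 2 * κ ≤ y ^ 2 := by
    have h3 : ε * (144 * (ρ * d) ^ 2 * κ) ≤ ε * (ε * y ^ 2) := by
      calc ε * (144 * (ρ * d) ^ 2 * κ) = 144 * (ρ * d) ^ 2 * (κ * ε) := by ring
        _ ≤ 144 * (ρ * d) ^ 2 * ((1 + ε) ^ 2 * θ ^ 2 * v) := by gcongr
        _ = θ ^ 2 * (144 * (ρ * d) ^ 2 * (1 + ε) ^ 2 * v) := by ring
        _ ≤ θ ^ 2 * (ε ^ 2 * M ^ 2) := by gcongr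
        _ = ε * (ε * y ^ 2) := by rw [hy]; ring
    have h4 := le_of_mul_le_mul_left h3 hε0
    nlinarith [sq_nonneg y]
  have h5 : 2 * κ * (ρ * d) ^ 2 * (1 + y / 18) ^ 2 ≤ y / 18 := by
    calc 2 * κ * (ρ * d) ^ 2 * (1 + y / 18) ^ 2 = (144 * (ρ * d) ^ 2 * κ) / 72 * (1 + y / 18) ^ 2 := by
          ring
      _ ≤ y ^ 2 / 72 * 2 := by
          gcongr
          nlinarith
      _ ≤ y / 18 := by nlinarith
  have h6 : -(2 * κ * ρ * (1 + y / 18) * ρ⁻¹)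
      + (2 * κ * ρ * (1 + y / 18)) ^ 2 / 2 * (2 * d ^ 2)
      = -(2 * κ) * (1 + y / 18) + 2 * κ * (2 * κ * (ρ * d) ^ 2 * (1 + y / 18) ^ 2) := by
    field_simp
  rw [h6]
  nlinarith [mul_le_mul_of_nonneg_left h5 (by linarith : (0 : ℝ) ≤ 2 * κ)]

/-- Outside the trivial range s² ≥ L, hence M ≤ s. Then the surplus y/18 costs at most Ms/18 and the
additive 1 at most Ms/12, less than the Ms/2 available in L(1 - y/2). -/
lemma bernstein_param_exponent {ρ d ε M v s L θ y κ : ℝ} {n : ℕ} (hε0 : 0 < ε) (hε1 : ε < 1)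
    (hρ : 0 < ρ) (hv : 0 ≤ v) (hM : 0 ≤ M) (hMd : 12 * ρ * d * (1 + ε) * √v / ε ≤ M)
    (hd : 1 ≤ ρ * d) (hs : 0 < s) (hL : L = (1 + ε) * v * ρ * n + M * s) (hLpos : 0 < L)
    (hbig : 2 * Real.log 2 < s ^ 2 / L) (hθ : θ = s / L) (hy : y = θ * M)
    (hκ : κ = (1 + ε) ^ 2 * θ ^ 2 * v / (2 * ε * (1 - y / 2))) :
    -(θ * s) + ε * κ * (ρ * n * (1 + y / 18) + 1) / (1 + ε) ≤ -(s ^ 2 / (2 * L)) := by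
  have hyL : y * L = M * s := by rw [hy, hθ]; field_simp
  have hA0 : 0 ≤ (1 + ε) * v * ρ * n := by positivity
  have hMs : 0 ≤ M * s := by positivity
  have hθ0 : 0 < θ := by rw [hθ]; positivity
  have hy0 : 0 ≤ y := by rw [hy]; positivity
  have hy1 : y ≤ 1 := by
    by_contra h
    have h := not_le.1 h
    nlinarith
  have hy2 : 0 < 1 - y / 2 := by linarith
  have hsM : M ≤ s := by
    rw [lt_div_iff₀ hLpos] at hbig
    have h1 := Real.log_two_gt_d9
    have h2 : L ≤ s ^ 2 := by nlinarith
    have h3 : M * s ≤ s * s := by nlinarith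
    exact le_of_mul_le_mul_right h3 hs
  have hrv : 12 * ((1 + ε) * v) ≤ M * s := by
    rw [div_le_iff₀ hε0] at hMd
    have h0 : 0 ≤ (1 + ε) * √v := by positivity
    have h1 : 12 * ((1 + ε) * √v) ≤ M := by
      have : 12 * ((1 + ε) * √v) ≤ 12 * ρ * d * (1 + ε) * √v := by
        have := mul_le_mul_of_nonneg_right hd h0
        linarith
      nlinarith
    have h3 := Real.mul_self_sqrt hv
    have h4 : 0 ≤ √v := Real.sqrt_nonneg v
    have h5 : √v ≤ M := by nlinarith
    calc 12 * ((1 + ε) * v) = 12 * ((1 + ε) * √v) * √v := by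
          rw [mul_assoc, mul_assoc, h3]
      _ ≤ M * M := by gcongr
      _ ≤ M * s := by gcongr
  have hmain : (1 + ε) * v * (ρ * n * (1 + y / 18) + 1) ≤ L * (1 - y / 2) := by
    have h1 : (1 + ε) * v * ρ * n * y ≤ M * s := by
      rw [← hyL, mul_comm y L]
      gcongr
      linarith
    have h2 : L * (1 - y / 2) = (1 + ε) * v * ρ * n + M * s / 2 := by
      rw [mul_sub, mul_one, mul_div_assoc', mul_comm L y, hyL, hL]; ring
    rw [h2]
    nlinarith
  have heq : ε * κ * (ρ * n * (1 + y / 18) + 1) / (1 + ε)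
      = θ ^ 2 / (2 * (1 - y / 2)) * ((1 + ε) * v * (ρ * n * (1 + y / 18) + 1)) := by
    have hr : (1 + ε) ≠ 0 := by positivity
    rw [hκ]
    field_simp
  have hle : ε * κ * (ρ * n * (1 + y / 18) + 1) / (1 + ε) ≤ θ ^ 2 / 2 * L := by
    rw [heq]
    calc _ ≤ θ ^ 2 / (2 * (1 - y / 2)) * (L * (1 - y / 2)) := by gcongr
      _ = _ := by
          have : 2 * (1 - y / 2) ≠ 0 := by positivity
          rw [div_mul_eq_mul_div, div_eq_iff this]; ring
  have h7 : θ ^ 2 / 2 * L = s ^ 2 / (2 * L) := by rw [hθ]; field_simp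
  have h8 : θ * s = 2 * (s ^ 2 / (2 * L)) := by rw [hθ]; field_simp
  rw [h7] at hle
  linarith

variable {Ω : Type*} [MeasurableSpace Ω] {μ : Measure Ω} [IsProbabilityMeasure μ]
  {Z : ℕ → Ω → ℕ × ℝ}

omit [IsProbabilityMeasure μ] in
lemma lintegral_ofReal_exp_sub_le_one {Y : Ω → ℝ} (hY : Measurable Y)
    (hint : Integrable (fun ω => Real.exp (Y ω)) μ) {b : ℝ}
    (h : ∫ ω, Real.exp (Y ω) ∂μ ≤ Real.exp b) :
    ∫⁻ ω, ENNReal.ofReal (Real.exp (Y ω - b)) ∂μ ≤ 1 := by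
  have h1 : ∀ ω, ENNReal.ofReal (Real.exp (Y ω - b))
      = ENNReal.ofReal (Real.exp (-b)) * ENNReal.ofReal (Real.exp (Y ω)) := fun ω => by
    rw [← ENNReal.ofReal_mul (Real.exp_pos _).le, ← Real.exp_add]
    congr 2; ring
  simp only [h1]
  rw [lintegral_const_mul _ (by fun_prop), ← ofReal_integral_eq_lintegral_ofReal hint
    (Filter.Eventually.of_forall fun ω => (Real.exp_pos _).le),
    ← ENNReal.ofReal_mul (Real.exp_pos _).le, ENNReal.ofReal_le_one]
  calc _ ≤ Real.exp (-b) * Real.exp b := by gcongr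
    _ = 1 := by rw [← Real.exp_add]; simp

/-- One-sided Bernstein inequality for a sum of bounded centred variables up to the number of
renewals before time `n`. -/
lemma measure_lt_completedSum_le_bernstein (hZ : ∀ i, Measurable (Z i)) (hind : iIndepFun Z μ)
    {U v ρ d ε M s L : ℝ} {n : ℕ} (hU : ∀ i ω, |(Z i ω).2| ≤ U)
    (hmean : ∀ i, ∫ ω, (Z (i + 1) ω).2 ∂μ = 0) (hvar : ∀ i, ∫ ω, (Z (i + 1) ω).2 ^ 2 ∂μ ≤ v)
    (hT1 : ∀ i, Integrable (fun ω => ((Z (i + 1) ω).1 : ℝ)) μ)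
    (hT2 : ∀ i, Integrable (fun ω => ((Z (i + 1) ω).1 : ℝ) ^ 2) μ)
    (hTm : ∀ i, ∫ ω, ((Z (i + 1) ω).1 : ℝ) ∂μ = ρ⁻¹)
    (hTd : ∀ i, ∫ ω, ((Z (i + 1) ω).1 : ℝ) ^ 2 ∂μ ≤ 2 * d ^ 2)
    (hε0 : 0 < ε) (hε1 : ε < 1) (hρ : 0 < ρ) (hv : 0 ≤ v) (hM : 0 ≤ M)
    (hMU : 2 * U * (1 + ε) / 3 ≤ M) (hMd : 12 * ρ * d * (1 + ε) * √v / ε ≤ M)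
    (hd : 1 ≤ ρ * d) (hs : 0 < s) (hL : L = (1 + ε) * v * ρ * n + M * s) (hLpos : 0 < L)
    (hbig : 2 * Real.log 2 < s ^ 2 / L) (N : ℕ) :
    μ {ω | s < completedSum n N (fun k => Z k ω)}
      ≤ ENNReal.ofReal (2 ^ (ε / (1 + ε)) * Real.exp (-(s ^ 2 / (2 * L)))) := by
  -- The minimiser of -θs + θ²L/2.
  obtain ⟨θ, hθ⟩ : ∃ θ, θ = s / L := ⟨_, rfl⟩
  obtain ⟨y, hy⟩ : ∃ y, y = θ * M := ⟨_, rfl⟩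
  -- εκ is Bernstein's bound on the logarithmic moment generating function at (1 + ε)θ, with (1 +
  -- ε)θU/3 relaxed to y/2.
  obtain ⟨κ, hκ⟩ : ∃ κ, κ = (1 + ε) ^ 2 * θ ^ 2 * v / (2 * ε * (1 - y / 2)) := ⟨_, rfl⟩
  have hyL : y * L = M * s := by rw [hy, hθ]; field_simp
  have hA0 : 0 ≤ (1 + ε) * v * ρ * n := by positivity
  have hMs : 0 ≤ M * s := by positivity
  have hθ0 : 0 < θ := by rw [hθ]; positivity
  have hy0 : 0 ≤ y := by rw [hy]; positivity
  have hy1 : y ≤ 1 := by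
    by_contra h
    have h := not_le.1 h
    nlinarith
  have hy2 : 0 < 1 - y / 2 := by linarith
  have hκ0 : 0 ≤ κ := by rw [hκ]; positivity
  have hl0 : 0 ≤ 2 * κ * ρ * (1 + y / 18) := by positivity
  have hZ2 : ∀ i, Measurable fun ω => (Z i ω).2 := fun i => (hZ i).snd
  have hZ1 : ∀ i, Measurable fun ω => ((Z i ω).1 : ℝ) := fun i => by
    have := (hZ i).fst; fun_prop
  have hint : ∀ i, ∫⁻ ω, ENNReal.ofReal (Real.exp
      (2 * κ - 2 * κ * ρ * (1 + y / 18) * (Z (i + 1) ω).1)) ∂μ ≤ 1 := by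
    intro i
    have h1 := integral_exp_neg_le (hZ1 (i + 1)) (fun ω => Nat.cast_nonneg _) (hT1 i) (hT2 i) hl0
    rw [hTm i] at h1
    have h2 : ∫ ω, Real.exp (-(2 * κ * ρ * (1 + y / 18) * (Z (i + 1) ω).1)) ∂μ
        ≤ Real.exp (-(2 * κ)) := by
      refine h1.trans (Real.exp_le_exp.2 (le_trans ?_
        (bernstein_param_laplace hε0 hε1 hρ hv hMd hd hy hy0 hy1 hκ)))
      gcongr
      exact hTd i
    have hI : Integrable (fun ω => Real.exp (-(2 * κ * ρ * (1 + y / 18) * (Z (i + 1) ω).1))) μ := by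
      refine Integrable.of_bound (by have := hZ1 (i + 1); fun_prop) 1
        (Filter.Eventually.of_forall fun ω => ?_)
      rw [Real.norm_eq_abs, Real.abs_exp, Real.exp_le_one_iff]
      have := mul_nonneg hl0 (Nat.cast_nonneg (α := ℝ) (Z (i + 1) ω).1)
      linarith
    have h3 := lintegral_ofReal_exp_sub_le_one (by have := hZ1 (i + 1); fun_prop) hI h2
    refine le_trans (le_of_eq (lintegral_congr fun ω => ?_)) h3
    congr 2; ring
  have hθU : (1 + ε) * θ * U / 3 ≤ y / 2 := by
    have := mul_le_mul_of_nonneg_left hMU hθ0.le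
    rw [hy]
    linarith
  have hint2 : ∀ i, ∫⁻ ω, ENNReal.ofReal (Real.exp
      ((1 + ε) * θ * (Z (i + 1) ω).2 - ε * κ)) ∂μ ≤ 1 := by
    intro i
    have h1 := integral_exp_le_of_abs_le (hZ2 (i + 1)) (hU (i + 1)) (hmean i) (hvar i)
      (θ := (1 + ε) * θ) (by positivity) (by linarith)
    have h2 : ∫ ω, Real.exp ((1 + ε) * θ * (Z (i + 1) ω).2) ∂μ ≤ Real.exp (ε * κ) := by
      refine h1.trans (Real.exp_le_exp.2 ?_)
      have h3 : ε * κ = ((1 + ε) * θ) ^ 2 * v / (2 * (1 - y / 2)) := by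
        rw [hκ]; field_simp
      rw [h3]
      gcongr
    have hI : Integrable (fun ω => Real.exp ((1 + ε) * θ * (Z (i + 1) ω).2)) μ := by
      refine Integrable.of_bound (by have := hZ2 (i + 1); fun_prop) (Real.exp ((1 + ε) * θ * U))
        (Filter.Eventually.of_forall fun ω => ?_)
      rw [Real.norm_eq_abs, Real.abs_exp]
      gcongr
      exact (le_abs_self _).trans (hU _ _)
    exact lintegral_ofReal_exp_sub_le_one (by have := hZ2 (i + 1); fun_prop) hI h2
  have ha : 0 ≤ ρ * n * (1 + y / 18) := by positivity
  refine (measure_lt_completedSum_le hZ hind hl0 hκ0 ha hε0 hθ0.le hint hint2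
    (s := s) (n := n) (by ring) N).trans (ENNReal.ofReal_le_ofReal ?_)
  gcongr
  exact bernstein_param_exponent hε0 hε1 hρ hv hM hMd hd hs hL hLpos hbig hθ hy hκ

/-- Two-sided version of `measure_lt_completedSum_le_bernstein`. -/
lemma measure_lt_abs_completedSum_le_bernstein (hZ : ∀ i, Measurable (Z i)) (hind : iIndepFun Z μ)
    {U v ρ d ε M s L : ℝ} {n : ℕ} (hU : ∀ i ω, |(Z i ω).2| ≤ U)
    (hmean : ∀ i, ∫ ω, (Z (i + 1) ω).2 ∂μ = 0) (hvar : ∀ i, ∫ ω, (Z (i + 1) ω).2 ^ 2 ∂μ ≤ v)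
    (hT1 : ∀ i, Integrable (fun ω => ((Z (i + 1) ω).1 : ℝ)) μ)
    (hT2 : ∀ i, Integrable (fun ω => ((Z (i + 1) ω).1 : ℝ) ^ 2) μ)
    (hTm : ∀ i, ∫ ω, ((Z (i + 1) ω).1 : ℝ) ∂μ = ρ⁻¹)
    (hTd : ∀ i, ∫ ω, ((Z (i + 1) ω).1 : ℝ) ^ 2 ∂μ ≤ 2 * d ^ 2)
    (hε0 : 0 < ε) (hε1 : ε < 1) (hρ : 0 < ρ) (hv : 0 ≤ v) (hM : 0 ≤ M)
    (hMU : 2 * U * (1 + ε) / 3 ≤ M) (hMd : 12 * ρ * d * (1 + ε) * √v / ε ≤ M)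
    (hd : 1 ≤ ρ * d) (hs : 0 < s) (hL : L = (1 + ε) * v * ρ * n + M * s) (hLpos : 0 < L) (N : ℕ) :
    μ {ω | s < |completedSum n N (fun k => Z k ω)|}
      ≤ ENNReal.ofReal (2 ^ (1 + ε / (1 + ε)) * Real.exp (-(s ^ 2 / (2 * L)))) := by
  have h2 : (2 : ℝ) ^ (1 + ε / (1 + ε)) = 2 * 2 ^ (ε / (1 + ε)) := by
    rw [Real.rpow_add (by norm_num), Real.rpow_one]
  -- In the opposite case the right-hand side is at least one.
  by_cases hbig : 2 * Real.log 2 < s ^ 2 / L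
  · set Z' : ℕ → Ω → ℕ × ℝ := fun i ω => ((Z i ω).1, -(Z i ω).2) with hZ'
    have hZ'm : ∀ i, Measurable (Z' i) := fun i => (hZ i).fst.prodMk (hZ i).snd.neg
    have hind' : iIndepFun Z' μ :=
      hind.comp (fun _ x => (x.1, -x.2)) fun _ => by fun_prop
    have h3 := measure_lt_completedSum_le_bernstein hZ hind hU hmean hvar hT1 hT2 hTm hTd hε0 hε1
      hρ hv hM hMU hMd hd hs hL hLpos hbig N
    have h4 := measure_lt_completedSum_le_bernstein hZ'm hind' (v := v)
      (fun i ω => by simpa [hZ'] using hU i ω)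
      (fun i => by simp only [hZ', integral_neg, hmean i, neg_zero])
      (fun i => by simpa [hZ'] using hvar i) hT1 hT2 hTm hTd hε0 hε1
      hρ hv hM hMU hMd hd hs hL hLpos hbig N
    have hneg : ∀ ω, completedSum n N (fun k => Z' k ω) = -completedSum n N (fun k => Z k ω) := by
      classical
      intro ω
      simp only [completedSum, ← Finset.sum_neg_distrib]
      refine Finset.sum_congr rfl fun i _ => ?_
      by_cases h : (fun k => Z k ω) ∈ completed n i
      · have h' : (fun k => Z' k ω) ∈ completed n i := h
        rw [if_pos h, if_pos h']
      · have h' : (fun k => Z' k ω) ∉ completed n i := h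
        rw [if_neg h, if_neg h', neg_zero]
    simp only [hneg] at h4
    have hsub : {ω | s < |completedSum n N (fun k => Z k ω)|}
        ⊆ {ω | s < completedSum n N (fun k => Z k ω)}
          ∪ {ω | s < -completedSum n N (fun k => Z k ω)} := by
      intro ω hω
      rcases lt_abs.1 hω.out with h | h
      · exact Or.inl h
      · exact Or.inr h
    refine (measure_mono hsub).trans ((measure_union_le _ _).trans ((add_le_add h3 h4).trans ?_))
    rw [← ENNReal.ofReal_add (by positivity) (by positivity), h2]
    refine ENNReal.ofReal_le_ofReal (le_of_eq (by ring))
  · refine prob_le_one.trans ?_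
    rw [← ENNReal.ofReal_one]
    refine ENNReal.ofReal_le_ofReal ?_
    have h5 : s ^ 2 / (2 * L) ≤ Real.log 2 := by
      have := not_lt.1 hbig
      rw [mul_comm, ← div_div]
      linarith
    have h6 : Real.exp (-Real.log 2) ≤ Real.exp (-(s ^ 2 / (2 * L))) := by gcongr
    rw [Real.exp_neg, Real.exp_log (by norm_num)] at h6
    have h7 : (1 : ℝ) ≤ 2 ^ (ε / (1 + ε)) := Real.one_le_rpow (by norm_num) (by positivity)
    rw [h2]
    nlinarith

end Bernstein

/-! ### Moments from exponential integrability. -/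

section Moments

lemma exists_pow_le_exp_rpow {α c : ℝ} (hα : 0 < α) (hc : 0 < c) (k : ℕ) :
    ∃ K, 0 ≤ K ∧ ∀ x : ℝ, |x| ^ k ≤ K * Real.exp (|x| ^ α / c ^ α) := by
  -- For u ≥ 1 this gives u^k ≤ (u^α)^m, which m! · exp(u^α) dominates.
  obtain ⟨m, hm⟩ := exists_nat_ge ((k : ℝ) / α)
  refine ⟨c ^ k * (m.factorial + 1), by positivity, fun x => ?_⟩
  set u := |x| / c with hu
  have hu0 : 0 ≤ u := by positivity
  have hx : |x| = c * u := by rw [hu]; field_simp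
  have hy0 : 0 ≤ u ^ α := by positivity
  have hdiv : |x| ^ α / c ^ α = u ^ α := by rw [hu, Real.div_rpow (abs_nonneg x) hc.le]
  rw [hdiv, hx, mul_pow, mul_assoc]
  gcongr
  have hexp : 1 ≤ Real.exp (u ^ α) := Real.one_le_exp hy0
  have hm0 : (0 : ℝ) < m.factorial := by positivity
  rcases le_total u 1 with h1 | h1
  · have : u ^ k ≤ 1 := pow_le_one₀ hu0 h1
    nlinarith
  · have h2 : u ^ k ≤ (u ^ α) ^ m := by
      rw [← Real.rpow_natCast u k, ← Real.rpow_natCast (u ^ α) m, ← Real.rpow_mul hu0]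
      refine Real.rpow_le_rpow_of_exponent_le h1 ?_
      rwa [div_le_iff₀ hα, mul_comm] at hm
    have h3 := Real.pow_div_factorial_le_exp (u ^ α) hy0 m
    rw [div_le_iff₀ hm0] at h3
    nlinarith

variable {Ω : Type*} [MeasurableSpace Ω] {μ : Measure Ω}

lemma integrable_pow_of_lintegral_exp_rpow {α c : ℝ} (hα : 0 < α) (hc : 0 < c) {Y : Ω → ℝ}
    (hY : Measurable Y) (h : ∫⁻ ω, ENNReal.ofReal (Real.exp (|Y ω| ^ α / c ^ α)) ∂μ ≤ 2) (k : ℕ) :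
    Integrable (fun ω => Y ω ^ k) μ := by
  obtain ⟨K, hK0, hK⟩ := exists_pow_le_exp_rpow hα hc k
  have h1 : Integrable (fun ω => Real.exp (|Y ω| ^ α / c ^ α)) μ := by
    have hm : Measurable fun ω => Real.exp (|Y ω| ^ α / c ^ α) := by fun_prop
    refine ⟨hm.aestronglyMeasurable, ?_⟩
    rw [hasFiniteIntegral_iff_ofReal (Filter.Eventually.of_forall fun ω => (Real.exp_pos _).le)]
    exact h.trans_lt (by norm_num)
  refine (h1.const_mul K).mono' (by fun_prop) (Filter.Eventually.of_forall fun ω => ?_)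
  rw [Real.norm_eq_abs, abs_pow]
  exact hK _

/-- First and second moments of a nonnegative variable of finite exponential moment. -/
lemma integral_le_of_lintegral_exp_div [IsProbabilityMeasure μ] {d : ℝ} (hd : 0 < d) {T : Ω → ℝ}
    (hT : Measurable T) (hT0 : ∀ ω, 0 ≤ T ω)
    (h : ∫⁻ ω, ENNReal.ofReal (Real.exp (|T ω| ^ (1 : ℝ) / d ^ (1 : ℝ))) ∂μ ≤ 2) :
    Integrable T μ ∧ Integrable (fun ω => T ω ^ 2) μ ∧ ∫ ω, T ω ∂μ ≤ d
      ∧ ∫ ω, T ω ^ 2 ∂μ ≤ 2 * d ^ 2 := by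
  have hI1 : Integrable T μ := by
    simpa using integrable_pow_of_lintegral_exp_rpow one_pos hd hT h 1
  have hI2 := integrable_pow_of_lintegral_exp_rpow one_pos hd hT h 2
  -- Three terms of the series of e^{T/d}; each of the two nonnegative moment terms is then at most
  -- 1.
  have hle : ∫ ω, (1 + T ω / d + T ω ^ 2 / (2 * d ^ 2)) ∂μ ≤ 2 := by
    rw [integral_eq_lintegral_of_nonneg_ae (Filter.Eventually.of_forall fun ω => by
      have := hT0 ω; positivity) (by fun_prop)]
    refine ENNReal.toReal_le_of_le_ofReal zero_le_two (le_trans (lintegral_mono fun ω => ?_)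
      (h.trans (by simp)))
    refine ENNReal.ofReal_le_ofReal ?_
    have := Real.quadratic_le_exp_of_nonneg (div_nonneg (hT0 ω) hd.le)
    rw [Real.rpow_one, Real.rpow_one, abs_of_nonneg (hT0 ω)]
    refine le_trans (le_of_eq ?_) this
    rw [div_pow, div_div, mul_comm 2]
  rw [integral_add (by fun_prop) (by fun_prop), integral_add (by fun_prop) (by fun_prop),
    integral_div, integral_div] at hle
  simp only [integral_const, probReal_univ, smul_eq_mul, mul_one] at hle
  have h1 : 0 ≤ ∫ ω, T ω ∂μ := integral_nonneg hT0
  have h2 : 0 ≤ ∫ ω, T ω ^ 2 ∂μ := integral_nonneg fun ω => sq_nonneg _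
  have h3 : 0 ≤ (∫ ω, T ω ∂μ) / d := by positivity
  have h4 : 0 ≤ (∫ ω, T ω ^ 2 ∂μ) / (2 * d ^ 2) := by positivity
  refine ⟨hI1, hI2, ?_, ?_⟩
  · rw [← div_le_one hd]; linarith
  · rw [← div_le_one (by positivity)]; linarith

end Moments

/-! ### Truncation of unbounded cycle sums. -/

section Truncation

/-- The part of `x` inside `[-B, B]`. -/
noncomputable def innerPart (B x : ℝ) : ℝ := if B < |x| then 0 else x

@[fun_prop]
lemma measurable_innerPart (B : ℝ) : Measurable (innerPart B) :=
  Measurable.ite (measurableSet_lt measurable_const (by fun_prop)) measurable_const measurable_id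

lemma abs_innerPart_le {B : ℝ} (hB : 0 ≤ B) (x : ℝ) : |innerPart B x| ≤ B := by
  unfold innerPart
  split_ifs with h
  · simpa using hB
  · exact not_lt.1 h

lemma abs_sub_innerPart (B x : ℝ) : |x - innerPart B x| = tailPart B x := by
  unfold innerPart tailPart
  split_ifs <;> simp

lemma innerPart_sq_le (B x : ℝ) : innerPart B x ^ 2 ≤ x ^ 2 := by
  unfold innerPart
  split_ifs
  · simpa using sq_nonneg x
  · exact le_rfl

variable {Ω : Type*} [MeasurableSpace Ω] {μ : Measure Ω} [IsProbabilityMeasure μ]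
  {Z : ℕ → Ω → ℕ × ℝ}

/-- Bernstein inequality for a sum of centred variables with a stretched exponential moment, up to
the number of renewals before time `n`. -/
lemma measure_lt_abs_completedSum_le (hZ : ∀ i, Measurable (Z i)) (hind : iIndepFun Z μ)
    {α c v ρ d ε M l B r s L : ℝ} {n : ℕ} (hα0 : 0 < α) (hα1 : α ≤ 1) (hc : 0 < c) (hl : 1 ≤ l)
    (hB : B = c * (3 * (α ^ 2)⁻¹ * l) ^ (1 / α)) (hn : (n : ℝ) ≤ Real.exp l)
    (hexp : ∀ i, ∫⁻ ω, ENNReal.ofReal (Real.exp (|(Z (i + 1) ω).2| ^ α / c ^ α)) ∂μ ≤ 2)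
    (hmean : ∀ i, ∫ ω, (Z (i + 1) ω).2 ∂μ = 0) (hvar : ∀ i, ∫ ω, (Z (i + 1) ω).2 ^ 2 ∂μ ≤ v)
    (hT1 : ∀ i, Integrable (fun ω => ((Z (i + 1) ω).1 : ℝ)) μ)
    (hT2 : ∀ i, Integrable (fun ω => ((Z (i + 1) ω).1 : ℝ) ^ 2) μ)
    (hTm : ∀ i, ∫ ω, ((Z (i + 1) ω).1 : ℝ) ∂μ = ρ⁻¹)
    (hTd : ∀ i, ∫ ω, ((Z (i + 1) ω).1 : ℝ) ^ 2 ∂μ ≤ 2 * d ^ 2)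
    (hε0 : 0 < ε) (hε1 : ε < 1) (hρ : 0 < ρ) (hv : 0 ≤ v)
    (hMB : 4 * B * (1 + ε) / 3 ≤ M) (hMd : 12 * ρ * d * (1 + ε) * √v / ε ≤ M)
    (hd : 1 ≤ ρ * d) (hr : 0 ≤ r) (hs : 0 < s) (hL : L = (1 + ε) * v * ρ * n + M * s) :
    μ {ω | r + s < |completedSum n n (fun k => Z k ω)|}
      ≤ ENNReal.ofReal (Real.exp (3 - r ^ α / (2 * c ^ α)))
        + ENNReal.ofReal (2 ^ (1 + ε / (1 + ε)) * Real.exp (-(s ^ 2 / (2 * L)))) := by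
  classical
  have hB0 : 0 < B := by rw [hB]; positivity
  have hM : 0 < M := lt_of_lt_of_le (by positivity) hMB
  have hLpos : 0 < L := by rw [hL]; positivity
  have hZ2 : ∀ i, Measurable fun ω => (Z i ω).2 := fun i => (hZ i).snd
  have hX : ∀ i, Integrable (fun ω => (Z (i + 1) ω).2) μ := fun i => by
    simpa using integrable_pow_of_lintegral_exp_rpow hα0 hc (hZ2 (i + 1)) (hexp i) 1
  have hX2 : ∀ i, Integrable (fun ω => (Z (i + 1) ω).2 ^ 2) μ := fun i =>
    integrable_pow_of_lintegral_exp_rpow hα0 hc (hZ2 (i + 1)) (hexp i) 2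
  have hm0 : ∀ i, Measurable fun ω => innerPart B (Z i ω).2 := fun i =>
    (measurable_innerPart B).comp (hZ2 i)
  have hI : ∀ i, Integrable (fun ω => innerPart B (Z i ω).2) μ := fun i =>
    Integrable.of_bound (hm0 i).aestronglyMeasurable B
      (Filter.Eventually.of_forall fun ω => abs_innerPart_le hB0.le _)
  have hI2 : ∀ i, Integrable (fun ω => innerPart B (Z i ω).2 ^ 2) μ := fun i =>
    Integrable.of_bound ((hm0 i).pow_const 2).aestronglyMeasurable (B ^ 2)
      (Filter.Eventually.of_forall fun ω => by
        rw [Real.norm_eq_abs, abs_pow]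
        have := abs_innerPart_le hB0.le (Z i ω).2
        gcongr)
  set m : ℕ → ℝ := fun i => ∫ ω, innerPart B (Z i ω).2 ∂μ with hm
  have hmB : ∀ i, |m i| ≤ B := fun i => by
    have := norm_integral_le_of_norm_le_const (μ := μ) (f := fun ω => innerPart B (Z i ω).2)
      (Filter.Eventually.of_forall fun ω => abs_innerPart_le hB0.le _)
    simpa using this
  -- Only the values are truncated and recentred. The lengths are kept, so the same cycles are
  -- completed.
  set Z' : ℕ → Ω → ℕ × ℝ := fun i ω => ((Z i ω).1, innerPart B (Z i ω).2 - m i) with hZ'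
  have hZ'm : ∀ i, Measurable (Z' i) := fun i =>
    (hZ i).fst.prodMk (by have := hZ2 i; fun_prop)
  have hind' : iIndepFun Z' μ :=
    hind.comp (fun i x => (x.1, innerPart B x.2 - m i)) fun _ => by fun_prop
  set e := 2 * c * Real.exp (-(l / α)) with he
  have he0 : 0 ≤ e := by positivity
  -- As the full value has mean zero, the mean of the inner part is minus that of the removed part.
  -- Index 0 never enters the sum.
  have hme : ∀ i, |m (i + 1)| ≤ e := fun i => by
    have h1 : m (i + 1) = -∫ ω, ((Z (i + 1) ω).2 - innerPart B (Z (i + 1) ω).2) ∂μ := by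
      rw [integral_sub (hX i) (hI (i + 1)), hmean i]; simp [hm]
    rw [h1, abs_neg]
    refine (abs_integral_le_integral_abs).trans ?_
    simp only [abs_sub_innerPart]
    rw [integral_eq_lintegral_of_nonneg_ae
      (Filter.Eventually.of_forall fun ω => tailPart_nonneg _ _)
      ((measurable_tailPart B).comp (hZ2 (i + 1))).aestronglyMeasurable]
    exact ENNReal.toReal_le_of_le_ofReal he0
      (lintegral_tailPart_le hα0 hα1 hc hl hB (hZ2 (i + 1)) (hexp i))
  have hsum : ∀ ω, |completedSum n n (fun k => Z k ω)| ≤ |completedSum n n (fun k => Z' k ω)|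
      + ∑ i ∈ Finset.range n, (tailPart B (Z (i + 1) ω).2 + e) := fun ω => by
    have h1 : |completedSum n n (fun k => Z k ω) - completedSum n n (fun k => Z' k ω)|
        ≤ ∑ i ∈ Finset.range n, (tailPart B (Z (i + 1) ω).2 + e) := by
      simp only [completedSum, ← Finset.sum_sub_distrib]
      refine (Finset.abs_sum_le_sum_abs _ _).trans (Finset.sum_le_sum fun i _ => ?_)
      have h0 := tailPart_nonneg B (Z (i + 1) ω).2
      by_cases h : (fun k => Z k ω) ∈ completed n i
      · have h' : (fun k => Z' k ω) ∈ completed n i := h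
        rw [if_pos h, if_pos h', ← abs_sub_innerPart]
        simp only [hZ']
        rw [← sub_add]
        exact (abs_add_le _ _).trans (by have := hme i; gcongr)
      · have h' : (fun k => Z' k ω) ∉ completed n i := h
        rw [if_neg h, if_neg h', sub_zero, abs_zero]
        positivity
    have h2 := abs_sub_abs_le_abs_sub (completedSum n n fun k => Z k ω)
      (completedSum n n fun k => Z' k ω)
    linarith
  have htail := measure_lt_sum_tailPart_le hα0 hα1 hc hl hB (X := fun i ω => (Z (i + 1) ω).2)
    (fun i => hZ2 (i + 1))
    ((hind.precomp (g := fun i => i + 1) (add_left_injective 1)).comp (fun _ x => x.2)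
      fun _ => measurable_snd)
    hexp hn he0 le_rfl hr
  -- Recentring doubles the bound to 2B, whence the 4 in the first entry of M(ε); it does not
  -- increase the second moment.
  have hmain := measure_lt_abs_completedSum_le_bernstein hZ'm hind' (U := 2 * B) (v := v)
    (fun i ω => by
      simp only [hZ']
      have := abs_sub (innerPart B (Z i ω).2) (m i)
      have := abs_innerPart_le hB0.le (Z i ω).2
      have := hmB i
      linarith)
    (fun i => by
      simp only [hZ']
      rw [integral_sub (hI (i + 1)) (integrable_const _)]
      simp [hm])
    (fun i => by
      have h0 : ∫ ω, (Z' (i + 1) ω).2 ^ 2 ∂μ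
          = ∫ ω, innerPart B (Z (i + 1) ω).2 ^ 2 ∂μ - 2 * m (i + 1) * m (i + 1) + m (i + 1) ^ 2 := by
        simp only [hZ', sub_sq]
        rw [integral_add (f := fun ω => innerPart B (Z (i + 1) ω).2 ^ 2
            - 2 * innerPart B (Z (i + 1) ω).2 * m (i + 1))
          ((hI2 (i + 1)).sub (((hI (i + 1)).const_mul 2).mul_const _)) (integrable_const _),
          integral_sub (hI2 (i + 1)) (((hI (i + 1)).const_mul 2).mul_const _),
          integral_mul_const, integral_const_mul]
        simp [hm]
      have h1 : ∫ ω, innerPart B (Z (i + 1) ω).2 ^ 2 ∂μ ≤ ∫ ω, (Z (i + 1) ω).2 ^ 2 ∂μ :=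
        integral_mono (hI2 (i + 1)) (hX2 i) fun ω => innerPart_sq_le _ _
      have h2 := hvar i
      rw [h0]
      nlinarith [sq_nonneg (m (i + 1))])
    hT1 hT2 hTm hTd hε0 hε1 hρ hv hM.le (by linarith) hMd hd hs hL hLpos n
  refine (measure_mono fun ω hω => ?_).trans
    ((measure_union_le {ω | r < ∑ i ∈ Finset.range n, (tailPart B (Z (i + 1) ω).2 + e)}
      {ω | s < |completedSum n n (fun k => Z' k ω)|}).trans (add_le_add htail hmain))
  by_contra hcon
  simp only [Set.mem_union, Set.mem_ofPred_eq, not_or, not_lt] at hcon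
  have h1 : r + s < |completedSum n n (fun k => Z k ω)| := hω
  have h2 := hsum ω
  linarith

end Truncation

/-! ### Splitting the deviation event. -/

section Decomposition

variable {S : Type*}

lemma completedSum_cycleData (f : S → ℝ) (n : ℕ) (w : ℕ → S × Bool) :
    completedSum n n (fun k => cycleData f k w)
      = ∑ i ∈ Finset.range n, (if cycleStart (i + 1) w ≤ n then cycleSum f (nextCycle^[i + 1] w)
          else 0) := by
  classical
  refine Finset.sum_congr rfl fun i _ => ?_
  by_cases h : cycleStart (i + 1) w ≤ n
  · have h' : (fun k => cycleData f k w) ∈ completed n i := h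
    rw [if_pos h, if_pos h']; rfl
  · have h' : (fun k => cycleData f k w) ∉ completed n i := h
    rw [if_neg h, if_neg h']

/-- Without a regeneration before n the sum is a piece of the first cycle. Otherwise t = t/p/2 +
t/p/2 + t/q, and one of the three terms of the decomposition exceeds its share. -/
lemma lt_abs_sum_range_imp {w : ℕ → S × Bool} (hw : Regenerates w) (f : S → ℝ) {p q t : ℝ}
    (hp : 1 < p) (hpq : p⁻¹ + q⁻¹ = 1) (ht : 0 ≤ t) {n : ℕ}
    (h : t < |∑ k ∈ Finset.range n, f (w k).1|) :
    t / p / 2 < firstBlockAbs f w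
      ∨ (w ∉ Minorization.noRegen S n ∧ t / p / 2 < firstBlockAbs f (shift n w))
      ∨ t / q < |completedSum n n (fun k => cycleData f k w)| := by
  have htp : t / p / 2 ≤ t := by
    have : t / p ≤ t := div_le_self ht hp.le
    have : 0 ≤ t / p := by positivity
    linarith
  by_cases hn : w ∈ Minorization.noRegen S n
  · have h1 := abs_sum_range_le_firstBlockAbs f ((lt_cycleLength_iff hw.exists n).2 hn)
    exact Or.inl (by linarith)
  · by_contra! hcon
    obtain ⟨h1, h2, h3⟩ := hcon
    have h2 := h2 hn
    rw [completedSum_cycleData] at h3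
    rw [sum_range_eq_cycles hw] at h
    have h4 := abs_sub (cycleSum f w + ∑ i ∈ Finset.range n,
      (if cycleStart (i + 1) w ≤ n then cycleSum f (nextCycle^[i + 1] w) else 0))
      (cycleSum f (shift n w))
    have h5 := abs_add_le (cycleSum f w) (∑ i ∈ Finset.range n,
      (if cycleStart (i + 1) w ≤ n then cycleSum f (nextCycle^[i + 1] w) else 0))
    have h6 := abs_cycleSum_le f w
    have h7 := abs_cycleSum_le f (shift n w)
    have h8 : t = t / p + t / q := by
      rw [div_eq_mul_inv, div_eq_mul_inv, ← mul_add, hpq, mul_one]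
    linarith

end Decomposition

/-! ### Means and moments of a cycle. -/

namespace Minorization

variable {S : Type*} [MeasurableSpace S] {P : Kernel S S} [IsMarkovKernel P] (D : Minorization P)

omit [IsMarkovKernel P] in
lemma split_atom_ne_zero {π : Measure S} (hC : 0 < π D.C) : D.split π D.atom ≠ 0 := by
  have hat : MeasurableSet D.atom := D.measurableSet_C.prod (measurableSet_singleton true)
  have h : D.split π D.atom = D.δ * π D.C := by
    rw [← lintegral_indicator_one hat, D.lintegral_split π (measurable_one.indicator hat),
      ← setLIntegral_const, ← lintegral_indicator D.measurableSet_C]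
    refine lintegral_congr fun x => ?_
    by_cases hx : x ∈ D.C
    · simp [atom, hx, D.regenProb_of_mem hx]
    · simp [atom, hx]
  rw [h]
  exact mul_ne_zero (by simpa using D.δ_pos.ne') hC.ne'

/-- Passing to the next cycle preserves the law started from ν^*, so the second cycle may be
replaced by the first. -/
lemma lintegral_blockSum_zero (hreg : ∀ (μ : Measure S) [IsProbabilityMeasure μ],
      ∀ᵐ w ∂(D.splitLaw μ), Regenerates w) {f : S → ℝ} (hf : Measurable f) {φ : ℝ → ℝ≥0∞}
    (hφ : Measurable φ) :
    ∫⁻ w, φ (blockSum f 0 w) ∂(D.splitLaw D.ν) = ∫⁻ w, φ (cycleSum f w) ∂(D.splitLaw D.ν) := by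
  have hm : Measurable fun w : ℕ → S × Bool => φ (cycleSum f w) := hφ.comp (measurable_cycleSum hf)
  conv_rhs => rw [← D.map_nextCycle D.ν (hreg D.ν), lintegral_map hm measurable_nextCycle]
  refine lintegral_congr_ae ?_
  filter_upwards [hreg D.ν] with w hw
  rw [blockSum_zero_eq hw]

lemma paramC_eq_psiNorm_cycleSum (hreg : ∀ (μ : Measure S) [IsProbabilityMeasure μ],
      ∀ᵐ w ∂(D.splitLaw μ), Regenerates w) {f : S → ℝ} (hf : Measurable f) (α : ℝ) :
    D.paramC α f = psiNorm α (D.splitLaw D.ν) (cycleSum f) := by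
  refine iInf_congr fun c => iInf_congr fun _ => ?_
  rw [D.lintegral_blockSum_zero hreg hf
    (φ := fun y => ENNReal.ofReal (Real.exp (|y| ^ α / c ^ α))) (by fun_prop)]

lemma identDistrib_cycleData {f : S → ℝ} (hf : Measurable f)
    (hreg : ∀ (μ : Measure S) [IsProbabilityMeasure μ], ∀ᵐ w ∂(D.splitLaw μ), Regenerates w)
    (μ : Measure S) [IsProbabilityMeasure μ] (i : ℕ) :
    IdentDistrib (cycleData f (i + 1)) (cycleData f 0) (D.splitLaw μ) (D.splitLaw D.ν) where
  aemeasurable_fst := (measurable_cycleData hf _).aemeasurable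
  aemeasurable_snd := (measurable_cycleData hf _).aemeasurable
  map_eq := D.map_cycleData_succ hf hreg μ i

/-- Kac's formula: the occupation formula for the constant 1. -/
lemma integral_cycleLength {π : Measure S} [IsProbabilityMeasure π] (hinv : P.Invariant π)
    (hreg : ∀ (μ : Measure S) [IsProbabilityMeasure μ], ∀ᵐ w ∂(D.splitLaw μ), Regenerates w) :
    ∫ w, (cycleLength w : ℝ) ∂(D.splitLaw D.ν) = (D.split π D.atom).toReal⁻¹ := by
  have h := D.lintegral_cycle hinv hreg (g := fun _ => 1) measurable_const
  simp only [Finset.sum_const, Finset.card_range, nsmul_eq_mul, mul_one, lintegral_const,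
    measure_univ] at h
  have hm : Measurable fun w : ℕ → S × Bool => (cycleLength w : ℝ) := by
    have := measurable_cycleLength (S := S); fun_prop
  rw [integral_eq_lintegral_of_nonneg_ae (Filter.Eventually.of_forall fun w => Nat.cast_nonneg _)
    hm.aestronglyMeasurable]
  simp only [ENNReal.ofReal_natCast]
  have h' := congrArg ENNReal.toReal h
  rw [ENNReal.toReal_mul, ENNReal.toReal_one] at h'
  exact eq_inv_of_mul_eq_one_right h'

/-- The occupation formula is applied to the positive and negative parts of f: π-integrability makes
both means finite, and π(f) = 0 makes them equal. -/
lemma integral_cycleSum_eq_zero {π : Measure S} [IsProbabilityMeasure π] (hinv : P.Invariant π)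
    (hreg : ∀ (μ : Measure S) [IsProbabilityMeasure μ], ∀ᵐ w ∂(D.splitLaw μ), Regenerates w)
    (hpos : D.split π D.atom ≠ 0) {f : S → ℝ} (hf : Measurable f) (hint : Integrable f π)
    (hmean : ∫ x, f x ∂π = 0) : ∫ w, cycleSum f w ∂(D.splitLaw D.ν) = 0 := by
  have hkey : ∀ {g : S → ℝ}, Measurable g → Integrable g π →
      Integrable (cycleSum fun x => max (g x) 0) (D.splitLaw D.ν)
      ∧ ENNReal.ofReal (∫ w, cycleSum (fun x => max (g x) 0) w ∂(D.splitLaw D.ν))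
        = (D.split π D.atom)⁻¹ * ∫⁻ x, ENNReal.ofReal (g x) ∂π := by
    intro g hg hgi
    have h := D.lintegral_cycle hinv hreg (g := fun x => ENNReal.ofReal (g x)) (by fun_prop)
    have hsum : ∀ w : ℕ → S × Bool, ∑ k ∈ Finset.range (cycleLength w), ENNReal.ofReal (g (w k).1)
        = ENNReal.ofReal (cycleSum (fun x => max (g x) 0) w) := fun w => by
      rw [cycleSum, ENNReal.ofReal_sum_of_nonneg fun _ _ => le_max_right _ _]
      exact Finset.sum_congr rfl fun k _ => by rw [ENNReal.ofReal_max]; simp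
    simp only [hsum] at h
    have h0 : ∀ w : ℕ → S × Bool, 0 ≤ cycleSum (fun x => max (g x) 0) w := fun w =>
      Finset.sum_nonneg fun _ _ => le_max_right _ _
    have h1 : ∫⁻ w, ENNReal.ofReal (cycleSum (fun x => max (g x) 0) w) ∂(D.splitLaw D.ν)
        = (D.split π D.atom)⁻¹ * ∫⁻ x, ENNReal.ofReal (g x) ∂π := by
      rw [← h, ← mul_assoc, ENNReal.inv_mul_cancel hpos (measure_ne_top _ _), one_mul]
    have hI : Integrable (cycleSum fun x => max (g x) 0) (D.splitLaw D.ν) := by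
      refine ⟨(measurable_cycleSum (by fun_prop)).aestronglyMeasurable, ?_⟩
      rw [hasFiniteIntegral_iff_ofReal (Filter.Eventually.of_forall h0), h1]
      refine ENNReal.mul_lt_top (ENNReal.inv_lt_top.2 (pos_iff_ne_zero.2 hpos)) ?_
      refine lt_of_le_of_lt (lintegral_mono fun x => ?_) hgi.2
      exact Real.ofReal_le_enorm _
    exact ⟨hI, by rw [ofReal_integral_eq_lintegral_ofReal hI (Filter.Eventually.of_forall h0), h1]⟩
  obtain ⟨hI1, h1⟩ := hkey hf hint
  obtain ⟨hI2, h2⟩ := hkey hf.neg hint.neg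
  have heq : ∫⁻ x, ENNReal.ofReal (f x) ∂π = ∫⁻ x, ENNReal.ofReal (-f x) ∂π := by
    rw [integral_eq_lintegral_pos_part_sub_lintegral_neg_part hint, sub_eq_zero] at hmean
    refine (ENNReal.toReal_eq_toReal_iff' ?_ ?_).1 hmean
    · exact (lt_of_le_of_lt (lintegral_mono fun x => Real.ofReal_le_enorm _) hint.2).ne
    · exact (lt_of_le_of_lt (lintegral_mono fun x => Real.ofReal_le_enorm _) hint.neg.2).ne
  have hsub : ∀ w : ℕ → S × Bool, cycleSum f w
      = cycleSum (fun x => max (f x) 0) w - cycleSum (fun x => max ((-f) x) 0) w := fun w => by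
    simp only [cycleSum, ← Finset.sum_sub_distrib]
    refine Finset.sum_congr rfl fun k _ => ?_
    rw [Pi.neg_apply]
    rcases le_total (f (w k).1) 0 with h | h
    · rw [max_eq_right h, max_eq_left (by linarith)]; ring
    · rw [max_eq_left h, max_eq_right (by linarith)]; ring
  simp only [hsub]
  rw [integral_sub hI1 hI2, sub_eq_zero]
  have h0 : ∀ g : S → ℝ, 0 ≤ ∫ w, cycleSum (fun x => max (g x) 0) w ∂(D.splitLaw D.ν) := fun g =>
    integral_nonneg fun w => Finset.sum_nonneg fun _ _ => le_max_right _ _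
  refine (ENNReal.ofReal_eq_ofReal_iff (h0 _) (h0 _)).1 ?_
  rw [h1, h2, heq]
  rfl

/-- A function whose first block has a stretched exponential moment is integrable. -/
lemma integrable_of_paramB_lt_top {π : Measure S} [IsProbabilityMeasure π] {α : ℝ} (hα : 0 < α)
    {f : S → ℝ} (hf : Measurable f) (hb : D.paramB α f π < ∞) : Integrable f π := by
  obtain ⟨c, hc, hlt⟩ : ∃ c : ℝ, 0 < c ∧ D.paramB α f π < ENNReal.ofReal c := by
    refine ⟨(D.paramB α f π).toReal + 1, by positivity, ?_⟩
    rw [ENNReal.lt_ofReal_iff_toReal_lt hb.ne]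
    linarith
  have h1 := lintegral_exp_le_two_of_psiNorm_lt hα hc hlt
  have h2 := integrable_pow_of_lintegral_exp_rpow hα hc (measurable_firstBlockAbs hf) h1 1
  simp only [pow_one] at h2
  have h3 : Integrable (fun w : ℕ → S × Bool => f (w 0).1) (D.splitLaw π) := by
    refine h2.mono' (by
      have : Measurable fun w : ℕ → S × Bool => f (w 0).1 := by fun_prop
      exact this.aestronglyMeasurable) (Filter.Eventually.of_forall fun w => ?_)
    exact Finset.single_le_sum (f := fun k => |f (w k).1|) (fun _ _ => abs_nonneg _)
      (Finset.mem_range.2 (cycleLength_pos w))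
  have h4 : (D.splitLaw π).map (fun w => (w 0).1) = π := by
    have hcomp : (fun w : ℕ → S × Bool => (w 0).1) = Prod.fst ∘ fun w => w 0 := rfl
    rw [hcomp, ← Measure.map_map measurable_fst (by fun_prop), splitLaw, map_eval_zero_chainLaw,
      map_fst_split]
  have hm : Measurable fun w : ℕ → S × Bool => (w 0).1 := by fun_prop
  rw [← h4, integrable_map_measure hf.aestronglyMeasurable hm.aemeasurable]
  exact h3

end Minorization

/-! ### Passage to extended constants and assembly. -/

lemma ofReal_rpow_div_two_mul_rpow {α : ℝ} (hα : 0 < α) (s : ℝ) (a : ℝ≥0∞) :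
    ENNReal.ofReal s ^ α / (2 * a) ^ α = (ENNReal.ofReal (s / 2) / a) ^ α := by
  rw [← ENNReal.div_rpow_of_nonneg _ _ hα.le]
  congr 1
  rw [ENNReal.ofReal_div_of_pos two_pos, ENNReal.ofReal_ofNat, div_eq_mul_inv, div_eq_mul_inv,
    div_eq_mul_inv, ENNReal.mul_inv (by simp) (by simp), mul_assoc]

lemma two_mul_ofReal_add_eq {a v ρ M s : ℝ} (ha : 0 ≤ a) (hv : 0 ≤ v) (hρ : 0 ≤ ρ) (hM : 0 ≤ M)
    (hs : 0 ≤ s) (n : ℕ) :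
    2 * (ENNReal.ofReal a * (ENNReal.ofReal ρ * ENNReal.ofReal v) * n
        + ENNReal.ofReal M * ENNReal.ofReal s)
      = ENNReal.ofReal (2 * (a * v * ρ * n + M * s)) := by
  rw [ENNReal.ofReal_mul zero_le_two, ENNReal.ofReal_ofNat,
    ENNReal.ofReal_add (by positivity) (by positivity), ENNReal.ofReal_mul hM,
    ENNReal.ofReal_mul (by positivity), ENNReal.ofReal_mul (by positivity),
    ENNReal.ofReal_mul ha, ENNReal.ofReal_natCast]
  ring

namespace Minorization

variable {S : Type*} [MeasurableSpace S] {P : Kernel S S} [IsMarkovKernel P] (D : Minorization P)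

lemma paramM_eq_ofReal {π : Measure S} {α c ρ d v ε : ℝ} {f : S → ℝ} (n : ℕ) (hc0 : 0 ≤ c)
    (hd0 : 0 ≤ d) (hρ0 : 0 ≤ ρ) (hv0 : 0 ≤ v) (hε0 : 0 < ε) (hc : D.paramC α f = ENNReal.ofReal c)
    (hd : D.paramD = ENNReal.ofReal d) (hρ : D.split π D.atom = ENNReal.ofReal ρ)
    (hv : D.blockVar f = ENNReal.ofReal v) :
    D.paramM π α f n ε = ENNReal.ofReal (max
      (4 * (c * (3 * (α ^ 2)⁻¹ * Real.log (max (n : ℝ) (Real.exp 1))) ^ (1 / α)) * (1 + ε) / 3)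
      (12 * ρ * d * (1 + ε) * √v / ε)) := by
  rw [paramM, hc, hd, hρ, hv, ENNReal.ofReal_max, ENNReal.ofReal_rpow_of_nonneg hv0 (by norm_num),
    ← Real.sqrt_eq_rpow]
  have h4 : (4 : ℝ≥0∞) = ENNReal.ofReal 4 := by simp
  have h3 : (3 : ℝ≥0∞) = ENNReal.ofReal 3 := by simp
  have h12 : (12 : ℝ≥0∞) = ENNReal.ofReal 12 := by simp
  congr 1
  · rw [h4, h3, ← ENNReal.ofReal_mul (by positivity), ← ENNReal.ofReal_mul (by positivity),
      ← ENNReal.ofReal_mul' (by positivity), ← ENNReal.ofReal_div_of_pos (by positivity)]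
    congr 1; ring
  · rw [h12, ← ENNReal.ofReal_mul (by positivity), ← ENNReal.ofReal_mul (by positivity),
      ← ENNReal.ofReal_mul (by positivity), ← ENNReal.ofReal_mul (by positivity),
      ← ENNReal.ofReal_div_of_pos hε0]

/-- Concentration of the sum of the complete cycles. -/
lemma measure_lt_abs_completedSum_cycleData_le {π : Measure S} [IsProbabilityMeasure π]
    (hinv : P.Invariant π)
    (hreg : ∀ (μ : Measure S) [IsProbabilityMeasure μ], ∀ᵐ w ∂(D.splitLaw μ), Regenerates w)
    (hpos : D.split π D.atom ≠ 0) (hgeo : D.IsGeometricallyErgodic) {α : ℝ} (hα0 : 0 < α)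
    (hα1 : α ≤ 1) {f : S → ℝ} (hf : Measurable f) (hc : D.paramC α f < ∞) (hint : Integrable f π)
    (hmean : ∫ y, f y ∂π = 0) (μ : Measure S) [IsProbabilityMeasure μ] {ε : ℝ} (hε0 : 0 < ε)
    (hε1 : ε < 1) (n : ℕ) {r s : ℝ} (hr : 0 ≤ r) (hs : 0 < s) :
    D.splitLaw μ {w | r + s < |completedSum n n (fun k => cycleData f k w)|}
      ≤ ENNReal.ofReal (Real.exp 8)
          * expNeg (ENNReal.ofReal r ^ α / (2 * D.paramC α f ^ α))
        + ENNReal.ofReal (2 ^ (1 + ε / (1 + ε)))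
          * expNeg (ENNReal.ofReal (s ^ 2)
            / (2 * (ENNReal.ofReal (1 + ε) * D.asympVar π f * n
              + D.paramM π α f n ε * ENNReal.ofReal s))) := by
  have hident := D.identDistrib_cycleData hf hreg μ
  have hcs := measurable_cycleSum hf
  have hcl := measurable_cycleLength (S := S)
  -- If c = 0, all cycles after the first have sum zero almost surely and the event is null;
  -- otherwise c can be used as a divisor.
  rcases eq_or_ne (D.paramC α f) 0 with hc0 | hc0
  · have h0 : ∀ᵐ w ∂(D.splitLaw D.ν), (cycleData f 0 w).2 = 0 :=
      ae_eq_zero_of_psiNorm_eq_zero (Y := cycleSum f) hα0 hcs (by rw [← D.paramC_eq_psiNorm_cycleSum hreg hf, hc0])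
    have h1 : ∀ᵐ w ∂(D.splitLaw μ), ∀ i, (cycleData f (i + 1) w).2 = 0 :=
      ae_all_iff.2 fun i => (hident i).symm.ae_snd (p := fun z => z.2 = 0)
        (measurable_snd (measurableSet_singleton 0)) h0
    refine le_of_eq_of_le ?_ zero_le
    refine measure_mono_null (fun w hw => ?_) (ae_iff.1 h1)
    intro hz
    have hw : r + s < |completedSum n n (fun k => cycleData f k w)| := hw
    simp only [completedSum, hz, ite_self, Finset.sum_const_zero, abs_zero] at hw
    linarith
  obtain ⟨c, hcdef⟩ : ∃ c, c = (D.paramC α f).toReal := ⟨_, rfl⟩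
  have hcpos : 0 < c := hcdef ▸ ENNReal.toReal_pos hc0 hc.ne
  have hceq : D.paramC α f = ENNReal.ofReal c := by
    rw [hcdef, ENNReal.ofReal_toReal hc.ne]
  have hexp : ∫⁻ w, ENNReal.ofReal (Real.exp (|cycleSum f w| ^ α / c ^ α)) ∂(D.splitLaw D.ν) ≤ 2 :=
    lintegral_exp_psiNorm_le_two hα0 hcs hcpos
      (by rw [← D.paramC_eq_psiNorm_cycleSum hreg hf, hceq])
  obtain ⟨ρ, hρdef⟩ : ∃ ρ, ρ = (D.split π D.atom).toReal := ⟨_, rfl⟩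
  have hρpos : 0 < ρ := hρdef ▸ ENNReal.toReal_pos hpos (measure_ne_top _ _)
  have hρeq : D.split π D.atom = ENNReal.ofReal ρ := by
    rw [hρdef, ENNReal.ofReal_toReal (measure_ne_top _ _)]
  have hTm : Measurable fun w : ℕ → S × Bool => (cycleLength w : ℝ) := by fun_prop
  have hparamD : D.paramD = psiNorm 1 (D.splitLaw D.ν) fun w => (cycleLength w : ℝ) := by
    simp only [paramD, cycleLength, Nat.cast_add, Nat.cast_one]
  obtain ⟨d, hddef⟩ : ∃ d, d = D.paramD.toReal := ⟨_, rfl⟩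
  have hd0 : D.paramD ≠ 0 := fun h => by
    rw [hparamD] at h
    obtain ⟨w, hw⟩ := (ae_eq_zero_of_psiNorm_eq_zero one_pos hTm h).exists
    exact (cycleLength_pos w).ne' (by exact_mod_cast hw)
  have hdpos : 0 < d := hddef ▸ ENNReal.toReal_pos hd0 hgeo.ne
  have hdeq : D.paramD = ENNReal.ofReal d := by
    rw [hddef, ENNReal.ofReal_toReal hgeo.ne]
  obtain ⟨hT1, hT2, hTle, hTd⟩ := integral_le_of_lintegral_exp_div hdpos hTm
    (fun w => Nat.cast_nonneg _)
    (lintegral_exp_psiNorm_le_two one_pos hTm hdpos (by rw [← hparamD, hdeq]))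
  have hTi := D.integral_cycleLength hinv hreg
  rw [← hρdef] at hTi
  -- The mean cycle length 1/ρ is at most d.
  have hρd : 1 ≤ ρ * d := by
    rw [hTi, inv_le_iff_one_le_mul₀ hρpos] at hTle
    linarith
  obtain ⟨v, hvdef⟩ : ∃ v, v = ∫ w, cycleSum f w ^ 2 ∂(D.splitLaw D.ν) := ⟨_, rfl⟩
  have hv0 : 0 ≤ v := hvdef ▸ integral_nonneg fun w => sq_nonneg _
  have hveq : D.blockVar f = ENNReal.ofReal v := by
    rw [blockVar, D.lintegral_blockSum_zero hreg hf (φ := fun y => ENNReal.ofReal (y ^ 2))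
      (by fun_prop), hvdef, ofReal_integral_eq_lintegral_ofReal
      (integrable_pow_of_lintegral_exp_rpow hα0 hcpos hcs hexp 2)
      (Filter.Eventually.of_forall fun w => sq_nonneg _)]
  obtain ⟨l, hldef⟩ : ∃ l, l = Real.log (max (n : ℝ) (Real.exp 1)) := ⟨_, rfl⟩
  have hmax : 0 < max (n : ℝ) (Real.exp 1) := lt_max_of_lt_right (Real.exp_pos 1)
  have hl : 1 ≤ l := by
    rw [hldef, Real.le_log_iff_exp_le hmax]; exact le_max_right _ _
  have hn : (n : ℝ) ≤ Real.exp l := by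
    rw [hldef, Real.exp_log hmax]; exact le_max_left _ _
  have hMeq := D.paramM_eq_ofReal n hcpos.le hdpos.le hρpos.le hv0 hε0 hceq hdeq hρeq hveq
  rw [← hldef] at hMeq
  obtain ⟨M, hM⟩ : ∃ M, M = max (4 * (c * (3 * (α ^ 2)⁻¹ * l) ^ (1 / α)) * (1 + ε) / 3)
    (12 * ρ * d * (1 + ε) * √v / ε) := ⟨_, rfl⟩
  rw [← hM] at hMeq
  have hMpos : 0 < M := hM ▸ lt_max_of_lt_left (by positivity)
  have hTfun : Measurable fun z : ℕ × ℝ => (z.1 : ℝ) := by fun_prop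
  have hE1 : ∀ i, ∫⁻ w, ENNReal.ofReal (Real.exp (|(cycleData f (i + 1) w).2| ^ α / c ^ α))
      ∂(D.splitLaw μ) ≤ 2 := fun i =>
    (((hident i).comp (u := fun z : ℕ × ℝ => ENNReal.ofReal (Real.exp (|z.2| ^ α / c ^ α)))
      (by fun_prop)).lintegral_eq).trans_le hexp
  have hE2 : ∀ i, ∫ w, (cycleData f (i + 1) w).2 ∂(D.splitLaw μ) = 0 := fun i =>
    ((hident i).comp measurable_snd).integral_eq.trans
      (D.integral_cycleSum_eq_zero hinv hreg hpos hf hint hmean)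
  have hE3 : ∀ i, ∫ w, (cycleData f (i + 1) w).2 ^ 2 ∂(D.splitLaw μ) ≤ v := fun i => by
    rw [hvdef]
    exact ((hident i).comp (u := fun z : ℕ × ℝ => z.2 ^ 2) (by fun_prop)).integral_eq.le
  have hE4 : ∀ i, Integrable (fun w => ((cycleData f (i + 1) w).1 : ℝ)) (D.splitLaw μ) := fun i =>
    ((hident i).comp hTfun).integrable_iff.2 hT1
  have hE5 : ∀ i, Integrable (fun w => ((cycleData f (i + 1) w).1 : ℝ) ^ 2) (D.splitLaw μ) :=
    fun i => ((hident i).comp (hTfun.pow_const 2)).integrable_iff.2 hT2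
  have hE6 : ∀ i, ∫ w, ((cycleData f (i + 1) w).1 : ℝ) ∂(D.splitLaw μ) = ρ⁻¹ := fun i =>
    ((hident i).comp hTfun).integral_eq.trans hTi
  have hE7 : ∀ i, ∫ w, ((cycleData f (i + 1) w).1 : ℝ) ^ 2 ∂(D.splitLaw μ) ≤ 2 * d ^ 2 := fun i =>
    ((hident i).comp (hTfun.pow_const 2)).integral_eq.trans_le hTd
  have hmain := measure_lt_abs_completedSum_le (fun i => measurable_cycleData hf i)
    (D.iIndepFun_cycleData hf hreg μ) hα0 hα1 hcpos hl rfl hn hE1 hE2 hE3 hE4 hE5 hE6 hE7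
    hε0 hε1 hρpos hv0 (hM ▸ le_max_left _ _) (hM ▸ le_max_right _ _) hρd hr hs rfl
  refine hmain.trans (add_le_add ?_ ?_)
  · have hrc : ENNReal.ofReal r ^ α / (2 * D.paramC α f ^ α)
        = ENNReal.ofReal (r ^ α / (2 * c ^ α)) := by
      rw [hceq, ENNReal.ofReal_rpow_of_nonneg hr hα0.le, ENNReal.ofReal_rpow_of_pos hcpos,
        ENNReal.ofReal_div_of_pos (by positivity), ENNReal.ofReal_mul zero_le_two,
        ENNReal.ofReal_ofNat]
    -- The truncation estimate has constant e³, well below e⁸.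
    rw [hrc, expNeg_ofReal (by positivity), ← ENNReal.ofReal_mul (by positivity), ← Real.exp_add]
    gcongr
    linarith
  · rw [hMeq, asympVar, hρeq, hveq,
      two_mul_ofReal_add_eq (by positivity) hv0 hρpos.le hMpos.le hs.le,
      ← ENNReal.ofReal_div_of_pos (by positivity), expNeg_ofReal (by positivity),
      ← ENNReal.ofReal_mul (by positivity)]

end Minorization

end MarkovBernstein

theorem mainTheorem4 {S : Type*} [MeasurableSpace S] [MeasurableSpace.CountablyGenerated S]
    (P : Kernel S S) [IsMarkovKernel P] (π : Measure S) [IsProbabilityMeasure π]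
    (hinv : P.Invariant π) (hHarris : IsHarrisRecurrent P π)
    (D : Minorization P) (hC : 0 < π D.C) (hgeo : D.IsGeometricallyErgodic)
    (α : ℝ) (hα0 : 0 < α) (hα1 : α ≤ 1)
    (f : S → ℝ) (hf : Measurable f) (x : S)
    (ha : D.paramA α f x < ∞) (hb : D.paramB α f π < ∞) (hc : D.paramC α f < ∞)
    (hmean : ∫ y, f y ∂π = 0)
    (p q : ℝ) (hp : 1 < p) (hq : 1 < q) (hpq : p⁻¹ + q⁻¹ = 1)
    (ε : ℝ) (hε0 : 0 < ε) (hε1 : ε < 1) (n : ℕ) (t : ℝ) (ht : 0 ≤ t) :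
    chainLaw P (Measure.dirac x) {ω | t < |∑ i ∈ Finset.range n, f (ω i)|}
      ≤ 2 * expNeg (ENNReal.ofReal (t / p) ^ α / (2 * D.paramA α f x) ^ α)
        + 2 * (D.split π D.atom)⁻¹
          * expNeg (ENNReal.ofReal (t / p) ^ α / (2 * D.paramB α f π) ^ α)
        + ENNReal.ofReal (Real.exp 8)
          * expNeg (ENNReal.ofReal (t / (p * q)) ^ α / (2 * D.paramC α f ^ α))
        + ENNReal.ofReal (2 ^ (1 + ε / (1 + ε)))
          * expNeg (ENNReal.ofReal (t ^ 2 / q ^ 4)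
            / (2 * (ENNReal.ofReal (1 + ε) * D.asympVar π f * n
              + D.paramM π α f n ε * ENNReal.ofReal (t / q ^ 2)))) := by
  rw [ofReal_rpow_div_two_mul_rpow hα0, ofReal_rpow_div_two_mul_rpow hα0]
  rcases ht.eq_or_lt with rfl | ht0
  -- For t = 0 the first term alone exceeds one.
  · have h1 : (1 : ℝ≥0∞) ≤ 2 * expNeg ((ENNReal.ofReal (0 / p / 2) / D.paramA α f x) ^ α) := by
      simp [ENNReal.zero_rpow_of_pos hα0, expNeg_zero]
    refine (h1.trans' ?_).trans ((le_self_add.trans le_self_add).trans le_self_add)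
    have := Measure.isProbabilityMeasure_map (μ := D.splitLaw (Measure.dirac x))
      (f := fun (w : ℕ → S × Bool) k => (w k).1)
      (measurable_pi_lambda _ fun _ => by fun_prop).aemeasurable
    rw [← D.map_fst_splitLaw]
    exact prob_le_one
  have hreg : ∀ (μ : Measure S) [IsProbabilityMeasure μ],
      ∀ᵐ w ∂(D.splitLaw μ), Regenerates w := fun μ _ => D.ae_frequently_regen hHarris hC μ
  have hpos := D.split_atom_ne_zero hC
  have hpm : Measurable fun (w : ℕ → S × Bool) k => (w k).1 :=
    measurable_pi_lambda _ fun _ => by fun_prop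
  have hF : Measurable (firstBlockAbs f : (ℕ → S × Bool) → ℝ) := measurable_firstBlockAbs hf
  have hs1 : 0 ≤ t / p / 2 := by positivity
  set F := {w : ℕ → S × Bool | t / p / 2 < |firstBlockAbs f w|} with hFdef
  have hFm : MeasurableSet F := measurableSet_lt measurable_const (by fun_prop)
  set H := {w : ℕ → S × Bool | t / q < |completedSum n n (fun k => cycleData f k w)|} with hHdef
  have hsub : D.splitLaw (Measure.dirac x) {w | t < |∑ i ∈ Finset.range n, f (w i).1|}
      ≤ D.splitLaw (Measure.dirac x) (F ∪ ((Minorization.noRegen S n)ᶜ ∩ shift n ⁻¹' F) ∪ H) := by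
    refine measure_mono_ae ?_
    filter_upwards [hreg (Measure.dirac x)] with w hw hwt
    rcases lt_abs_sum_range_imp hw f hp hpq ht hwt with h | ⟨h, h'⟩ | h
    · exact Or.inl (Or.inl (h.trans_le (le_abs_self _)))
    · exact Or.inl (Or.inr ⟨h, h'.trans_le (le_abs_self _)⟩)
    · exact Or.inr h
  have hA := measure_lt_abs_le_psiNorm (μ := D.splitLaw (Measure.dirac x)) hα0 hF hs1
  have hB := (D.measure_compl_noRegen_inter_shift_le hinv hpos (Measure.dirac x) n hFm).trans
    (mul_le_mul_right (measure_lt_abs_le_psiNorm (μ := D.splitLaw π) hα0 hF hs1) _)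
  have hq0 : 0 < q := by linarith
  have hH := D.measure_lt_abs_completedSum_cycleData_le hinv hreg hpos hgeo hα0 hα1 hf hc
    (D.integrable_of_paramB_lt_top hα0 hf hb) hmean (Measure.dirac x) hε0 hε1 n
    (r := t / (p * q)) (s := t / q ^ 2) (by positivity) (by positivity)
  -- The share t/q is divided in proportion 1/p to 1/q between the removed and the truncated parts.
  have hrs : t / (p * q) + t / q ^ 2 = t / q := by
    have : t / (p * q) + t / q ^ 2 = t / q * (p⁻¹ + q⁻¹) := by field_simp
    rw [this, hpq, mul_one]
  rw [hrs, div_pow, ← pow_mul] at hH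
  have hS : MeasurableSet {ω : ℕ → S | t < |∑ i ∈ Finset.range n, f (ω i)|} :=
    measurableSet_lt measurable_const (by fun_prop)
  rw [← D.map_fst_splitLaw, Measure.map_apply hpm hS]
  refine hsub.trans ((measure_union_le _ _).trans ?_)
  rw [add_assoc (_ + _)]
  refine add_le_add ((measure_union_le _ _).trans (add_le_add hA (hB.trans (le_of_eq ?_)))) hH
  rw [← mul_assoc, mul_comm _ (2 : ℝ≥0∞)]
  rfl
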